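/- Let $n>2$ be an integer, and let $M_0,M_1,N,m$ be real numbers with $m>0$. There exist constants $\beta>0$ and $C$, depending only on $n,M_0,M_1,N,m$, with the following property. Let $\Omega\subset\mathbb R^n$ be a bounded open set (for instance a bounded domain with smooth boundary), let $\psi\in C^{1,1}(\overline\Omega\times\mathbb R\times\mathbb R^n)$ (that is, $\psi$ is continuous, it is differentiable in $\Omega\times\mathbb R\times\mathbb R^n$, and for every $R$ both $\psi$ and its derivative are bounded and the derivative is Lipschitz on $\Omega\times[-R,R]\times\{|p|\le R\}$) with $\psi>0$, and let $u\in C^4(\Omega)\cap C^2(\overline\Omega)$ be a solution of $$\sigma_{n-1}(\lambda(\nabla^2u))=\psi(x,u,\nabla u)\ \text{ in }\Omega,\qquad u=0\ \text{ on }\partial\Omega,$$ which is admissible, that is, the vector $\lambda(\nabla^2u(x))$ of the eigenvalues of the Hessian lies in $$\Gamma_{n-1}=\{\lambda\in\mathbb R^n:\ \sigma_i(\lambda)>0\ \text{ for } 1\le i\le n-1\},\qquad \sigma_k(\lambda)=\sum_{1\le i_1<\dots<i_k\le n}\lambda_{i_1}\cdots\lambda_{i_k},$$ for every $x\in\Omega$.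 Suppose that $\sup_\Omega|u|\le M_0$, that $\sup_\Omega|\nabla u|\le M_1$, that $\inf_{x\in\Omega}\psi(x,u(x),\nabla u(x))\ge m$, and that $|\psi|$, $|D\psi|$ and the Lipschitz constant of $D\psi$ are at most $N$ on $\Omega\times[-M_0,M_0]\times\{p\in\mathbb R^n:|p|\le M_1\}$ (here the norm on $\mathbb R^n\times\mathbb R\times\mathbb R^n$ is the maximum of the norms of the three components, $|D\psi|$ is the corresponding dual norm). Then $u<0$ in $\Omega$ and $$(-u(x))^{\beta}\,|\nabla^2u(x)|\le C\qquad\text{for all }x\in\Omega ,$$ where $|\nabla^2 u|=\big(\sum_{i,j}u_{ij}^2\big)^{1/2}$. -/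

import Mathlib

open scoped Gradient

namespace HessianEq

/-- Euclidean space `ℝⁿ`. -/
abbrev E (n : ℕ) : Type := EuclideanSpace ℝ (Fin n)

/-- The elementary symmetric function `σ_k(λ)`, the sum of the products of `k` entries of `λ`. -/
def sigma {n : ℕ} (k : ℕ) (l : Fin n → ℝ) : ℝ :=
  ∑ s ∈ Finset.powersetCard k (Finset.univ : Finset (Fin n)), ∏ i ∈ s, l i

/-- The Garding cone `Γ_k`. -/
def gardingCone (n k : ℕ) : Set (Fin n → ℝ) :=
  {l | ∀ i : ℕ, 1 ≤ i → i ≤ k → 0 < sigma i l}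

/-- The Hessian matrix `∇²u(x)`, with entries the second partial derivatives of `u` at `x`. -/
noncomputable def hessian {n : ℕ} (u : E n → ℝ) (x : E n) : Matrix (Fin n) (Fin n) ℝ :=
  Matrix.of fun i j =>
    fderiv ℝ (fderiv ℝ u) x (EuclideanSpace.single i 1) (EuclideanSpace.single j 1)

/-- The Hessian matrix of a `C²` function is symmetric. -/
theorem hessian_isHermitian {n : ℕ} {u : E n → ℝ} {x : E n} (hu : ContDiffAt ℝ 2 u x) :
    (hessian u x).IsHermitian := by
  have h : IsSymmSndFDerivAt ℝ u x := hu.isSymmSndFDerivAt (by simp)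
  ext i j
  simpa [hessian, Matrix.conjTranspose_apply] using h _ _

open Classical in
/-- The eigenvalues, counted with multiplicity, of a symmetric real matrix
(the value `0` for a matrix that is not symmetric is never used). -/
noncomputable def eigenvaluesOf {n : ℕ} (A : Matrix (Fin n) (Fin n) ℝ) : Fin n → ℝ :=
  if h : A.IsHermitian then h.eigenvalues else 0

/-- The Euclidean (Hilbert-Schmidt) norm `|A| = (∑ a_{ij}²)^{1/2}` of a matrix. -/
noncomputable def matNorm {n : ℕ} (A : Matrix (Fin n) (Fin n) ℝ) : ℝ :=
  Real.sqrt (∑ i, ∑ j, A i j ^ 2)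

/-- `u ∈ C²(Ω̄)`: `u` is continuous on `Ω̄`, twice continuously differentiable in `Ω`, and its
first and second derivatives extend continuously from `Ω` to `Ω̄`. -/
def IsC2UpToBoundary {n : ℕ} (Ω : Set (E n)) (u : E n → ℝ) : Prop :=
  ContDiffOn ℝ 2 u Ω ∧ ContinuousOn u (closure Ω) ∧
    (∃ g : E n → (E n →L[ℝ] ℝ), ContinuousOn g (closure Ω) ∧ Set.EqOn (fderiv ℝ u) g Ω) ∧
    (∃ g : E n → (E n →L[ℝ] E n →L[ℝ] ℝ), ContinuousOn g (closure Ω) ∧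
      Set.EqOn (fderiv ℝ (fderiv ℝ u)) g Ω)

/-- The set of all `(x, z, p)` with `x ∈ Ω`, `|z| ≤ R`, `|p| ≤ S`. -/
def box {n : ℕ} (Ω : Set (E n)) (R S : ℝ) : Set (E n × ℝ × E n) :=
  {q | q.1 ∈ Ω ∧ |q.2.1| ≤ R ∧ ‖q.2.2‖ ≤ S}

/-- The `C^{1,1}` norm of `ψ` on the set `D` is at most `N`: `ψ`, its derivative, and the Lipschitz
constant of its derivative are bounded by `N` on `D`. For a `C²` function on a convex set the last
bound says that the second derivative is bounded by `N`. -/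
def C11NormLE {n : ℕ} (ψ : E n × ℝ × E n → ℝ) (D : Set (E n × ℝ × E n)) (N : ℝ) : Prop :=
  (∀ q ∈ D, |ψ q| ≤ N) ∧ (∀ q ∈ D, ‖fderiv ℝ ψ q‖ ≤ N) ∧
    (∀ q ∈ D, ∀ q' ∈ D, ‖fderiv ℝ ψ q - fderiv ℝ ψ q'‖ ≤ N * ‖q - q'‖)

/-- `ψ ∈ C^{1,1}(Ω̄ × ℝ × ℝⁿ)`: `ψ` is continuous on `Ω̄ × ℝ × ℝⁿ`, differentiable in
`Ω × ℝ × ℝⁿ`, and its `C^{1,1}` norm is finite on `Ω × [-R, R] × {|p| ≤ R}` for every `R`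
(so that the derivative extends continuously to `Ω̄ × ℝ × ℝⁿ`). -/
def IsC11 {n : ℕ} (Ω : Set (E n)) (ψ : E n × ℝ × E n → ℝ) : Prop :=
  ContinuousOn ψ (closure Ω ×ˢ Set.univ) ∧ (∀ q, q.1 ∈ Ω → DifferentiableAt ℝ ψ q) ∧
    ∀ R : ℝ, ∃ N : ℝ, C11NormLE ψ (box Ω R R) N

end HessianEq

set_option maxSynthPendingDepth 3

/-! ### Quadratic forms behind the concavity inequality -/

namespace HessianEq

/-! The estimate is of Pogorelov type: the maximum principle is applied to `(-u)^β * exp (A/2 *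
|∇u|²) * λ_max(∇²u)`, which vanishes on the boundary. Its maximum is taken over points and unit
directions (`exists_maximum`), so λ_max is never differentiated. At the maximum point, moving along
an eigenvector while tilting the top eigendirection gives first- and second-order conditions
containing the extra good term `4/3 * ∑ T²/λ₁²` (`maximum_conditions`), where `T` denotes third
derivatives with one index in the top direction. Summing these conditions against the positive
derivatives of σ_{n-1} and inserting the differentiated equation (`equation_conditions`) leaves bad
third-order terms `∑ σ^{ii} u_{11i}²/λ₁²` to be absorbed.

The absorption rests on a concavity inequality for σ_{n-1}, with a definite gain δ: `(1+δ) σ^{11}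
ξ₁²` is at most `-λ₁ ∑ σ^{pp,qq} ξ_p ξ_q + 5/4 ∑_{i≠1} σ^{ii} ξ_i²` on the tangent space of the
level set (`concavity_of_tangent`). In Γ_{n-1} at most one entry, the smallest `l j`, is
nonpositive. In the logarithmic coordinates `ξ_c / l c`, `c ≠ j`, with `ξ j` eliminated by tangency,
the inequality becomes a family of forms in one parameter `t = l j * ∑ 1/l c > -1`
(`logForm_nonneg`). The forms at `t = -1` and `t = 0` and those with `t ≥ 1` are treated by
Cauchy–Schwarz, and the others by interpolation. General directions follow by subtracting a multiple
of `l` (`concavity`), and the off-diagonal third derivatives are controlled by divided differences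
of σ_{n-1} (`third_order`).

The gain δ also pays for the gradient term of `β * log(-u)` once β is large, while `A * ∑ σ^{ii}
λ_i²`, which is at least a multiple of `λ₁`, absorbs everything else (`top_le`). The result is a
bound for `λ₁ * (-u)` at the maximum point, hence for the test function everywhere. -/

theorem quadratic_nonneg {a b c : ℝ} (ha : 0 < a) (h : b ^ 2 ≤ a * c) (x y : ℝ) :
    0 ≤ a * x ^ 2 - 2 * b * (x * y) + c * y ^ 2 := by
  have h3 : 0 ≤ a * (a * x ^ 2 - 2 * b * (x * y) + c * y ^ 2) := by
    have e : a * (a * x ^ 2 - 2 * b * (x * y) + c * y ^ 2)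
      = (a * x - b * y) ^ 2 + (a * c - b ^ 2) * y ^ 2 := by ring
    rw [e]
    exact add_nonneg (sq_nonneg _) (mul_nonneg (by linarith) (sq_nonneg _))
  exact nonneg_of_mul_nonneg_right h3 ha

/-- A discriminant computation in `(Y, w)`: the determinant is `p` times a cubic that is nonnegative
on `(0, 1/2]`. -/
theorem binary_form_zero {p : ℝ} (hp : 0 < p) (hph : p ≤ 1 / 2) (Y w : ℝ) :
    (Y - w) ^ 2 / 4 ≤ (1 - 5 / 4 * p) * (Y - (p * Y + w)) ^ 2 + (1 + 2 * p) * w ^ 2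
      - (p * Y + w) ^ 2 + 5 / 4 * p * Y ^ 2 := by
  have hα : 0 < (1 - 5 / 4 * p) * (1 - p) ^ 2 - p ^ 2 + 5 / 4 * p - 1 / 4 := by nlinarith
  have hdet : (1 - 5 / 4 * p * (1 - p) - 1 / 4) ^ 2 ≤
      ((1 - 5 / 4 * p) * (1 - p) ^ 2 - p ^ 2 + 5 / 4 * p - 1 / 4) *
        (1 + 3 / 4 * p - 1 / 4) := by
    have e : ((1 - 5 / 4 * p) * (1 - p) ^ 2 - p ^ 2 + 5 / 4 * p - 1 / 4) *
        (1 + 3 / 4 * p - 1 / 4) - (1 - 5 / 4 * p * (1 - p) - 1 / 4) ^ 2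
        = p * (15 / 16 - 49 / 16 * p + 65 / 16 * p ^ 2 - 5 / 2 * p ^ 3) := by ring
    rw [← sub_nonneg, e]
    apply mul_nonneg hp.le
    nlinarith [mul_nonneg hp.le (sub_nonneg.2 hph), mul_nonneg (sq_nonneg p) (sub_nonneg.2 hph)]
  linarith [quadratic_nonneg hα hdet Y w]

theorem binary_form_neg_one {p : ℝ} (hp : 0 < p) (hph : p ≤ 1 / 2) (z₁ y : ℝ) :
    11 / 10 * z₁ ^ 2 ≤ 2 * (1 - p) * (z₁ - y) ^ 2
      + 5 / 4 * (p * z₁ + (1 - p) * y) ^ 2 + 5 / 4 * y ^ 2 := by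
  have ha : 0 < 2 * (1 - p) + 5 / 4 * (1 - p) ^ 2 + 5 / 4 := by nlinarith
  have hdet : (2 * (1 - p) - 5 / 4 * p * (1 - p)) ^ 2 ≤
      (2 * (1 - p) + 5 / 4 * (1 - p) ^ 2 + 5 / 4) *
        (2 * (1 - p) + 5 / 4 * p ^ 2 - 11 / 10) := by
    nlinarith [sq_nonneg (p - 1 / 4), mul_nonneg hp.le (sq_nonneg (p - 1 / 4)),
      mul_nonneg hp.le (sub_nonneg.2 hph)]
  linarith [quadratic_nonneg ha hdet y z₁]

section Weights

variable {ι : Type*} (s : Finset ι) (p z₁ : ℝ) (P z : ι → ℝ)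

/-- This controls `logForm` at `t = 0`. With `d i = P i - p` one has `x = p * Y + w`, `w = ∑ d i * z
i`. Cauchy–Schwarz with weights `d i` bounds `w`, and with weights `1 - d i` bounds the rest `b` of
`∑ z i`; a binary form in `(Y, w)` remains, and `z₁ = (Y - w) - b`. Using the coefficient `1 - 5/4 *
p` instead of `1` leaves the slack spent in `logForm_nonneg`. -/
theorem form_at_zero (hp : 0 < p) (hP : ∀ i ∈ s, p ≤ P i) (hs : s.Nonempty)
    (hsum : p + ∑ i ∈ s, P i = 1) (Y x : ℝ) (hY : Y = z₁ + ∑ i ∈ s, z i)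
    (hx : x = p * z₁ + ∑ i ∈ s, P i * z i) :
    z₁ ^ 2 ≤ (s.card + 4) * ((1 - 5 / 4 * p) * (Y - x) ^ 2 + ∑ i ∈ s, z i ^ 2 - x ^ 2
      + 5 / 4 * p * Y ^ 2) := by
  have hk : (1 : ℝ) ≤ s.card := by exact_mod_cast hs.card_pos
  set k : ℝ := (s.card : ℝ) with hkdef
  have hsumd : ∑ i ∈ s, (P i - p) = 1 - (k + 1) * p := by
    rw [Finset.sum_sub_distrib, Finset.sum_const, nsmul_eq_mul]; linarith
  have hd0 : ∀ i ∈ s, 0 ≤ P i - p := fun i hi => by linarith [hP i hi]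
  have hp2 : (k + 1) * p ≤ 1 := by
    have := Finset.sum_nonneg hd0; linarith
  have hph : p ≤ 1 / 2 := by nlinarith
  have hd1 : ∀ i ∈ s, 0 ≤ 1 - (P i - p) := fun i hi => by
    have := Finset.single_le_sum hd0 hi
    rw [hsumd] at this; nlinarith
  set w := ∑ i ∈ s, (P i - p) * z i with hw
  set D := ∑ i ∈ s, (P i - p) * z i ^ 2 with hD
  set q := ∑ i ∈ s, (1 - (P i - p)) * z i ^ 2 with hq
  set b := ∑ i ∈ s, (1 - (P i - p)) * z i with hb
  have hD0 : 0 ≤ D := Finset.sum_nonneg fun i hi => mul_nonneg (hd0 i hi) (sq_nonneg _)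
  have hq0 : 0 ≤ q := Finset.sum_nonneg fun i hi => mul_nonneg (hd1 i hi) (sq_nonneg _)
  have hwD : w ^ 2 ≤ (1 - (k + 1) * p) * D := by
    rw [← hsumd]
    exact Finset.sum_sq_le_sum_mul_sum_of_sq_le_mul s hd0
      (fun i hi => mul_nonneg (hd0 i hi) (sq_nonneg _)) (fun i _ => le_of_eq (by ring))
  have hbq : b ^ 2 ≤ k * q := by
    have h1 : b ^ 2 ≤ (∑ i ∈ s, (1 - (P i - p))) * q :=
      Finset.sum_sq_le_sum_mul_sum_of_sq_le_mul s hd1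
        (fun i hi => mul_nonneg (hd1 i hi) (sq_nonneg _)) (fun i _ => le_of_eq (by ring))
    have h2 : ∑ i ∈ s, (1 - (P i - p)) ≤ k := by
      rw [Finset.sum_sub_distrib, hsumd, Finset.sum_const, nsmul_eq_mul]; linarith
    exact h1.trans (mul_le_mul_of_nonneg_right h2 hq0)
  have hsq : ∑ i ∈ s, z i ^ 2 = q + D := by
    rw [hq, hD, ← Finset.sum_add_distrib]; exact Finset.sum_congr rfl fun i _ => by ring
  have hz : ∑ i ∈ s, z i = b + w := by
    rw [hb, hw, ← Finset.sum_add_distrib]; exact Finset.sum_congr rfl fun i _ => by ring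
  have hPz : ∑ i ∈ s, P i * z i = w + p * ∑ i ∈ s, z i := by
    rw [hw, Finset.mul_sum, ← Finset.sum_add_distrib]
    exact Finset.sum_congr rfl fun i _ => by ring
  have hxY : x = p * Y + w := by rw [hx, hY, hPz]; ring
  have hwD' : (1 + 2 * p) * w ^ 2 ≤ D := by
    have h2 : w ^ 2 ≤ (1 - 2 * p) * D := hwD.trans
      (mul_le_mul_of_nonneg_right (by nlinarith) hD0)
    nlinarith [mul_nonneg hD0 (sq_nonneg p)]
  have key : (Y - w) ^ 2 / 4 ≤ (1 - 5 / 4 * p) * (Y - x) ^ 2 + (1 + 2 * p) * w ^ 2 - x ^ 2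
      + 5 / 4 * p * Y ^ 2 := by
    rw [hxY]
    exact binary_form_zero hp hph Y w
  have hz1 : z₁ = (Y - w) - b := by rw [hY, hz]; ring
  have h5 : (Y - w) ^ 2 / 4 + q ≤ (1 - 5 / 4 * p) * (Y - x) ^ 2 + ∑ i ∈ s, z i ^ 2 - x ^ 2
      + 5 / 4 * p * Y ^ 2 := by rw [hsq]; linarith
  refine le_trans ?_ (mul_le_mul_of_nonneg_left h5 (by linarith))
  rw [hz1]
  generalize Y - w = a
  have h6 : 0 ≤ k * (k * a ^ 2 / 4 + 4 * q + 2 * (a * b)) := by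
    nlinarith [sq_nonneg (k * a / 2 + 2 * b)]
  have h7 := nonneg_of_mul_nonneg_right h6 (by linarith)
  nlinarith

/-- This controls `logForm` at `t = -1`. Cauchy–Schwarz replaces the `z i` by their weighted mean
`y`, leaving a binary form in `(z₁, y)`. The factor `11/10` makes room for `1 + δ`. -/
theorem form_at_neg_one (hp : 0 < p) (hP : ∀ i ∈ s, p ≤ P i) (hs : s.Nonempty)
    (hsum : p + ∑ i ∈ s, P i = 1) (x : ℝ)
    (hx : x = p * z₁ + ∑ i ∈ s, P i * z i) :
    11 / 10 * (p * z₁ ^ 2) ≤ 2 * (p * z₁ ^ 2 + ∑ i ∈ s, P i * z i ^ 2 - x ^ 2)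
      + 5 / 4 * p * x ^ 2 + 5 / 4 * p * ∑ i ∈ s, z i ^ 2 := by
  have hP0 : ∀ i ∈ s, 0 ≤ P i := fun i hi => hp.le.trans (hP i hi)
  have hS : ∑ i ∈ s, P i = 1 - p := by linarith
  have hle : ∀ i ∈ s, P i ≤ 1 - p := fun i hi => by
    rw [← hS]; exact Finset.single_le_sum hP0 hi
  obtain ⟨i₀, hi₀⟩ := hs
  have hph : p ≤ 1 / 2 := by linarith [hP i₀ hi₀, hle i₀ hi₀]
  set v := ∑ i ∈ s, P i * z i with hv
  set V := ∑ i ∈ s, P i * z i ^ 2 with hV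
  set S := ∑ i ∈ s, z i ^ 2 with hSdef
  have h1 : v ^ 2 ≤ (1 - p) * V := by
    rw [← hS]
    exact Finset.sum_sq_le_sum_mul_sum_of_sq_le_mul s hP0
      (fun i hi => mul_nonneg (hP0 i hi) (sq_nonneg _)) (fun i _ => le_of_eq (by ring))
  have h2 : V ≤ (1 - p) * S := by
    rw [hV, hSdef, Finset.mul_sum]
    exact Finset.sum_le_sum fun i hi => mul_le_mul_of_nonneg_right (hle i hi) (sq_nonneg _)
  have h1p : 0 < 1 - p := by linarith
  obtain ⟨y, hy⟩ : ∃ y, v = (1 - p) * y := ⟨v / (1 - p), by field_simp⟩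
  have hV' : (1 - p) * y ^ 2 ≤ V := by
    rw [hy] at h1
    have : (1 - p) * ((1 - p) * y ^ 2) ≤ (1 - p) * V := by linarith
    exact le_of_mul_le_mul_left this h1p
  have hS' : y ^ 2 ≤ S := le_of_mul_le_mul_left (hV'.trans h2) h1p
  rw [hx, hy]
  have key := binary_form_neg_one hp hph z₁ y
  have := mul_le_mul_of_nonneg_left key hp.le
  have h5 : 5 / 4 * p * y ^ 2 ≤ 5 / 4 * p * S := mul_le_mul_of_nonneg_left hS' (by positivity)
  nlinarith

/-- The linear constraint is used twice: Cauchy–Schwarz with weights `P i / (2 * p)` gives nearly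
twice the main term `p * z₁²`, and a second one with weights `1 - 2 * P i` gives a multiple of `z₁²`
that does not degenerate as `p` tends to zero. -/
theorem form_large (hp : 0 < p) (hP : ∀ i ∈ s, p ≤ P i) (hP' : ∀ i ∈ s, P i ≤ 1 / 2)
    (hs : 2 ≤ s.card) (hsum : p + ∑ i ∈ s, P i = 1)
    (hz : (1 - p) * z₁ + ∑ i ∈ s, (1 - P i) * z i = 0) (Z : ℝ) (hZ : Z = z₁ + ∑ i ∈ s, z i) :
    (p + 1 / (72 * (s.card + 1))) * z₁ ^ 2 ≤ Z ^ 2 + ∑ i ∈ s, (1 - 2 * P i) * z i ^ 2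
      + 5 / 4 * ∑ i ∈ s, (1 - P i) * (p / P i) * z i ^ 2 := by
  have hk : (2 : ℝ) ≤ s.card := by exact_mod_cast hs
  set k : ℝ := (s.card : ℝ) with hkdef
  have hp3 : 3 * p ≤ 1 := by
    have : (s.card : ℝ) * p ≤ ∑ i ∈ s, P i := by
      rw [← nsmul_eq_mul]; exact Finset.card_nsmul_le_sum s P p hP
    nlinarith
  have hP0 : ∀ i ∈ s, 0 < P i := fun i hi => hp.trans_le (hP i hi)
  set A := ∑ i ∈ s, (1 - 2 * P i) * z i ^ 2 with hA
  set B := ∑ i ∈ s, (1 - P i) * (p / P i) * z i ^ 2 with hB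
  have hA0 : ∀ i ∈ s, 0 ≤ 1 - 2 * P i := fun i hi => by linarith [hP' i hi]
  have hB0 : 0 ≤ B := Finset.sum_nonneg fun i hi => by
    have := hP0 i hi
    have := hP' i hi
    have : 0 ≤ 1 - P i := by linarith
    positivity
  have h1 : (∑ i ∈ s, (1 - P i) * z i) ^ 2 ≤ (1 - p) / (2 * p) * (A + 5 / 4 * B) := by
    have e : (1 - p) / (2 * p) = ∑ i ∈ s, P i / (2 * p) := by
      rw [← Finset.sum_div]; congr 1; linarith
    rw [e]
    refine (Finset.sum_sq_le_sum_mul_sum_of_sq_le_mul s (f := fun i => P i / (2 * p))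
      (g := fun i => 2 * p * (1 - P i) ^ 2 * z i ^ 2 / P i)
      (fun i hi => by have := hP0 i hi; positivity)
      (fun i hi => by have := hP0 i hi; positivity)
      (fun i hi => le_of_eq (by have := hP0 i hi; field_simp))).trans ?_
    refine mul_le_mul_of_nonneg_left ?_
      (Finset.sum_nonneg fun i hi => by have := hP0 i hi; positivity)
    rw [hA, hB, Finset.mul_sum, ← Finset.sum_add_distrib]
    refine Finset.sum_le_sum fun i hi => ?_
    have h0 := hP0 i hi
    have hle := hP' i hi
    have hge := hP i hi
    have e2 : (1 - 2 * P i) * z i ^ 2 + 5 / 4 * ((1 - P i) * (p / P i) * z i ^ 2)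
        = ((1 - 2 * P i) * P i + 5 / 4 * (1 - P i) * p) * z i ^ 2 / P i := by
      field_simp
    rw [e2]
    refine div_le_div_of_nonneg_right (mul_le_mul_of_nonneg_right ?_ (sq_nonneg _)) h0.le
    nlinarith [mul_nonneg (sub_nonneg.2 hle) (sub_nonneg.2 hge),
      mul_nonneg hp.le (sub_nonneg.2 hle), mul_nonneg hp.le h0.le,
      mul_nonneg (mul_nonneg hp.le h0.le) (sub_nonneg.2 hle)]
  have h2 : 2 * p * (1 - p) * z₁ ^ 2 ≤ A + 5 / 4 * B := by
    have e : ∑ i ∈ s, (1 - P i) * z i = -((1 - p) * z₁) := by linarith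
    rw [e, div_mul_eq_mul_div, le_div_iff₀ (by positivity)] at h1
    have : (1 - p) * (2 * p * (1 - p) * z₁ ^ 2) ≤ (1 - p) * (A + 5 / 4 * B) := by linarith
    exact le_of_mul_le_mul_left this (by linarith)
  have h3 : (∑ i ∈ s, (1 - 2 * P i) * z i) ^ 2 ≤ k * A := by
    have h4 : (∑ i ∈ s, (1 - 2 * P i) * z i) ^ 2 ≤ (∑ i ∈ s, (1 - 2 * P i)) * A :=
      Finset.sum_sq_le_sum_mul_sum_of_sq_le_mul s hA0
      (fun i hi => mul_nonneg (hA0 i hi) (sq_nonneg _)) (fun i _ => le_of_eq (by ring))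
    refine h4.trans (mul_le_mul_of_nonneg_right ?_
      (Finset.sum_nonneg fun i hi => mul_nonneg (hA0 i hi) (sq_nonneg _)))
    calc _ ≤ ∑ i ∈ s, (1 : ℝ) := Finset.sum_le_sum fun i hi => by linarith [hP0 i hi]
      _ = k := by simp [hkdef]
  set c := ∑ i ∈ s, (1 - 2 * P i) * z i with hc
  have h5 : (1 - 2 * p) * z₁ = -(c + Z) := by
    have e1 : c = 2 * ∑ i ∈ s, (1 - P i) * z i - ∑ i ∈ s, z i := by
      rw [hc, Finset.mul_sum, ← Finset.sum_sub_distrib]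
      exact Finset.sum_congr rfl fun i _ => by ring
    rw [hZ, e1]; linarith
  have h6 : (1 - 2 * p) ^ 2 * z₁ ^ 2 ≤ (k + 1) * (A + Z ^ 2) := by
    have : (1 - 2 * p) ^ 2 * z₁ ^ 2 = (c + Z) ^ 2 := by rw [← mul_pow, h5]; ring
    rw [this]
    have h7 : 0 ≤ k * (A + k * Z ^ 2 - 2 * (c * Z)) := by nlinarith [sq_nonneg (c - k * Z)]
    have h8 := nonneg_of_mul_nonneg_right h7 (by linarith)
    nlinarith
  have h9 : z₁ ^ 2 / (9 * (k + 1)) ≤ A + Z ^ 2 := by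
    rw [div_le_iff₀ (by positivity)]
    have : 1 / 9 * z₁ ^ 2 ≤ (1 - 2 * p) ^ 2 * z₁ ^ 2 :=
      mul_le_mul_of_nonneg_right (by nlinarith) (sq_nonneg _)
    linarith
  -- The two bounds are mixed with weights 7/8 and 1/8; since `p ≤ 1/3`, the first share still
  -- covers `p * z₁²`.
  have e3 : 1 / (72 * (k + 1)) * z₁ ^ 2 = 1 / 8 * (z₁ ^ 2 / (9 * (k + 1))) := by
    field_simp; ring
  have h10 : p * z₁ ^ 2 ≤ 7 / 8 * (2 * p * (1 - p) * z₁ ^ 2) := by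
    have : 0 ≤ p * z₁ ^ 2 * (3 / 4 - 7 / 4 * p) :=
      mul_nonneg (by positivity) (by linarith)
    linarith
  nlinarith [sq_nonneg Z]

end Weights
section Weights

variable {ι : Type*} (s : Finset ι) (p z₁ : ℝ) (P z : ι → ℝ)

/-- The second variation of `σ_{n-1}` at `λ` on its tangent space, together with the weighted
third-order terms, in logarithmic coordinates. -/
noncomputable def logForm (δ t : ℝ) : ℝ :=
  (1 + t) * ((z₁ + ∑ i ∈ s, z i - (p * z₁ + ∑ i ∈ s, P i * z i)) ^ 2
      + (z₁ ^ 2 + ∑ i ∈ s, z i ^ 2) - (p * z₁ + ∑ i ∈ s, P i * z i) ^ 2)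
    - 2 * t * (p * z₁ ^ 2 + ∑ i ∈ s, P i * z i ^ 2 - (p * z₁ + ∑ i ∈ s, P i * z i) ^ 2)
    + 5 / 4 * p * (t * (p * z₁ + ∑ i ∈ s, P i * z i) - (1 + t) * (z₁ + ∑ i ∈ s, z i)) ^ 2
    + 5 / 4 * ((1 + t) * ∑ i ∈ s, p / P i * z i ^ 2 - t * p * ∑ i ∈ s, z i ^ 2)
    - (1 + δ) * (1 + t - p * t) * z₁ ^ 2

variable {s p P}

/-- Here the smallest entry of `l` is positive as well, so it has its own logarithmic coordinate `y`
and all indices can be treated alike by `form_large`. The condition `t ≥ 1` says that its normalized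
weight `1 / (1 + t)` is at most 1/2. -/
theorem logForm_nonneg_of_one_le (hp : 0 < p) (hP : ∀ i ∈ s, p ≤ P i) (hs : s.Nonempty)
    (hsum : p + ∑ i ∈ s, P i = 1) {t δ : ℝ} (ht : 1 ≤ t) (htP : ∀ i ∈ s, t * P i ≤ 1)
    (hδ : δ ≤ 1 / (72 * (s.card + 2))) : 0 ≤ logForm s p z₁ P z δ t := by
  have ht0 : 0 < t := by linarith
  have h1t : 0 < 1 + t := by linarith
  have hcard : (1 : ℝ) ≤ s.card := by exact_mod_cast hs.card_pos
  have hP0 : ∀ i ∈ s, 0 < P i := fun i hi => hp.trans_le (hP i hi)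
  obtain ⟨i₀, hi₀⟩ := id hs
  have htp : t * p ≤ 1 := (mul_le_mul_of_nonneg_left (hP i₀ hi₀) ht0.le).trans (htP i₀ hi₀)
  have hp1 : p ≤ 1 := by
    have := Finset.sum_nonneg fun i hi => (hP0 i hi).le
    linarith
  set Y := z₁ + ∑ i ∈ s, z i with hY
  set x := p * z₁ + ∑ i ∈ s, P i * z i with hx
  set S := ∑ i ∈ s, z i ^ 2 with hS
  set V := ∑ i ∈ s, P i * z i ^ 2 with hV
  set W := ∑ i ∈ s, p / P i * z i ^ 2 with hW
  -- This is the tangency condition solved for the coordinate of the smallest entry, which is the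
  -- index `none` below. The new weights are the inverses of all entries, normalized to sum 1.
  obtain ⟨y, hy⟩ : ∃ y, t * y = t * x - (1 + t) * Y := ⟨(t * x - (1 + t) * Y) / t, by field_simp⟩
  have main := form_large (Finset.insertNone s) (t * p / (1 + t)) z₁
    (fun o => o.elim (1 / (1 + t)) fun i => t * P i / (1 + t)) (fun o => o.elim y z)
    (by positivity) (by
      intro o ho
      match o with
      | none => exact div_le_div_of_nonneg_right htp h1t.le
      | some i =>
        have := hP i (Finset.some_mem_insertNone.1 ho)
        simp only [Option.elim]
        gcongr) (by
      intro o ho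
      match o with
      | none =>
        simp only [Option.elim]
        rw [div_le_div_iff₀ h1t two_pos]; linarith
      | some i =>
        have := htP i (Finset.some_mem_insertNone.1 ho)
        simp only [Option.elim]
        rw [div_le_div_iff₀ h1t two_pos]; linarith) (by
      rw [Finset.card_insertNone]; have := hs.card_pos; omega) (by
      rw [Finset.sum_insertNone]
      simp only [Option.elim]
      rw [← Finset.sum_div, ← Finset.mul_sum]
      field_simp
      linear_combination t * hsum) (by
      rw [Finset.sum_insertNone]
      simp only [Option.elim]
      have e : ∑ i ∈ s, (1 - t * P i / (1 + t)) * z i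
          = (Y - z₁) - t / (1 + t) * (x - p * z₁) := by
        have e1 : Y - z₁ = ∑ i ∈ s, z i := by rw [hY]; ring
        have e2 : x - p * z₁ = ∑ i ∈ s, P i * z i := by rw [hx]; ring
        rw [e1, e2, Finset.mul_sum, ← Finset.sum_sub_distrib]
        exact Finset.sum_congr rfl fun i _ => by ring
      rw [e]
      field_simp
      linear_combination hy) (Y + y) (by
      rw [Finset.sum_insertNone]
      simp only [Option.elim]
      rw [hY]; ring)
  rw [Finset.sum_insertNone, Finset.sum_insertNone, Finset.card_insertNone] at main
  simp only [Option.elim] at main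
  have e1 : ∑ i ∈ s, (1 - 2 * (t * P i / (1 + t))) * z i ^ 2 = S - 2 * (t / (1 + t)) * V := by
    rw [hS, hV, Finset.mul_sum, ← Finset.sum_sub_distrib]
    exact Finset.sum_congr rfl fun i _ => by ring
  have e2 : ∑ i ∈ s, (1 - t * P i / (1 + t)) * (t * p / (1 + t) / (t * P i / (1 + t))) * z i ^ 2
      = W - t / (1 + t) * p * S := by
    rw [hW, hS, Finset.mul_sum, ← Finset.sum_sub_distrib]
    refine Finset.sum_congr rfl fun i hi => ?_
    have := hP0 i hi
    field_simp
  rw [e1, e2] at main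
  have hδ' : δ * (1 + t - p * t) ≤ 1 / (72 * (((s.card + 1 : ℕ) : ℝ) + 1)) * (1 + t) := by
    have e3 : (((s.card + 1 : ℕ) : ℝ) + 1) = s.card + 2 := by push_cast; ring
    rw [e3]
    have : 0 ≤ p * t := by positivity
    have h0 : 0 ≤ 1 + t - p * t := by nlinarith
    calc δ * (1 + t - p * t) ≤ 1 / (72 * ((s.card : ℝ) + 2)) * (1 + t - p * t) :=
          mul_le_mul_of_nonneg_right hδ h0
      _ ≤ _ := mul_le_mul_of_nonneg_left (by linarith) (by positivity)
  set ε := 1 / (72 * (((s.card + 1 : ℕ) : ℝ) + 1))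
  have main' := mul_le_mul_of_nonneg_left main h1t.le
  have e4 : (1 + t) * ((t * p / (1 + t) + ε) * z₁ ^ 2) = t * p * z₁ ^ 2 + ε * (1 + t) * z₁ ^ 2 := by
    field_simp
  have e5 : (1 + t) * ((Y + y) ^ 2 + ((1 - 2 * (1 / (1 + t))) * y ^ 2 + (S - 2 * (t / (1 + t)) * V))
      + 5 / 4 * ((1 - 1 / (1 + t)) * (t * p / (1 + t) / (1 / (1 + t))) * y ^ 2
        + (W - t / (1 + t) * p * S)))
      = (1 + t) * ((Y - x) ^ 2 + S - x ^ 2) - 2 * t * (V - x ^ 2)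
        + 5 / 4 * p * (t * x - (1 + t) * Y) ^ 2 + 5 / 4 * ((1 + t) * W - t * p * S) := by
    have hx' : x = y + (1 + t) * Y / t := by field_simp; linarith
    rw [← hy, hx']
    field_simp
    ring
  rw [e4, e5] at main'
  have h6 := mul_le_mul_of_nonneg_right hδ' (sq_nonneg z₁)
  unfold logForm
  rw [← hY, ← hx, ← hS, ← hV, ← hW]
  linear_combination main' + h6

/-- Apart from the square `5/4 * p * (t * x - (1 + t) * Y)²` the form is affine in `t`, so for `t <
1` one interpolates between -1 and 0 or between 0 and 1. The square is convex in `t`, which costs a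
multiple of `p * (Y - x)²`; the slack in `form_at_zero` covers it, and `a4` is what is left over. -/
theorem logForm_nonneg (hp : 0 < p) (hP : ∀ i ∈ s, p ≤ P i) (hs : s.Nonempty)
    (hsum : p + ∑ i ∈ s, P i = 1) {t δ : ℝ} (ht : -1 < t)
    (htP : 1 ≤ t → ∀ i ∈ s, t * P i ≤ 1)
    (hδ0 : 0 ≤ δ) (hδ : δ ≤ 1 / (72 * (s.card + 2))) : 0 ≤ logForm s p z₁ P z δ t := by
  rcases le_or_gt 1 t with h1 | h1
  · exact logForm_nonneg_of_one_le z₁ z hp hP hs hsum h1 (htP h1) hδ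
  have hcard : (1 : ℝ) ≤ s.card := by exact_mod_cast hs.card_pos
  have hP0 : ∀ i ∈ s, 0 < P i := fun i hi => hp.trans_le (hP i hi)
  have hone : 0 ≤ logForm s p z₁ P z δ 1 := by
    refine logForm_nonneg_of_one_le z₁ z hp hP hs hsum le_rfl (fun i hi => ?_) hδ
    have := Finset.single_le_sum (fun i hi => (hP0 i hi).le) hi
    linarith
  have hzero := form_at_zero s p z₁ P z hp hP hs hsum _ _ rfl rfl
  have hneg := form_at_neg_one s p z₁ P z hp hP hs hsum _ rfl
  have hW0 : 0 ≤ ∑ i ∈ s, p / P i * z i ^ 2 := Finset.sum_nonneg fun i hi => by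
    have := hP0 i hi; positivity
  unfold logForm at hone ⊢
  set Y := z₁ + ∑ i ∈ s, z i with hY
  set x := p * z₁ + ∑ i ∈ s, P i * z i with hx
  set S := ∑ i ∈ s, z i ^ 2 with hS
  set V := ∑ i ∈ s, P i * z i ^ 2 with hV
  set W := ∑ i ∈ s, p / P i * z i ^ 2 with hW
  have hδ4 : δ * (s.card + 4) ≤ 1 := by
    rw [le_div_iff₀ (by positivity)] at hδ
    nlinarith
  have hδ1 : δ ≤ 1 / 10 := hδ.trans (by
    rw [div_le_div_iff₀ (by positivity) (by positivity)]; linarith)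
  set E := (1 - 5 / 4 * p) * (Y - x) ^ 2 + S - x ^ 2 + 5 / 4 * p * Y ^ 2 with hE
  have hE0 : 0 ≤ E :=
    nonneg_of_mul_nonneg_right ((sq_nonneg _).trans hzero) (by positivity)
  have hzero' : 0 ≤ E - δ * z₁ ^ 2 := by
    have h1 := mul_le_mul_of_nonneg_left hzero hδ0
    have h2 := mul_le_mul_of_nonneg_right hδ4 hE0
    linear_combination h1 + h2
  have hneg' : 0 ≤ 2 * (p * z₁ ^ 2 + V - x ^ 2) + 5 / 4 * p * x ^ 2 + 5 / 4 * p * S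
      - (1 + δ) * (p * z₁ ^ 2) := by
    have h1 : 0 ≤ p * z₁ ^ 2 := by positivity
    have h2 := mul_le_mul_of_nonneg_right hδ1 h1
    linear_combination hneg + h2
  rcases le_or_gt t 0 with h0 | h0
  · have a1 := mul_nonneg (by linarith : 0 ≤ 1 + t) hzero'
    have a2 := mul_nonneg (by linarith : 0 ≤ -t) hneg'
    have a3 := mul_nonneg (by linarith : 0 ≤ 1 + t) hW0
    have a4 : 0 ≤ p * (1 + t) ^ 2 * (Y - x) ^ 2 := by positivity
    rw [hE] at a1
    linear_combination a1 + a2 + 5 / 4 * a3 + 5 / 4 * a4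
  · have a1 := mul_nonneg (by linarith : 0 ≤ 1 - t) hzero'
    have a2 := mul_nonneg h0.le hone
    have a3 := mul_nonneg (by linarith : 0 ≤ 1 - t) hW0
    have a4 : 0 ≤ p * (1 - t) * (1 - t) * (Y - x) ^ 2 := by
      have : 0 ≤ 1 - t := by linarith
      positivity
    rw [hE] at a1
    linear_combination a1 + a2 + 5 / 4 * a3 + 5 / 4 * a4

end Weights
-- The function σ_{n-1} and its derivatives in logarithmic coordinates
section Esymm

variable {ι : Type*} [DecidableEq ι]

/-- The elementary symmetric function of degree `|S| - 1` of the numbers `l i`, `i ∈ S`. -/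
def esymmPred (S : Finset ι) (l : ι → ℝ) : ℝ := ∑ i ∈ S, ∏ c ∈ S.erase i, l c

theorem esymmPred_eq_of_ne_zero {S : Finset ι} {l : ι → ℝ} (h : ∀ c ∈ S, l c ≠ 0) :
    esymmPred S l = (∏ c ∈ S, l c) * ∑ c ∈ S, (l c)⁻¹ := by
  rw [esymmPred, Finset.mul_sum]
  refine Finset.sum_congr rfl fun i hi => ?_
  rw [← Finset.mul_prod_erase S l hi]
  have := h i hi
  field_simp

/-- Only the entry at `j` is allowed to vanish or change sign, so the others are divided out and the
dependence on `l j` is affine. All formulas for `sig`, `sig₁`, `sig₂` come from this one. -/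
theorem esymmPred_eq_of_mem {S : Finset ι} {l : ι → ℝ} {j : ι} (hj : j ∈ S)
    (h : ∀ c ∈ S.erase j, l c ≠ 0) :
    esymmPred S l = (∏ c ∈ S.erase j, l c) * (1 + l j * ∑ c ∈ S.erase j, (l c)⁻¹) := by
  rw [esymmPred, ← Finset.add_sum_erase S _ hj, mul_add, mul_one, Finset.mul_sum, Finset.mul_sum]
  congr 1
  refine Finset.sum_congr rfl fun i hi => ?_
  have hij : j ∈ S.erase i := Finset.mem_erase.2 ⟨(Finset.ne_of_mem_erase hi).symm, hj⟩
  rw [← Finset.mul_prod_erase _ l hij, Finset.erase_right_comm, ← Finset.mul_prod_erase _ l hi]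
  have := h i hi
  field_simp

variable [Fintype ι]

/-- The elementary symmetric function of degree `n - 1`. -/
abbrev sig (l : ι → ℝ) : ℝ := esymmPred Finset.univ l

/-- The first derivatives of `sig`. -/
abbrev sig₁ (l : ι → ℝ) (a : ι) : ℝ := esymmPred (Finset.univ.erase a) l

/-- The second derivatives of `sig` in two different directions. -/
abbrev sig₂ (l : ι → ℝ) (a b : ι) : ℝ := esymmPred ((Finset.univ.erase a).erase b) l

/-- The second derivative of `-sig` as a quadratic form. -/
def negHess (l ξ : ι → ℝ) : ℝ := -∑ a, ∑ b ∈ Finset.univ.erase a, sig₂ l a b * (ξ a * ξ b)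

theorem sig₂_comm (l : ι → ℝ) (a b : ι) : sig₂ l a b = sig₂ l b a := by
  rw [sig₂, Finset.erase_right_comm]

variable {l : ι → ℝ} {j : ι}

theorem sig_eq (h : ∀ c, c ≠ j → l c ≠ 0) :
    sig l = (∏ c ∈ Finset.univ.erase j, l c)
      * (1 + l j * ∑ c ∈ Finset.univ.erase j, (l c)⁻¹) :=
  esymmPred_eq_of_mem (Finset.mem_univ j) fun c hc => h c (Finset.ne_of_mem_erase hc)

theorem sig₁_self_eq (h : ∀ c, c ≠ j → l c ≠ 0) :
    sig₁ l j = (∏ c ∈ Finset.univ.erase j, l c) * ∑ c ∈ Finset.univ.erase j, (l c)⁻¹ :=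
  esymmPred_eq_of_ne_zero fun c hc => h c (Finset.ne_of_mem_erase hc)

theorem sig₁_eq (h : ∀ c, c ≠ j → l c ≠ 0) {a : ι} (ha : a ≠ j) :
    sig₁ l a = (∏ c ∈ Finset.univ.erase j, l c) * (l a)⁻¹
      * (1 + l j * (∑ c ∈ Finset.univ.erase j, (l c)⁻¹ - (l a)⁻¹)) := by
  have haj : a ∈ Finset.univ.erase j := by simp [ha]
  rw [sig₁, esymmPred_eq_of_mem (j := j) (by simp [ha.symm])
    (fun c hc => h c (Finset.ne_of_mem_erase hc)), Finset.erase_right_comm,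
    ← Finset.mul_prod_erase _ l haj, ← Finset.add_sum_erase _ _ haj]
  have := h a ha
  field_simp
  ring

theorem sig₂_self_eq (h : ∀ c, c ≠ j → l c ≠ 0) {a : ι} (ha : a ≠ j) :
    sig₂ l j a = (∏ c ∈ Finset.univ.erase j, l c) * (l a)⁻¹
      * (∑ c ∈ Finset.univ.erase j, (l c)⁻¹ - (l a)⁻¹) := by
  have haj : a ∈ Finset.univ.erase j := by simp [ha]
  rw [sig₂, esymmPred_eq_of_ne_zero
    (fun c hc => h c (Finset.ne_of_mem_erase (Finset.mem_of_mem_erase hc))),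
    ← Finset.mul_prod_erase _ l haj, ← Finset.add_sum_erase _ _ haj]
  have := h a ha
  field_simp
  ring

theorem sig₂_eq (h : ∀ c, c ≠ j → l c ≠ 0) {a b : ι} (ha : a ≠ j) (hb : b ≠ j) (hab : b ≠ a) :
    sig₂ l a b = (∏ c ∈ Finset.univ.erase j, l c) * (l a)⁻¹ * (l b)⁻¹
      * (1 + l j * (∑ c ∈ Finset.univ.erase j, (l c)⁻¹ - (l a)⁻¹ - (l b)⁻¹)) := by
  have haj : a ∈ Finset.univ.erase j := by simp [ha]
  have hbj : b ∈ (Finset.univ.erase j).erase a := by simp [hb, hab]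
  rw [sig₂, esymmPred_eq_of_mem (j := j) (by simp [ha.symm, hb.symm])
    (fun c hc => h c (Finset.ne_of_mem_erase hc)), Finset.erase_right_comm (a := b),
    Finset.erase_right_comm (a := a) (b := j),
    ← Finset.mul_prod_erase _ l haj, ← Finset.add_sum_erase _ _ haj,
    ← Finset.mul_prod_erase _ l hbj, ← Finset.add_sum_erase _ _ hbj]
  have h1 := h a ha
  have h2 := h b hb
  field_simp
  ring

/-- The linear part of `sig` in logarithmic coordinates. -/
theorem sum_sig₁_mul_eq (h : ∀ c, c ≠ j → l c ≠ 0) (ξ : ι → ℝ) {U : Finset ι}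
    (hU : U = Finset.univ.erase j) {M R : ℝ} (hM : M = ∏ c ∈ U, l c) (hR : R = ∑ c ∈ U, (l c)⁻¹) :
    ∑ a, sig₁ l a * ξ a = M * ((1 + l j * R) * ∑ c ∈ U, (l c)⁻¹ * ξ c
      - l j * ∑ c ∈ U, (l c)⁻¹ * ((l c)⁻¹ * ξ c) + R * ξ j) := by
  have e : ∑ a ∈ U, sig₁ l a * ξ a = ∑ c ∈ U, (M * (1 + l j * R) * ((l c)⁻¹ * ξ c)
      - M * l j * ((l c)⁻¹ * ((l c)⁻¹ * ξ c))) := by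
    refine Finset.sum_congr rfl fun a ha => ?_
    rw [sig₁_eq h (Finset.ne_of_mem_erase (hU ▸ ha)), ← hU, ← hM, ← hR]
    ring
  rw [← Finset.add_sum_erase _ _ (Finset.mem_univ j), ← hU, e, sig₁_self_eq h, ← hU, ← hM, ← hR,
    Finset.sum_sub_distrib, ← Finset.mul_sum, ← Finset.mul_sum]
  ring

/-- The quadratic form `negHess` in logarithmic coordinates. -/
theorem negHess_eq (h : ∀ c, c ≠ j → l c ≠ 0) (ξ : ι → ℝ) {U : Finset ι}
    (hU : U = Finset.univ.erase j) {M R : ℝ} (hM : M = ∏ c ∈ U, l c) (hR : R = ∑ c ∈ U, (l c)⁻¹) :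
    negHess l ξ = M * (-(1 + l j * R) * ((∑ c ∈ U, (l c)⁻¹ * ξ c) ^ 2
        - ∑ c ∈ U, ((l c)⁻¹ * ξ c) ^ 2)
      + 2 * l j * ((∑ c ∈ U, (l c)⁻¹ * ((l c)⁻¹ * ξ c)) * (∑ c ∈ U, (l c)⁻¹ * ξ c)
        - ∑ c ∈ U, (l c)⁻¹ * ((l c)⁻¹ * ξ c) ^ 2)
      - 2 * ξ j * (R * ∑ c ∈ U, (l c)⁻¹ * ξ c - ∑ c ∈ U, (l c)⁻¹ * ((l c)⁻¹ * ξ c))) := by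
  set μ : ι → ℝ := fun c => (l c)⁻¹ with hμ
  set ζ : ι → ℝ := fun c => (l c)⁻¹ * ξ c with hζ
  have hjU : ∀ c ∈ U, c ≠ j := fun c hc => Finset.ne_of_mem_erase (hU ▸ hc)
  have ej : ∑ b ∈ Finset.univ.erase j, sig₂ l j b * (ξ j * ξ b)
      = M * ξ j * (R * ∑ c ∈ U, ζ c - ∑ c ∈ U, μ c * ζ c) := by
    rw [← hU, Finset.mul_sum, ← Finset.sum_sub_distrib, Finset.mul_sum]
    refine Finset.sum_congr rfl fun b hb => ?_
    rw [sig₂_self_eq h (hjU b hb), ← hU, ← hM, ← hR]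
    simp only [hζ, hμ]; ring
  have ea : ∀ a ∈ U, ∑ b ∈ Finset.univ.erase a, sig₂ l a b * (ξ a * ξ b)
      = M * ξ j * (R * ζ a - μ a * ζ a)
        + M * ((1 + l j * R) * (ζ a * (∑ c ∈ U, ζ c - ζ a))
          - l j * (μ a * ζ a * (∑ c ∈ U, ζ c) + ζ a * (∑ c ∈ U, μ c * ζ c)
            - 2 * (μ a * ζ a ^ 2))) := by
    intro a ha
    have haj := hjU a ha
    have hja : j ∈ Finset.univ.erase a := by simp [haj.symm]
    rw [← Finset.add_sum_erase _ _ hja, Finset.erase_right_comm, ← hU, sig₂_comm,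
      sig₂_self_eq h haj, ← hU, ← hM, ← hR]
    have e1 : ∑ b ∈ U.erase a, sig₂ l a b * (ξ a * ξ b)
        = ∑ b ∈ U.erase a, M * ((1 + l j * R - l j * μ a) * ζ a * ζ b
            - l j * ζ a * (μ b * ζ b)) := by
      refine Finset.sum_congr rfl fun b hb => ?_
      rw [sig₂_eq h haj (hjU b (Finset.mem_of_mem_erase hb)) (Finset.ne_of_mem_erase hb),
        ← hU, ← hM, ← hR]
      simp only [hζ, hμ]; ring
    have e2 : ∑ b ∈ U.erase a, ζ b = ∑ c ∈ U, ζ c - ζ a := by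
      rw [← Finset.add_sum_erase U _ ha]; ring
    have e3 : ∑ b ∈ U.erase a, μ b * ζ b = ∑ c ∈ U, μ c * ζ c - μ a * ζ a := by
      rw [← Finset.add_sum_erase U _ ha]; ring
    rw [e1, ← Finset.mul_sum, Finset.sum_sub_distrib, ← Finset.mul_sum, ← Finset.mul_sum, e2, e3]
    simp only [hζ, hμ]; ring
  rw [negHess, ← Finset.add_sum_erase _ _ (Finset.mem_univ j), ej, ← hU, Finset.sum_congr rfl ea]
  have e4 : ∑ a ∈ U, (M * ξ j * (R * ζ a - μ a * ζ a)
        + M * ((1 + l j * R) * (ζ a * (∑ c ∈ U, ζ c - ζ a))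
          - l j * (μ a * ζ a * (∑ c ∈ U, ζ c) + ζ a * (∑ c ∈ U, μ c * ζ c)
            - 2 * (μ a * ζ a ^ 2))))
      = ∑ a ∈ U, (M * (ξ j * R + (1 + l j * R) * (∑ c ∈ U, ζ c)
            - l j * ∑ c ∈ U, μ c * ζ c) * ζ a
          - M * (ξ j + l j * ∑ c ∈ U, ζ c) * (μ a * ζ a)
          - M * (1 + l j * R) * ζ a ^ 2 + 2 * M * l j * (μ a * ζ a ^ 2)) :=
    Finset.sum_congr rfl fun a _ => by ring
  rw [e4]
  simp only [Finset.sum_add_distrib, Finset.sum_sub_distrib, ← Finset.mul_sum]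
  ring

end Esymm
-- Points of the cone and concavity in tangent directions
section Esymm

variable {ι : Type*} [DecidableEq ι] [Fintype ι]

/-- `l` is a point of the cone `Γ_{n-1}` with largest entry `l i₀` and smallest entry `l j`. -/
structure IsAdmissible (l : ι → ℝ) (i₀ j : ι) : Prop where
  ne : i₀ ≠ j
  pos : ∀ c, c ≠ j → 0 < l c
  le_top : ∀ c, l c ≤ l i₀
  bot_le : ∀ c, l j ≤ l c
  sig_pos : 0 < sig l

namespace IsAdmissible

variable {l : ι → ℝ} {i₀ j : ι}

theorem ne_zero (h : IsAdmissible l i₀ j) (c : ι) (hc : c ≠ j) : l c ≠ 0 := (h.pos c hc).ne'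

theorem top_pos (h : IsAdmissible l i₀ j) : 0 < l i₀ := h.pos _ h.ne

theorem prod_pos (h : IsAdmissible l i₀ j) : 0 < ∏ c ∈ Finset.univ.erase j, l c :=
  Finset.prod_pos fun c hc => h.pos c (Finset.ne_of_mem_erase hc)

theorem sum_inv_pos (h : IsAdmissible l i₀ j) : 0 < ∑ c ∈ Finset.univ.erase j, (l c)⁻¹ :=
  Finset.sum_pos (fun c hc => inv_pos.2 (h.pos c (Finset.ne_of_mem_erase hc)))
    ⟨i₀, by simp [h.ne]⟩

theorem one_add_pos (h : IsAdmissible l i₀ j) :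
    0 < 1 + l j * ∑ c ∈ Finset.univ.erase j, (l c)⁻¹ := by
  have := h.sig_pos
  rw [sig_eq h.ne_zero] at this
  exact pos_of_mul_pos_right this h.prod_pos.le

theorem inv_le_sum_inv (h : IsAdmissible l i₀ j) {c : ι} (hc : c ≠ j) :
    (l c)⁻¹ ≤ ∑ c ∈ Finset.univ.erase j, (l c)⁻¹ :=
  Finset.single_le_sum (f := fun c => (l c)⁻¹)
    (fun c hc => (inv_pos.2 (h.pos c (Finset.ne_of_mem_erase hc))).le) (by simp [hc])

theorem one_add_sub_pos (h : IsAdmissible l i₀ j) {c : ι} (hc : c ≠ j) :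
    0 < 1 + l j * (∑ c ∈ Finset.univ.erase j, (l c)⁻¹ - (l c)⁻¹) := by
  have h1 := h.one_add_pos
  have h2 := h.inv_le_sum_inv hc
  have h3 : 0 < (l c)⁻¹ := inv_pos.2 (h.pos c hc)
  rcases le_or_gt 0 (l j) with h0 | h0
  · have : 0 ≤ l j * (∑ c ∈ Finset.univ.erase j, (l c)⁻¹ - (l c)⁻¹) :=
      mul_nonneg h0 (by linarith)
    linarith
  · nlinarith

theorem sig₁_pos (h : IsAdmissible l i₀ j) (c : ι) : 0 < sig₁ l c := by
  by_cases hc : c = j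
  · rw [hc, sig₁_self_eq h.ne_zero]
    exact mul_pos h.prod_pos h.sum_inv_pos
  · rw [sig₁_eq h.ne_zero hc]
    exact mul_pos (mul_pos h.prod_pos (inv_pos.2 (h.pos c hc))) (h.one_add_sub_pos hc)

/-- The `i₀` term alone suffices. A third index `k` makes the sum of inverses at least `2 / l i₀`,
so dropping one inverse loses at most a factor 2 when `l j ≥ 0`, and only helps when `l j < 0`. -/
theorem sig_mul_top_le (h : IsAdmissible l i₀ j) {k : ι} (hk : k ≠ i₀) (hkj : k ≠ j) :
    sig l * l i₀ ≤ 2 * ∑ c, sig₁ l c * l c ^ 2 := by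
  have h1 : sig₁ l i₀ * l i₀ ^ 2 ≤ ∑ c, sig₁ l c * l c ^ 2 :=
    Finset.single_le_sum (f := fun c => sig₁ l c * l c ^ 2)
      (fun c _ => mul_nonneg (h.sig₁_pos c).le (sq_nonneg _)) (Finset.mem_univ i₀)
  refine le_trans ?_ (mul_le_mul_of_nonneg_left h1 two_pos.le)
  rw [sig_eq h.ne_zero, sig₁_eq h.ne_zero h.ne]
  have h0 := h.top_pos
  have hM := h.prod_pos
  have h2 : 2 * (l i₀)⁻¹ ≤ ∑ c ∈ Finset.univ.erase j, (l c)⁻¹ := by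
    have hi : i₀ ∈ Finset.univ.erase j := by simp [h.ne]
    have hk' : k ∈ (Finset.univ.erase j).erase i₀ := by simp [hk, hkj]
    rw [← Finset.add_sum_erase _ _ hi]
    have h3 : (l k)⁻¹ ≤ ∑ c ∈ (Finset.univ.erase j).erase i₀, (l c)⁻¹ :=
      Finset.single_le_sum (f := fun c => (l c)⁻¹)
        (fun c hc => (inv_pos.2 (h.pos c
          (Finset.ne_of_mem_erase (Finset.mem_of_mem_erase hc)))).le) hk'
    have h4 : (l i₀)⁻¹ ≤ (l k)⁻¹ := by
      rw [inv_le_inv₀ h0 (h.pos k hkj)]; exact h.le_top k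
    linarith
  set R := ∑ c ∈ Finset.univ.erase j, (l c)⁻¹
  set M := ∏ c ∈ Finset.univ.erase j, l c
  have e : 2 * (M * (l i₀)⁻¹ * (1 + l j * (R - (l i₀)⁻¹)) * l i₀ ^ 2)
      = M * l i₀ * (2 * (1 + l j * (R - (l i₀)⁻¹))) := by field_simp
  rw [e]
  have h5 : 1 + l j * R ≤ 2 * (1 + l j * (R - (l i₀)⁻¹)) := by
    have h1 := h.one_add_pos
    have hi := inv_pos.2 h0
    rcases le_or_gt 0 (l j) with hj | hj
    · have : 0 ≤ l j * (R - 2 * (l i₀)⁻¹) := mul_nonneg hj (by linarith)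
      linarith
    · have : 0 ≤ -l j * (l i₀)⁻¹ := mul_nonneg (by linarith) hi.le
      change 0 < 1 + l j * R at h1
      linarith
  calc M * (1 + l j * R) * l i₀ = M * l i₀ * (1 + l j * R) := by ring
    _ ≤ _ := mul_le_mul_of_nonneg_left h5 (by positivity)

/-- Positivity of σ_{n-1} means `1 + l j * R > 0`, and the indices `i₀` and `k` give `R ≥ 2 / l i₀`.
The factor 2 fixes the constants 4/3 and 3/2 in the later third-order estimates. -/
theorem neg_top_lt (h : IsAdmissible l i₀ j) {k : ι} (hk : k ≠ i₀) (hkj : k ≠ j) (c : ι) :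
    -l i₀ < 2 * l c := by
  refine lt_of_lt_of_le ?_ (mul_le_mul_of_nonneg_left (h.bot_le c) two_pos.le)
  have h0 := h.top_pos
  rcases le_or_gt 0 (l j) with hj | hj
  · linarith
  have h1 := h.one_add_sub_pos h.ne
  have h4 : (l i₀)⁻¹ ≤ (l k)⁻¹ := by
    rw [inv_le_inv₀ h0 (h.pos k hkj)]; exact h.le_top k
  have h2 : 2 * (l i₀)⁻¹ ≤ ∑ c ∈ Finset.univ.erase j, (l c)⁻¹ := by
    have hi : i₀ ∈ Finset.univ.erase j := by simp [h.ne]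
    have hk' : k ∈ (Finset.univ.erase j).erase i₀ := by simp [hk, hkj]
    rw [← Finset.add_sum_erase _ _ hi]
    have h3 : (l k)⁻¹ ≤ ∑ c ∈ (Finset.univ.erase j).erase i₀, (l c)⁻¹ :=
      Finset.single_le_sum (f := fun c => (l c)⁻¹)
        (fun c hc => (inv_pos.2 (h.pos c
          (Finset.ne_of_mem_erase (Finset.mem_of_mem_erase hc)))).le) hk'
    linarith
  have h5 := h.one_add_pos
  have h6 : 0 < 1 + l j * (2 * (l i₀)⁻¹) := by nlinarith
  have h7 := mul_pos h6 h0
  have e : (1 + l j * (2 * (l i₀)⁻¹)) * l i₀ = l i₀ + 2 * l j := by field_simp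
  linarith

/-- The concavity inequality for `σ_{n-1}` on its tangent space. -/
theorem concavity_of_tangent (h : IsAdmissible l i₀ j) {k : ι} (hk : k ≠ i₀) (hkj : k ≠ j)
    (ξ : ι → ℝ) (hξ : ∑ c, sig₁ l c * ξ c = 0) :
    (1 + 1 / (72 * Fintype.card ι)) * (sig₁ l i₀ * ξ i₀ ^ 2) ≤ l i₀ * negHess l ξ
      + 5 / 4 * ∑ c ∈ Finset.univ.erase i₀, sig₁ l c * ξ c ^ 2 := by
  set U := Finset.univ.erase j with hU
  set s := U.erase i₀ with hs
  have hi : i₀ ∈ U := by simp [hU, h.ne]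
  have hk' : k ∈ s := by simp [hs, hU, hk, hkj]
  set M := ∏ c ∈ U, l c with hM
  set R := ∑ c ∈ U, (l c)⁻¹ with hR
  have hM0 : 0 < M := h.prod_pos
  have hR0 : 0 < R := h.sum_inv_pos
  have ht0 : 0 < 1 + l j * R := h.one_add_pos
  have h0 := h.top_pos
  have hjU : ∀ c ∈ U, c ≠ j := fun c hc => Finset.ne_of_mem_erase hc
  have hsU : ∀ c ∈ s, c ∈ U := fun c hc => Finset.mem_of_mem_erase hc
  have hcard : Fintype.card ι = s.card + 2 := by
    have h1 := Finset.card_erase_add_one (Finset.mem_univ j)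
    have h2 := Finset.card_erase_add_one hi
    rw [Finset.card_univ, ← hU] at h1
    rw [← hs] at h2
    omega
  -- The weights are the normalized inverses of the entries other than `l j`; `t > -1` is positivity
  -- of σ_{n-1}, and `t * P c = l j / l c ≤ 1` is minimality of `l j`.
  have hform := logForm_nonneg (s := s) (p := (l i₀)⁻¹ / R) (P := fun c => (l c)⁻¹ / R)
    ((l i₀)⁻¹ * ξ i₀) (fun c => (l c)⁻¹ * ξ c) (t := l j * R)
    (δ := 1 / (72 * Fintype.card ι)) (by positivity) (by
      intro c hc
      refine div_le_div_of_nonneg_right ?_ hR0.le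
      rw [inv_le_inv₀ h0 (h.pos c (hjU c (hsU c hc)))]
      exact h.le_top c) ⟨k, hk'⟩ (by
      rw [← Finset.sum_div, ← add_div, hs, Finset.add_sum_erase _ (fun c => (l c)⁻¹) hi]
      exact div_self hR0.ne') (by linarith) (by
      intro _ c hc
      have hc0 := h.pos c (hjU c (hsU c hc))
      have e : l j * R * ((l c)⁻¹ / R) = l j / l c := by field_simp
      rw [e, div_le_one hc0]
      exact h.bot_le c) (by positivity) (le_of_eq (by rw [hcard]; push_cast; ring))
  set δ : ℝ := 1 / (72 * Fintype.card ι)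
  clear_value M R δ
  unfold logForm at hform
  beta_reduce at hform
  rw [sum_sig₁_mul_eq h.ne_zero ξ hU hM hR] at hξ
  rw [negHess_eq h.ne_zero ξ hU hM hR, sig₁_eq h.ne_zero h.ne, ← hU, ← hM, ← hR]
  have hjs : j ∈ Finset.univ.erase i₀ := by simp [h.ne.symm]
  rw [← Finset.add_sum_erase _ _ hjs, Finset.erase_right_comm, ← hU, ← hs,
    sig₁_self_eq h.ne_zero, ← hU, ← hM, ← hR]
  rw [← Finset.add_sum_erase _ _ hi, ← Finset.add_sum_erase _ _ hi, ← hs] at hξ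
  simp only [← Finset.add_sum_erase _ _ hi, ← hs]
  have es : ∑ c ∈ s, sig₁ l c * ξ c ^ 2 = M * l i₀ * ((1 + l j * R) *
        ∑ c ∈ s, (l i₀)⁻¹ / R / ((l c)⁻¹ / R) * ((l c)⁻¹ * ξ c) ^ 2
      - l j * (l i₀)⁻¹ * ∑ c ∈ s, ((l c)⁻¹ * ξ c) ^ 2) := by
    rw [Finset.mul_sum, Finset.mul_sum, ← Finset.sum_sub_distrib, Finset.mul_sum]
    refine Finset.sum_congr rfl fun c hc => ?_
    rw [sig₁_eq h.ne_zero (hjU c (hsU c hc)), ← hU, ← hM, ← hR]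
    have hc0 := h.pos c (hjU c (hsU c hc))
    field_simp
    ring
  have e1 : ∑ c ∈ s, (l c)⁻¹ / R * ((l c)⁻¹ * ξ c)
      = (∑ c ∈ s, (l c)⁻¹ * ((l c)⁻¹ * ξ c)) / R := by
    rw [Finset.sum_div]; exact Finset.sum_congr rfl fun c _ => by ring
  have e2 : ∑ c ∈ s, (l c)⁻¹ / R * ((l c)⁻¹ * ξ c) ^ 2
      = (∑ c ∈ s, (l c)⁻¹ * ((l c)⁻¹ * ξ c) ^ 2) / R := by
    rw [Finset.sum_div]; exact Finset.sum_congr rfl fun c _ => by ring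
  rw [e1, e2] at hform
  rw [es]
  set Y := ∑ c ∈ s, (l c)⁻¹ * ξ c
  set X := ∑ c ∈ s, (l c)⁻¹ * ((l c)⁻¹ * ξ c)
  set S := ∑ c ∈ s, ((l c)⁻¹ * ξ c) ^ 2
  set V := ∑ c ∈ s, (l c)⁻¹ * ((l c)⁻¹ * ξ c) ^ 2
  set W := ∑ c ∈ s, (l i₀)⁻¹ / R / ((l c)⁻¹ / R) * ((l c)⁻¹ * ξ c) ^ 2
  obtain ⟨z, hz⟩ : ∃ z, z = (l i₀)⁻¹ * ξ i₀ := ⟨_, rfl⟩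
  have hξ0 : ξ i₀ = l i₀ * z := by rw [hz]; field_simp
  rw [← hz] at hξ hform ⊢
  rw [hξ0]
  -- Tangency determines `ξ j`; after this substitution the claim is `M * l i₀` times the
  -- nonnegativity of `logForm`.
  have hξj : ξ j = (l j * ((l i₀)⁻¹ * z + X) - (1 + l j * R) * (z + Y)) / R := by
    have := (mul_eq_zero.1 hξ).resolve_left hM0.ne'
    field_simp
    field_simp at this
    linarith
  rw [hξj]
  have := mul_nonneg (mul_nonneg hM0.le h0.le) hform
  rw [← sub_nonneg]
  refine this.trans (le_of_eq ?_)
  field_simp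
  ring

end IsAdmissible
end Esymm
-- Concavity in all directions and the third-order terms
section Esymm

variable {ι : Type*} [DecidableEq ι]

theorem esymmPred_erase {S : Finset ι} (l : ι → ℝ) {b : ι} (hb : b ∈ S) :
    esymmPred S l = l b * esymmPred (S.erase b) l + ∏ c ∈ S.erase b, l c := by
  rw [esymmPred, ← Finset.add_sum_erase S _ hb, add_comm, esymmPred, Finset.mul_sum]
  congr 1
  refine Finset.sum_congr rfl fun i hi => ?_
  have hbi : b ∈ S.erase i := Finset.mem_erase.2 ⟨(Finset.ne_of_mem_erase hi).symm, hb⟩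
  rw [← Finset.mul_prod_erase _ l hbi, Finset.erase_right_comm]

variable [Fintype ι]

theorem sig₁_sub_sig₁ (l : ι → ℝ) {a b : ι} (hab : a ≠ b) :
    sig₁ l a - sig₁ l b = (l b - l a) * sig₂ l a b := by
  rw [sig₁, esymmPred_erase l (b := b) (by simp [hab.symm]), sig₁,
    esymmPred_erase l (S := Finset.univ.erase b) (b := a) (by simp [hab]), sig₂,
    Finset.erase_right_comm (a := b)]
  ring

namespace IsAdmissible

variable {l : ι → ℝ} {i₀ j : ι}

theorem sum_sig₁_mul_self (h : IsAdmissible l i₀ j) :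
    ∑ c, sig₁ l c * l c = (Fintype.card ι - 1) * sig l := by
  rw [sum_sig₁_mul_eq h.ne_zero l rfl rfl rfl, sig_eq h.ne_zero]
  set U := Finset.univ.erase j with hU
  have hμ : ∀ c ∈ U, (l c)⁻¹ * l c = 1 := fun c hc =>
    inv_mul_cancel₀ (h.ne_zero c (Finset.ne_of_mem_erase hc))
  have hcard : (U.card : ℝ) = Fintype.card ι - 1 := by
    have h1 := Finset.card_erase_add_one (Finset.mem_univ j)
    rw [Finset.card_univ, ← hU] at h1
    rw [← h1]; push_cast; ring
  have e1 : ∑ c ∈ U, (l c)⁻¹ * l c = Fintype.card ι - 1 := by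
    rw [Finset.sum_congr rfl hμ]; simp [hcard]
  have e2 : ∑ c ∈ U, (l c)⁻¹ * ((l c)⁻¹ * l c) = ∑ c ∈ U, (l c)⁻¹ :=
    Finset.sum_congr rfl fun c hc => by rw [hμ c hc, mul_one]
  rw [e1, e2]
  ring

/-- This is Euler's relation for the homogeneous first derivatives: the Hessian of σ_{n-1} applied
to `l` is `n - 2` times its gradient. -/
theorem negHess_sub (h : IsAdmissible l i₀ j) (ξ : ι → ℝ) (s : ℝ) :
    negHess l (fun c => ξ c - s * l c) = negHess l ξ + (Fintype.card ι - 2) *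
      (2 * s * ∑ c, sig₁ l c * ξ c - s ^ 2 * ((Fintype.card ι - 1) * sig l)) := by
  rw [negHess_eq h.ne_zero _ rfl rfl rfl, negHess_eq h.ne_zero ξ rfl rfl rfl,
    sum_sig₁_mul_eq h.ne_zero ξ rfl rfl rfl, sig_eq h.ne_zero]
  set U := Finset.univ.erase j with hU
  have hμ : ∀ c ∈ U, (l c)⁻¹ * (ξ c - s * l c) = (l c)⁻¹ * ξ c - s := fun c hc => by
    have := h.ne_zero c (Finset.ne_of_mem_erase hc)
    field_simp
  have hcard : (U.card : ℝ) = Fintype.card ι - 1 := by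
    have h1 := Finset.card_erase_add_one (Finset.mem_univ j)
    rw [Finset.card_univ, ← hU] at h1
    rw [← h1]; push_cast; ring
  have e1 : ∑ c ∈ U, (l c)⁻¹ * (ξ c - s * l c)
      = ∑ c ∈ U, (l c)⁻¹ * ξ c - (Fintype.card ι - 1) * s := by
    rw [Finset.sum_congr rfl hμ, Finset.sum_sub_distrib]; simp [hcard]
  have e2 : ∑ c ∈ U, ((l c)⁻¹ * (ξ c - s * l c)) ^ 2 = ∑ c ∈ U, ((l c)⁻¹ * ξ c) ^ 2
      - 2 * s * ∑ c ∈ U, (l c)⁻¹ * ξ c + (Fintype.card ι - 1) * s ^ 2 := by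
    rw [← hcard, ← nsmul_eq_mul, ← Finset.sum_const, Finset.mul_sum, ← Finset.sum_sub_distrib,
      ← Finset.sum_add_distrib]
    exact Finset.sum_congr rfl fun c hc => by rw [hμ c hc]; ring
  have e3 : ∑ c ∈ U, (l c)⁻¹ * ((l c)⁻¹ * (ξ c - s * l c))
      = ∑ c ∈ U, (l c)⁻¹ * ((l c)⁻¹ * ξ c) - s * ∑ c ∈ U, (l c)⁻¹ := by
    rw [Finset.mul_sum, ← Finset.sum_sub_distrib]
    exact Finset.sum_congr rfl fun c hc => by rw [hμ c hc]; ring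
  have e4 : ∑ c ∈ U, (l c)⁻¹ * ((l c)⁻¹ * (ξ c - s * l c)) ^ 2
      = ∑ c ∈ U, (l c)⁻¹ * ((l c)⁻¹ * ξ c) ^ 2 - 2 * s * ∑ c ∈ U, (l c)⁻¹ * ((l c)⁻¹ * ξ c)
        + s ^ 2 * ∑ c ∈ U, (l c)⁻¹ := by
    rw [Finset.mul_sum, Finset.mul_sum, ← Finset.sum_sub_distrib, ← Finset.sum_add_distrib]
    exact Finset.sum_congr rfl fun c hc => by rw [hμ c hc]; ring
  rw [e1, e2, e3, e4]
  ring

theorem sig₂_nonneg (h : IsAdmissible l i₀ j) {a b : ι} (hab : a ≠ b) : 0 ≤ sig₂ l a b := by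
  have aux : ∀ a, a ≠ j → 0 ≤ sig₂ l j a := fun a ha => by
    rw [sig₂_self_eq h.ne_zero ha]
    exact mul_nonneg (mul_nonneg h.prod_pos.le (inv_pos.2 (h.pos a ha)).le)
      (sub_nonneg.2 (h.inv_le_sum_inv ha))
  by_cases ha : a = j
  · rw [ha]; exact aux b (fun hb => hab (ha.trans hb.symm))
  by_cases hb : b = j
  · rw [hb, sig₂_comm]; exact aux a ha
  rw [sig₂_eq h.ne_zero ha hb hab.symm]
  have hμa := inv_pos.2 (h.pos a ha)
  have hμb := inv_pos.2 (h.pos b hb)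
  refine mul_nonneg (mul_nonneg (mul_nonneg h.prod_pos.le hμa.le) hμb.le) ?_
  have h1 := h.one_add_pos
  have h2 : (l a)⁻¹ + (l b)⁻¹ ≤ ∑ c ∈ Finset.univ.erase j, (l c)⁻¹ := by
    rw [← Finset.add_sum_erase _ _ (by simp [ha] : a ∈ Finset.univ.erase j)]
    have := Finset.single_le_sum (s := (Finset.univ.erase j).erase a) (f := fun c => (l c)⁻¹)
      (fun c hc => (inv_pos.2 (h.pos c
          (Finset.ne_of_mem_erase (Finset.mem_of_mem_erase hc)))).le)
      (by simp [hb, hab.symm] : b ∈ (Finset.univ.erase j).erase a)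
    linarith
  set R := ∑ c ∈ Finset.univ.erase j, (l c)⁻¹
  rcases le_or_gt 0 (l j) with h0 | h0
  · have : 0 ≤ l j * (R - (l a)⁻¹ - (l b)⁻¹) := mul_nonneg h0 (by linarith)
    linarith
  · have : 0 ≤ -l j * ((l a)⁻¹ + (l b)⁻¹) := mul_nonneg (by linarith) (by linarith)
    linarith

/-- The concavity inequality for `σ_{n-1}` in all directions. -/
theorem concavity (h : IsAdmissible l i₀ j) {k : ι} (hk : k ≠ i₀) (hkj : k ≠ j) (ξ : ι → ℝ) :
    (1 + 1 / (144 * Fintype.card ι)) * (sig₁ l i₀ * ξ i₀ ^ 2) ≤ l i₀ * negHess l ξ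
      + 4 / 3 * ∑ c ∈ Finset.univ.erase i₀, sig₁ l c * ξ c ^ 2
      + (2 + 720 * Fintype.card ι) * ((∑ c, sig₁ l c * ξ c) ^ 2 / sig l ^ 2)
        * ∑ c, sig₁ l c * l c ^ 2 := by
  have hn : (3 : ℝ) ≤ Fintype.card ι := by
    have : Finset.card {i₀, j, k} = 3 := by
      rw [Finset.card_eq_three]; exact ⟨i₀, j, k, h.ne, hk.symm, hkj.symm, rfl⟩
    have h2 := Finset.card_le_univ ({i₀, j, k} : Finset ι)
    rw [this] at h2
    exact_mod_cast h2
  have hsub := h.negHess_sub ξ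
  have heul := h.sum_sig₁_mul_self
  set n : ℝ := (Fintype.card ι : ℝ) with hnn
  have hF := h.sig_pos
  have hW := h.sig_mul_top_le hk hkj
  have h0 := h.top_pos
  set L := ∑ c, sig₁ l c * ξ c with hL
  set W := ∑ c, sig₁ l c * l c ^ 2 with hWdef
  have hW0 : 0 ≤ W := Finset.sum_nonneg fun c _ => mul_nonneg (h.sig₁_pos c).le (sq_nonneg _)
  have hn1 : n - 1 ≠ 0 := by linarith
  -- By Euler's relation this `s` makes `ξ - s * l` tangent to the level set.
  obtain ⟨s, hs⟩ : ∃ s, L = s * ((n - 1) * sig l) :=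
    ⟨L / ((n - 1) * sig l), by field_simp⟩
  have htan := h.concavity_of_tangent hk hkj (fun c => ξ c - s * l c) (by
    have e : ∑ c, sig₁ l c * (ξ c - s * l c)
        = ∑ c, sig₁ l c * ξ c - s * ∑ c, sig₁ l c * l c := by
      rw [Finset.mul_sum, ← Finset.sum_sub_distrib]
      exact Finset.sum_congr rfl fun c _ => by ring
    rw [e, ← hL, heul, hs]; ring)
  rw [hsub s, hs, ← hnn] at htan
  have hδ : (1 : ℝ) / (72 * n) = 2 * (1 / (144 * n)) := by field_simp; norm_num
  rw [hδ] at htan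
  obtain ⟨δ, hδd⟩ : ∃ δ, δ = 1 / (144 * n) := ⟨_, rfl⟩
  have hδn : δ * n = 1 / 144 := by rw [hδd]; field_simp
  have hδ0 : 0 < δ := by rw [hδd]; positivity
  have hδ1 : δ ≤ 1 / 4 := by nlinarith
  rw [← hδd] at htan ⊢
  have hsum : 5 / 4 * ∑ c ∈ Finset.univ.erase i₀, sig₁ l c * (ξ c - s * l c) ^ 2
      ≤ 4 / 3 * ∑ c ∈ Finset.univ.erase i₀, sig₁ l c * ξ c ^ 2
        + 20 * s ^ 2 * ∑ c ∈ Finset.univ.erase i₀, sig₁ l c * l c ^ 2 := by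
    rw [Finset.mul_sum, Finset.mul_sum, Finset.mul_sum, ← Finset.sum_add_distrib]
    refine Finset.sum_le_sum fun c _ => ?_
    have h1 : 5 / 4 * (ξ c - s * l c) ^ 2 ≤ 4 / 3 * ξ c ^ 2 + 20 * s ^ 2 * l c ^ 2 := by
      linear_combination (1 / 12) * sq_nonneg (ξ c + 15 * (s * l c))
    have h2 := mul_le_mul_of_nonneg_left h1 (h.sig₁_pos c).le
    linarith
  have hWsplit : W = sig₁ l i₀ * l i₀ ^ 2 + ∑ c ∈ Finset.univ.erase i₀, sig₁ l c * l c ^ 2 :=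
    (Finset.add_sum_erase _ _ (Finset.mem_univ i₀)).symm
  set W' := ∑ c ∈ Finset.univ.erase i₀, sig₁ l c * l c ^ 2
  have hW'0 : 0 ≤ W' := Finset.sum_nonneg fun c _ => mul_nonneg (h.sig₁_pos c).le (sq_nonneg _)
  set A := ∑ c ∈ Finset.univ.erase i₀, sig₁ l c * ξ c ^ 2
  set A' := ∑ c ∈ Finset.univ.erase i₀, sig₁ l c * (ξ c - s * l c) ^ 2
  -- Half of the gain `2 * δ` is given up to replace the tangent part by `ξ` itself; the cost is of
  -- order `1/δ`, and `720 * n = 5/δ`.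
  have hi : (1 + δ) * ξ i₀ ^ 2 ≤ (1 + 2 * δ) * (ξ i₀ - s * l i₀) ^ 2
      + 720 * n * (s ^ 2 * l i₀ ^ 2) := by
    have hq : (1 + δ) * (1 + δ) ≤ δ * (720 * n - (1 + δ)) := by nlinarith
    have h2 := quadratic_nonneg (a := δ) (b := 1 + δ) (c := 720 * n - (1 + δ)) hδ0
      (by linarith [sq (1 + δ)]) (ξ i₀ - s * l i₀) (s * l i₀)
    linear_combination h2
  have hi' := mul_le_mul_of_nonneg_left hi (h.sig₁_pos i₀).le
  have hLs : L ^ 2 / sig l ^ 2 = s ^ 2 * (n - 1) ^ 2 := by rw [hs]; field_simp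
  rw [← hs] at htan
  rw [hLs]
  have e1 : 0 ≤ s ^ 2 * (n - 2) * (n - 1) * (2 * W - sig l * l i₀) :=
    mul_nonneg (mul_nonneg (mul_nonneg (sq_nonneg s) (by linarith)) (by linarith)) (by linarith)
  have e2 : 0 ≤ s ^ 2 * ((n - 1) ^ 2 - (n - 2) * (n - 1)) * W :=
    mul_nonneg (mul_nonneg (sq_nonneg s) (by nlinarith)) hW0
  have e3 : 0 ≤ n * s ^ 2 * ((n - 1) ^ 2 - 1) * W :=
    mul_nonneg (mul_nonneg (mul_nonneg (by linarith) (sq_nonneg s)) (by nlinarith)) hW0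
  have e4 : 0 ≤ (720 * n - 20) * s ^ 2 * W' :=
    mul_nonneg (mul_nonneg (by linarith) (sq_nonneg s)) hW'0
  have e5 : 720 * n * s ^ 2 * W
      = 720 * n * s ^ 2 * (sig₁ l i₀ * l i₀ ^ 2) + 720 * n * s ^ 2 * W' := by
    rw [hWsplit]; ring
  rw [hs] at htan
  linear_combination htan + hsum + hi' + e1 + 2 * e2 + 720 * e3 + e4 - e5

/-- The estimate of all third-order terms. -/
theorem third_order (h : IsAdmissible l i₀ j) {k : ι} (hk : k ≠ i₀) (hkj : k ≠ j)
    (T : ι → ι → ℝ) (hT : ∀ p q, T p q = T q p) :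
    1 / (144 * Fintype.card ι) * ∑ c, sig₁ l c * T c i₀ ^ 2 ≤
      l i₀ * (negHess l (fun c => T c c)
        + ∑ a, ∑ b ∈ Finset.univ.erase a, sig₂ l a b * T a b ^ 2)
      + 4 / 3 * ∑ c, sig₁ l c * ∑ p ∈ Finset.univ.erase i₀, T p c ^ 2
      - ∑ c, sig₁ l c * T c i₀ ^ 2
      + (2 + 720 * Fintype.card ι) * ((∑ c, sig₁ l c * T c c) ^ 2 / sig l ^ 2)
        * ∑ c, sig₁ l c * l c ^ 2 := by
  have hcon := h.concavity hk hkj fun c => T c c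
  have h0 := h.top_pos
  set E := Finset.univ.erase i₀ with hE
  have hEi : ∀ c ∈ E, c ≠ i₀ := fun c hc => Finset.ne_of_mem_erase hc
  -- Only the ordered pairs containing `i₀` are kept; each unordered pair occurs twice.
  have h1 : 2 * ∑ c ∈ E, sig₂ l i₀ c * T c i₀ ^ 2
      ≤ ∑ a, ∑ b ∈ Finset.univ.erase a, sig₂ l a b * T a b ^ 2 := by
    rw [← Finset.add_sum_erase _ _ (Finset.mem_univ i₀), ← hE, two_mul]
    refine add_le_add (le_of_eq (Finset.sum_congr rfl fun c _ => by rw [hT])) ?_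
    refine Finset.sum_le_sum fun c hc => ?_
    rw [sig₂_comm]
    exact Finset.single_le_sum (s := Finset.univ.erase c) (f := fun b => sig₂ l c b * T c b ^ 2)
      (fun b hb => mul_nonneg (h.sig₂_nonneg (Finset.ne_of_mem_erase hb).symm) (sq_nonneg _))
      (by simp [(hEi c hc).symm])
  have h2 : ∑ c ∈ E, sig₁ l c * T c c ^ 2 + sig₁ l i₀ * ∑ c ∈ E, T c i₀ ^ 2
      ≤ ∑ c, sig₁ l c * ∑ p ∈ E, T p c ^ 2 := by
    rw [← Finset.add_sum_erase _ _ (Finset.mem_univ i₀), ← hE, add_comm]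
    refine add_le_add le_rfl (Finset.sum_le_sum fun c hc => ?_)
    exact mul_le_mul_of_nonneg_left
      (Finset.single_le_sum (f := fun p => T p c ^ 2) (fun _ _ => sq_nonneg _) hc)
      (h.sig₁_pos c).le
  have hδ1 : (1 : ℝ) / (144 * Fintype.card ι) ≤ 1 / 3 := by
    have : (1 : ℝ) ≤ Fintype.card ι := by
      exact_mod_cast Fintype.card_pos_iff.2 ⟨i₀⟩
    rw [div_le_div_iff₀ (by positivity) (by norm_num)]
    linarith
  set δ := (1 : ℝ) / (144 * Fintype.card ι)
  have h3 : (1 + δ) * ∑ c ∈ E, sig₁ l c * T c i₀ ^ 2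
      ≤ l i₀ * (2 * ∑ c ∈ E, sig₂ l i₀ c * T c i₀ ^ 2)
        + 4 / 3 * (sig₁ l i₀ * ∑ c ∈ E, T c i₀ ^ 2) := by
    rw [Finset.mul_sum, Finset.mul_sum, Finset.mul_sum, Finset.mul_sum, Finset.mul_sum,
      ← Finset.sum_add_distrib]
    refine Finset.sum_le_sum fun c hc => ?_
    have hs := sig₁_sub_sig₁ l (hEi c hc)
    rw [sig₂_comm] at hs
    have hG := h.sig₂_nonneg (hEi c hc).symm
    have hlt := h.neg_top_lt hk hkj c
    -- The divided difference formula is combined with `l c > -l i₀ / 2`. Multiplied by `1 + δ ≤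
    -- 4/3`, the coefficients become at most 4/3 and 2, which is what is available.
    have hle : sig₁ l c ≤ sig₁ l i₀ + 3 / 2 * (l i₀ * sig₂ l i₀ c) := by nlinarith
    have hc0 := h.sig₁_pos c
    have h4 : (1 + δ) * sig₁ l c ≤ 2 * (l i₀ * sig₂ l i₀ c) + 4 / 3 * sig₁ l i₀ := by
      nlinarith
    have := mul_le_mul_of_nonneg_right h4 (sq_nonneg (T c i₀))
    linarith
  rw [← Finset.add_sum_erase _ _ (Finset.mem_univ i₀), ← hE]
  have h5 := mul_le_mul_of_nonneg_left h1 h0.le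
  linear_combination hcon + h5 + 4 / 3 * h2 + h3

end IsAdmissible
end Esymm
end HessianEq

/-! ### Derivatives of σ_{n-1} along paths of matrices -/

namespace HessianEq
open Filter Topology

section MatrixPath

variable {ι : Type*} [DecidableEq ι]

theorem perm_eq_one_of_fix {σ : Equiv.Perm ι} {a : ι} (h : ∀ c, c ≠ a → σ c = c) : σ = 1 := by
  ext c
  by_cases hc : c = a
  · subst hc
    by_contra hne
    have h1 := h (σ c) hne
    exact hne (σ.injective h1)
  · exact h c hc

theorem perm_eq_one_or_swap_of_fix {σ : Equiv.Perm ι} {a b : ι}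
    (h : ∀ c, c ≠ a → c ≠ b → σ c = c) : σ = 1 ∨ σ = Equiv.swap a b := by
  by_cases hab : a = b
  · exact Or.inl (perm_eq_one_of_fix (a := a) fun c hc => h c hc (hab ▸ hc))
  by_cases ha : σ a = a
  · refine Or.inl (perm_eq_one_of_fix (a := b) fun c hc => ?_)
    by_cases hca : c = a
    · rw [hca, ha]
    · exact h c hca hc
  · right
    have hσa : σ a = b := by
      by_contra hb
      exact ha (σ.injective (h (σ a) ha hb))
    have hσb : σ b = a := by
      by_contra hb
      by_cases hbb : σ b = b
      · exact hab (σ.injective (hσa.trans hbb.symm))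
      · exact hbb (σ.injective (h (σ b) hb hbb))
    ext c
    by_cases hca : c = a
    · rw [hca, hσa, Equiv.swap_apply_left]
    by_cases hcb : c = b
    · rw [hcb, hσb, Equiv.swap_apply_right]
    rw [h c hca hcb, Equiv.swap_apply_of_ne_of_ne hca hcb]

variable [Fintype ι]

theorem sum_perm_diagonal_one (d : ι → ℝ) (m : ι → ι → ℝ) (a : ι) :
    ∑ σ : Equiv.Perm ι, ((Equiv.Perm.sign σ : ℤ) : ℝ)
      * ((∏ c ∈ Finset.univ.erase a, Matrix.diagonal d (σ c) c) * m (σ a) a)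
      = (∏ c ∈ Finset.univ.erase a, d c) * m a a := by
  rw [Finset.sum_eq_single 1]
  · simp
  · intro σ _ hσ
    have : ∃ c, c ≠ a ∧ σ c ≠ c := by
      by_contra hcon
      push Not at hcon
      exact hσ (perm_eq_one_of_fix hcon)
    obtain ⟨c, hca, hc⟩ := this
    have e : ∏ c ∈ Finset.univ.erase a, Matrix.diagonal d (σ c) c = 0 :=
      Finset.prod_eq_zero (i := c) (by simp [hca]) (Matrix.diagonal_apply_ne _ hc)
    rw [e, zero_mul, mul_zero]
  · simp

/-- A permutation contributes only if it fixes every index other than `a` and `b`, which leaves the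
identity and the transposition. -/
theorem sum_perm_diagonal_two (d : ι → ℝ) (m : ι → ι → ℝ) {a b : ι} (hab : a ≠ b) :
    ∑ σ : Equiv.Perm ι, ((Equiv.Perm.sign σ : ℤ) : ℝ)
      * ((∏ c ∈ (Finset.univ.erase a).erase b, Matrix.diagonal d (σ c) c)
        * m (σ b) b * m (σ a) a)
      = (∏ c ∈ (Finset.univ.erase a).erase b, d c) * (m a a * m b b - m a b * m b a) := by
  have hne : (1 : Equiv.Perm ι) ≠ Equiv.swap a b := fun h => hab (by
    have := congrArg (fun σ : Equiv.Perm ι => σ b) h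
    simpa using this.symm)
  rw [Finset.sum_eq_add (1 : Equiv.Perm ι) (Equiv.swap a b) hne]
  · have e : ∏ c ∈ (Finset.univ.erase a).erase b, Matrix.diagonal d (Equiv.swap a b c) c
        = ∏ c ∈ (Finset.univ.erase a).erase b, d c := by
      refine Finset.prod_congr rfl fun c hc => ?_
      rw [Equiv.swap_apply_of_ne_of_ne (Finset.ne_of_mem_erase (Finset.mem_of_mem_erase hc))
        (Finset.ne_of_mem_erase hc), Matrix.diagonal_apply_eq]
    rw [e, Equiv.Perm.sign_swap hab]
    simp
    ring
  · intro σ _ hσ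
    have : ∃ c, c ≠ a ∧ c ≠ b ∧ σ c ≠ c := by
      by_contra hcon
      push Not at hcon
      rcases perm_eq_one_or_swap_of_fix hcon with h | h
      · exact hσ.1 h
      · exact hσ.2 h
    obtain ⟨c, hca, hcb, hc⟩ := this
    have e : ∏ c ∈ (Finset.univ.erase a).erase b, Matrix.diagonal d (σ c) c = 0 :=
      Finset.prod_eq_zero (i := c) (by simp [hca, hcb]) (Matrix.diagonal_apply_ne _ hc)
    rw [e, zero_mul, zero_mul, mul_zero]
  · simp
  · simp

/-- The first two derivatives of the determinant along a path of matrices that is diagonal at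
time `0`. -/
theorem det_path {M M₁ : ℝ → Matrix ι ι ℝ} {M₂ : Matrix ι ι ℝ} {d : ι → ℝ}
    (h₁ : ∀ᶠ t in 𝓝 0, ∀ a b, HasDerivAt (fun t => M t a b) (M₁ t a b) t)
    (h₂ : ∀ a b, HasDerivAt (fun t => M₁ t a b) (M₂ a b) 0) (h₀ : M 0 = Matrix.diagonal d) :
    ∃ f₁ : ℝ → ℝ, (∀ᶠ t in 𝓝 0, HasDerivAt (fun t => (M t).det) (f₁ t) t) ∧
      f₁ 0 = ∑ a, (∏ c ∈ Finset.univ.erase a, d c) * M₁ 0 a a ∧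
      HasDerivAt f₁ (∑ a, (∏ c ∈ Finset.univ.erase a, d c) * M₂ a a
        + ∑ a, ∑ b ∈ Finset.univ.erase a, (∏ c ∈ (Finset.univ.erase a).erase b, d c)
          * (M₁ 0 a a * M₁ 0 b b - M₁ 0 a b * M₁ 0 b a)) 0 := by
  refine ⟨fun t => ∑ σ : Equiv.Perm ι, ((Equiv.Perm.sign σ : ℤ) : ℝ) *
    ∑ a, (∏ c ∈ Finset.univ.erase a, M t (σ c) c) * M₁ t (σ a) a, ?_, ?_, ?_⟩
  · filter_upwards [h₁] with t ht
    simp only [Matrix.det_apply']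
    refine HasDerivAt.fun_sum fun σ _ => HasDerivAt.const_mul _ ?_
    simpa [smul_eq_mul] using
      HasDerivAt.fun_finsetProd (u := Finset.univ) (f := fun c t => M t (σ c) c)
        (f' := fun c => M₁ t (σ c) c) fun c _ => ht (σ c) c
  · simp only [h₀, Finset.mul_sum]
    rw [Finset.sum_comm]
    exact Finset.sum_congr rfl fun a _ => sum_perm_diagonal_one d (M₁ 0) a
  · have h₁' := h₁.self_of_nhds
    have hd : HasDerivAt (fun t => ∑ σ : Equiv.Perm ι, ((Equiv.Perm.sign σ : ℤ) : ℝ) *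
      ∑ a, (∏ c ∈ Finset.univ.erase a, M t (σ c) c) * M₁ t (σ a) a)
      (∑ σ : Equiv.Perm ι, ((Equiv.Perm.sign σ : ℤ) : ℝ) *
        ∑ a, ((∑ b ∈ Finset.univ.erase a,
          (∏ c ∈ (Finset.univ.erase a).erase b, M 0 (σ c) c) * M₁ 0 (σ b) b) * M₁ 0 (σ a) a
          + (∏ c ∈ Finset.univ.erase a, M 0 (σ c) c) * M₂ (σ a) a)) 0 := by
      refine HasDerivAt.fun_sum fun σ _ => HasDerivAt.const_mul _ ?_
      refine HasDerivAt.fun_sum fun a _ => HasDerivAt.fun_mul ?_ (h₂ (σ a) a)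
      simpa [smul_eq_mul] using
        HasDerivAt.fun_finsetProd (u := Finset.univ.erase a) (f := fun c t => M t (σ c) c)
          (f' := fun c => M₁ 0 (σ c) c) fun c _ => h₁' (σ c) c
    convert hd using 1
    simp only [h₀, Finset.sum_add_distrib, Finset.mul_sum, mul_add, Finset.sum_mul]
    rw [add_comm]
    congr 1
    · rw [Finset.sum_comm]
      refine Finset.sum_congr rfl fun a _ => ?_
      rw [Finset.sum_comm]
      refine Finset.sum_congr rfl fun b hb => ?_
      exact (sum_perm_diagonal_two d (M₁ 0) (Finset.ne_of_mem_erase hb).symm).symm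
    · rw [Finset.sum_comm]
      exact Finset.sum_congr rfl fun a _ => (sum_perm_diagonal_one d M₂ a).symm

theorem prod_update_one {ι : Type*} [DecidableEq ι] {S : Finset ι} (d : ι → ℝ) (i : ι) :
    ∏ c ∈ S, Function.update d i 1 c = ∏ c ∈ S.erase i, d c := by
  by_cases hi : i ∈ S
  · rw [← Finset.mul_prod_erase S _ hi, Function.update_self, one_mul]
    exact Finset.prod_congr rfl fun c hc => Function.update_of_ne (Finset.ne_of_mem_erase hc) _ _
  · rw [Finset.erase_eq_of_notMem hi]
    exact Finset.prod_congr rfl fun c hc =>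
      Function.update_of_ne (fun h => hi (by rwa [h] at hc)) _ _

/-- This reduces σ_{n-1} to determinants, whose derivatives come directly from the permutation
expansion. -/
theorem trace_adjugate_eq_sum (A : Matrix ι ι ℝ) :
    A.adjugate.trace = ∑ i, (A.updateRow i (Pi.single i 1)).det := by
  simp [Matrix.trace, Matrix.adjugate_apply]

theorem sum_ite_mul (S : Finset ι) (f : ι → ℝ) (x : ℝ) (P : ι → Prop) [DecidablePred P]
    (hP : ∀ i, P i ↔ i ∉ S) :
    ∑ i, f i * (if P i then 0 else x) = (∑ i ∈ S, f i) * x := by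
  rw [Finset.sum_mul, ← Finset.sum_filter_add_sum_filter_not Finset.univ (fun i => i ∈ S)]
  have h1 : ∑ i with i ∈ S, f i * (if P i then 0 else x) = ∑ i ∈ S, f i * x := by
    rw [Finset.filter_mem_eq_inter, Finset.univ_inter]
    exact Finset.sum_congr rfl fun i hi => by rw [if_neg (fun h => (hP i).1 h hi)]
  have h2 : ∑ i with i ∉ S, f i * (if P i then 0 else x) = 0 :=
    Finset.sum_eq_zero fun i hi => by
      rw [if_pos ((hP i).2 (Finset.mem_filter.1 hi).2), mul_zero]
  rw [h1, h2, add_zero]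

/-- The first two derivatives of `σ_{n-1}` along a path of matrices that is diagonal at
time `0`. -/
theorem trace_adjugate_path {M M₁ : ℝ → Matrix ι ι ℝ} {M₂ : Matrix ι ι ℝ} {d : ι → ℝ}
    (h₁ : ∀ᶠ t in 𝓝 0, ∀ a b, HasDerivAt (fun t => M t a b) (M₁ t a b) t)
    (h₂ : ∀ a b, HasDerivAt (fun t => M₁ t a b) (M₂ a b) 0) (h₀ : M 0 = Matrix.diagonal d) :
    ∃ f₁ : ℝ → ℝ, (∀ᶠ t in 𝓝 0, HasDerivAt (fun t => (M t).adjugate.trace) (f₁ t) t) ∧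
      f₁ 0 = ∑ a, sig₁ d a * M₁ 0 a a ∧
      HasDerivAt f₁ (∑ a, sig₁ d a * M₂ a a + ∑ a, ∑ b ∈ Finset.univ.erase a, sig₂ d a b
          * (M₁ 0 a a * M₁ 0 b b - M₁ 0 a b * M₁ 0 b a)) 0 := by
  -- Row `i` is frozen to a unit vector: its derivatives vanish and its diagonal entry at time 0 is
  -- 1, so the remaining products omit the index `i`.
  have key := fun i => det_path (M := fun t => (M t).updateRow i (Pi.single i 1))
    (M₁ := fun t => (M₁ t).updateRow i 0) (M₂ := M₂.updateRow i 0) (d := Function.update d i 1)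
    (by
      filter_upwards [h₁] with t ht a b
      by_cases ha : a = i
      · subst ha
        simpa using hasDerivAt_const t _
      · simpa [Matrix.updateRow_ne ha] using ht a b)
    (by
      intro a b
      by_cases ha : a = i
      · subst ha
        simpa using hasDerivAt_const (0 : ℝ) _
      · simpa [Matrix.updateRow_ne ha] using h₂ a b)
    (by
      ext a b
      by_cases ha : a = i
      · subst ha
        by_cases hb : b = a
        · subst hb; simp
        · simp [hb, Ne.symm hb]
      · rw [Matrix.updateRow_ne ha, h₀]
        by_cases hb : b = a
        · subst hb; simp [ha]
        · simp [Ne.symm hb])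
  choose f hf hf0 hf' using key
  refine ⟨fun t => ∑ i, f i t, ?_, ?_, ?_⟩
  · filter_upwards [eventually_all.2 hf] with t ht
    simp only [trace_adjugate_eq_sum]
    exact HasDerivAt.fun_sum fun i _ => ht i
  · simp only [hf0, prod_update_one, Matrix.updateRow_apply]
    rw [Finset.sum_comm]
    refine Finset.sum_congr rfl fun a _ => ?_
    exact sum_ite_mul (Finset.univ.erase a) _ _ (fun i => a = i) (fun i => by simp [eq_comm])
  · refine (HasDerivAt.fun_sum fun i _ => hf' i).congr_deriv ?_
    simp only [prod_update_one, Matrix.updateRow_apply, Finset.sum_add_distrib]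
    congr 1
    · rw [Finset.sum_comm]
      refine Finset.sum_congr rfl fun a _ => ?_
      exact sum_ite_mul (Finset.univ.erase a) _ _ (fun i => a = i) (fun i => by simp [eq_comm])
    · rw [Finset.sum_comm]
      refine Finset.sum_congr rfl fun a _ => ?_
      rw [Finset.sum_comm]
      refine Finset.sum_congr rfl fun b _ => ?_
      rw [sig₂, esymmPred, ← sum_ite_mul ((Finset.univ.erase a).erase b) _ _
        (fun i => a = i ∨ b = i) (fun i => by
          simp only [Finset.mem_erase, Finset.mem_univ, and_true, ne_eq]
          rw [eq_comm, eq_comm (a := b)]; tauto)]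
      refine Finset.sum_congr rfl fun i _ => ?_
      congr 1
      by_cases ha : a = i <;> by_cases hb : b = i <;> simp [ha, hb]

end MatrixPath

/-- `σ_{n-1}` of the eigenvalues of a symmetric matrix is the trace of its adjugate. -/
theorem sigma_pred_eq_sig {n : ℕ} (hn : 0 < n) (l : Fin n → ℝ) : sigma (n - 1) l = sig l := by
  rw [sigma, sig, esymmPred]
  symm
  refine Finset.sum_bij (fun i _ => Finset.univ.erase i) ?_ ?_ ?_ ?_
  · intro i _
    rw [Finset.mem_powersetCard]
    exact ⟨Finset.subset_univ _, by rw [Finset.card_erase_of_mem (Finset.mem_univ i)]; simp⟩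
  · intro i _ j _ hij
    by_contra hne
    have : i ∈ Finset.univ.erase j := by simp [hne]
    rw [← hij] at this
    simp at this
  · intro S hS
    rw [Finset.mem_powersetCard] at hS
    have h1 : Sᶜ.card = 1 := by rw [Finset.card_compl, hS.2]; simp; omega
    obtain ⟨i, hi⟩ := Finset.card_eq_one.1 h1
    refine ⟨i, Finset.mem_univ i, ?_⟩
    rw [← compl_compl S, hi]
    ext c; simp
  · intro i _; rfl

theorem sig_eq_trace_adjugate_diagonal {ι : Type*} [DecidableEq ι] [Fintype ι] (l : ι → ℝ) :
    sig l = (Matrix.diagonal l).adjugate.trace := by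
  rw [trace_adjugate_eq_sum, sig, esymmPred]
  refine Finset.sum_congr rfl fun i _ => ?_
  have : (Matrix.diagonal l).updateRow i (Pi.single i 1)
      = Matrix.diagonal (Function.update l i 1) := by
    ext a b
    by_cases ha : a = i
    · subst ha
      by_cases hb : b = a
      · subst hb; simp
      · simp [hb, Ne.symm hb]
    · rw [Matrix.updateRow_ne ha]
      by_cases hb : b = a
      · subst hb; simp [ha]
      · simp [Ne.symm hb]
  rw [this, Matrix.det_diagonal, prod_update_one]

theorem trace_adjugate_conj {ι : Type*} [DecidableEq ι] [Fintype ι] {U V : Matrix ι ι ℝ}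
    (hUV : U * V = 1) (A : Matrix ι ι ℝ) :
    (V * A * U).adjugate.trace = A.adjugate.trace := by
  rw [Matrix.adjugate_mul_distrib, Matrix.adjugate_mul_distrib, ← mul_assoc, Matrix.trace_mul_comm,
    ← mul_assoc, ← Matrix.adjugate_mul_distrib]
  rw [hUV, Matrix.adjugate_one, one_mul]

/-- This makes the equation polynomial in the entries of the Hessian, so it can be differentiated
without any regularity of the eigenvalues. -/
theorem sigma_eigenvaluesOf {n : ℕ} (hn : 0 < n) {A : Matrix (Fin n) (Fin n) ℝ}
    (hA : A.IsHermitian) : sigma (n - 1) (eigenvaluesOf A) = A.adjugate.trace := by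
  have h1 : eigenvaluesOf A = hA.eigenvalues := dif_pos hA
  rw [h1, sigma_pred_eq_sig hn, sig_eq_trace_adjugate_diagonal]
  have hspec := hA.spectral_theorem
  rw [Unitary.conjStarAlgAut_apply] at hspec
  conv_rhs => rw [hspec]
  rw [trace_adjugate_conj (by simp)]
  rfl

/-! ### Algebra at the maximum point -/

section Pointwise

variable {ι : Type*} [DecidableEq ι] [Fintype ι] {l : ι → ℝ} {i₀ j k : ι}

/-- The estimate that the first- and second-order conditions at a maximum point of the test
function give for the largest eigenvalue `l i₀`. -/
theorem IsAdmissible.top_le (h : IsAdmissible l i₀ j) (hk : k ≠ i₀) (hkj : k ≠ j)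
    {β A N m M₁ w c f₁₁ Q : ℝ} {g a e f C : ι → ℝ} {T : ι → ι → ℝ} {τ : ι → ι → ℝ}
    (hT : ∀ p q, T p q = T q p) (hw : 0 < w) (hm : 0 < m) (hN : 0 ≤ N)
    (hA : 16 * (2 + 720 * Fintype.card ι) * N ^ 2 / m ^ 2 ≤ A / 4)
    (hA' : 4 * N + 1 ≤ A / 8 * m)
    (hβ : 288 * Fintype.card ι ≤ β) (hβ' : 4 * A * M₁ ^ 2 ≤ β)
    (first : ∀ i, -β * g i / w + T i i₀ / l i₀ + A * (g i * l i) = 0)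
    (second : ∀ i, -β * l i / w - β * g i ^ 2 / w ^ 2
      + (C i + 4 / 3 * ∑ p ∈ Finset.univ.erase i₀, T p i ^ 2 / l i₀) / l i₀
      - T i i₀ ^ 2 / l i₀ ^ 2 + A * (l i ^ 2 + ∑ p, g p * τ p i) ≤ 0)
    (hτ : ∀ p, ∑ i, sig₁ l i * τ p i = f p) (hf : ∀ p, f p = a p + c * g p + e p * l p)
    (hTf : ∑ i, sig₁ l i * T i i = f i₀)
    (hC : ∑ i, sig₁ l i * C i = f₁₁ + negHess l (fun i => T i i)
      + ∑ a, ∑ b ∈ Finset.univ.erase a, sig₂ l a b * T a b ^ 2)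
    (hf₁₁ : c * l i₀ + ∑ p, e p * T p i₀ - N * Q ^ 2 ≤ f₁₁) (hfQ : |f i₀| ≤ N * Q)
    (hQ0 : 0 ≤ Q) (hQ : Q ≤ 2 * l i₀) (hag : |∑ p, a p * g p| ≤ N * M₁)
    (heg : |∑ p, e p * g p| ≤ N * M₁) (hc : |c| ≤ N) (hg : ∑ p, g p ^ 2 ≤ M₁ ^ 2)
    (hml : m ≤ sig l) (hlN : sig l ≤ N) :
    l i₀ ≤ β * N * (Fintype.card ι - 1 + M₁) / w + N + A * N * (M₁ + M₁ ^ 2) := by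
  have h0 := h.top_pos
  have hn1 : (1 : ℝ) ≤ Fintype.card ι := by exact_mod_cast Fintype.card_pos_iff.2 ⟨i₀⟩
  have hthird := h.third_order hk hkj T hT
  have hWlow := h.sig_mul_top_le hk hkj
  have heul := h.sum_sig₁_mul_self
  set n : ℝ := (Fintype.card ι : ℝ) with hnn
  have hA0 : 0 ≤ A := by
    have : 0 ≤ 16 * (2 + 720 * n) * N ^ 2 / m ^ 2 := by positivity
    linarith
  have hβ0 : 0 < β := by linarith
  set L := l i₀ with hL
  set W := ∑ i, sig₁ l i * l i ^ 2 with hW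
  have hW0 : 0 ≤ W := Finset.sum_nonneg fun c _ => mul_nonneg (h.sig₁_pos c).le (sq_nonneg _)
  set X := ∑ i, sig₁ l i * T i i₀ ^ 2 with hX
  have hX0 : 0 ≤ X := Finset.sum_nonneg fun c _ => mul_nonneg (h.sig₁_pos c).le (sq_nonneg _)
  set Y := ∑ i, sig₁ l i * ∑ p ∈ Finset.univ.erase i₀, T p i ^ 2 with hY
  set G := ∑ i, sig₁ l i * g i ^ 2 with hG
  set B := negHess l (fun i => T i i)
    + ∑ a, ∑ b ∈ Finset.univ.erase a, sig₂ l a b * T a b ^ 2 with hB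
  -- The second-order conditions are summed with the positive weights `sig₁ l i`. The good term `A *
  -- W` will be spent as `A/2` on the gradient term, `A/4` on the third-order error and `A/4` on
  -- terms linear in `L`.
  have hsum : -β / w * ((n - 1) * sig l) - β / w ^ 2 * G + (f₁₁ + B) / L + 4 / 3 * Y / L ^ 2
      - X / L ^ 2 + A * W + A * ∑ p, g p * f p ≤ 0 := by
    have e0 : ∑ p, g p * f p = ∑ i, sig₁ l i * ∑ p, g p * τ p i := by
      simp only [← hτ, Finset.mul_sum]
      rw [Finset.sum_comm]
      exact Finset.sum_congr rfl fun i _ => Finset.sum_congr rfl fun p _ => by ring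
    have e1 : (f₁₁ + B) = ∑ i, sig₁ l i * C i := by rw [hC, hB]; ring
    rw [e0, e1, ← heul, hG, hY, hX, hW]
    have e2 : -β / w * ∑ i, sig₁ l i * l i - β / w ^ 2 * ∑ i, sig₁ l i * g i ^ 2
        + (∑ i, sig₁ l i * C i) / L
        + 4 / 3 * (∑ i, sig₁ l i * ∑ p ∈ Finset.univ.erase i₀, T p i ^ 2) / L ^ 2
        - (∑ i, sig₁ l i * T i i₀ ^ 2) / L ^ 2 + A * ∑ i, sig₁ l i * l i ^ 2
        + A * ∑ i, sig₁ l i * ∑ p, g p * τ p i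
        = ∑ i, sig₁ l i * (-β * l i / w - β * g i ^ 2 / w ^ 2
          + (C i + 4 / 3 * ∑ p ∈ Finset.univ.erase i₀, T p i ^ 2 / L) / L
          - T i i₀ ^ 2 / L ^ 2 + A * (l i ^ 2 + ∑ p, g p * τ p i)) := by
      rw [Finset.mul_sum, Finset.mul_sum, Finset.sum_div, Finset.mul_sum, Finset.sum_div,
        Finset.sum_div, Finset.mul_sum, Finset.mul_sum, ← Finset.sum_sub_distrib,
        ← Finset.sum_add_distrib, ← Finset.sum_add_distrib, ← Finset.sum_sub_distrib,
        ← Finset.sum_add_distrib, ← Finset.sum_add_distrib]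
      refine Finset.sum_congr rfl fun i _ => ?_
      rw [← Finset.sum_div]
      field_simp
      ring
    rw [e2]
    exact Finset.sum_nonpos fun i _ => mul_nonpos_of_nonneg_of_nonpos (h.sig₁_pos i).le (second i)
  -- the gradient term of the logarithm
  have hgrad : β / w ^ 2 * G ≤ 2 / β * (X / L ^ 2) + A / 2 * W := by
    rw [hG, hX, hW, Finset.mul_sum, Finset.sum_div, Finset.mul_sum, Finset.mul_sum,
      ← Finset.sum_add_distrib]
    refine Finset.sum_le_sum fun i _ => ?_
    -- The first-order condition expresses `β * g i / w` through `T i i₀ / L`, which gains a factor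
    -- `1/β`.
    have e1 : β / w ^ 2 * (sig₁ l i * g i ^ 2)
        = sig₁ l i * ((T i i₀ / L + A * (g i * l i)) ^ 2 / β) := by
      have : T i i₀ / L + A * (g i * l i) = β * g i / w := by
        have := first i
        rw [neg_mul, neg_div] at this
        linarith
      rw [this]; field_simp
    have e2 : 2 / β * (sig₁ l i * T i i₀ ^ 2 / L ^ 2) + A / 2 * (sig₁ l i * l i ^ 2)
        = sig₁ l i * (2 * (T i i₀ / L) ^ 2 / β + A / 2 * l i ^ 2) := by
      field_simp
    rw [e1, e2]
    refine mul_le_mul_of_nonneg_left ?_ (h.sig₁_pos i).le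
    have e3 : 2 * (T i i₀ / L) ^ 2 / β + A / 2 * l i ^ 2
        = (2 * (T i i₀ / L) ^ 2 + β * (A / 2 * l i ^ 2)) / β := by field_simp
    rw [e3]
    refine div_le_div_of_nonneg_right ?_ hβ0.le
    have hgi : g i ^ 2 ≤ M₁ ^ 2 :=
      (Finset.single_le_sum (f := fun i => g i ^ 2) (fun _ _ => sq_nonneg _)
        (Finset.mem_univ i)).trans hg
    have h4 : 2 * (A * (g i * l i)) ^ 2 ≤ β * (A / 2 * l i ^ 2) := by
      have h5 : 2 * (A * (g i * l i)) ^ 2 ≤ 2 * (A ^ 2 * l i ^ 2) * M₁ ^ 2 := by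
        have := mul_le_mul_of_nonneg_left hgi (by positivity : 0 ≤ 2 * (A ^ 2 * l i ^ 2))
        linarith
      have h6 := mul_le_mul_of_nonneg_right hβ' (by positivity : 0 ≤ A / 2 * l i ^ 2)
      linarith
    have h7 := sq_nonneg (T i i₀ / L - A * (g i * l i))
    linarith
  -- The non-tangential part of `T i i` is the derivative of the right-hand side, hence of size at
  -- most `2 * N * L`; this keeps the error in `third_order` below `A/4 * W`.
  have hfsq : f i₀ ^ 2 / sig l ^ 2 / L ^ 2 ≤ 4 * N ^ 2 / m ^ 2 := by
    have h1 : f i₀ ^ 2 ≤ 4 * N ^ 2 * L ^ 2 := by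
      have h2 : |f i₀| ≤ N * (2 * L) := hfQ.trans (mul_le_mul_of_nonneg_left hQ hN)
      have h3 := pow_le_pow_left₀ (abs_nonneg _) h2 2
      rw [sq_abs] at h3
      linarith
    have h2 : m ^ 2 ≤ sig l ^ 2 := pow_le_pow_left₀ hm.le hml 2
    rw [div_div, div_le_div_iff₀ (by have := h.sig_pos; positivity) (by positivity)]
    calc f i₀ ^ 2 * m ^ 2 ≤ (4 * N ^ 2 * L ^ 2) * sig l ^ 2 :=
          mul_le_mul h1 h2 (by positivity) (by positivity)
      _ = _ := by ring
  -- the third-order terms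
  have hth : 1 / (144 * n) * (X / L ^ 2) ≤ B / L + 4 / 3 * Y / L ^ 2 - X / L ^ 2 + A / 4 * W := by
    rw [hTf] at hthird
    have h1 := div_le_div_of_nonneg_right hthird (sq_nonneg L)
    have e1 : (L * B + 4 / 3 * Y - X + (2 + 720 * n) * (f i₀ ^ 2 / sig l ^ 2) * W) / L ^ 2
        = B / L + 4 / 3 * Y / L ^ 2 - X / L ^ 2
          + (2 + 720 * n) * (f i₀ ^ 2 / sig l ^ 2 / L ^ 2) * W := by
      field_simp
    have h2 : (2 + 720 * n) * (f i₀ ^ 2 / sig l ^ 2 / L ^ 2) * W ≤ A / 4 * W := by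
      refine mul_le_mul_of_nonneg_right ?_ hW0
      have h3 := mul_le_mul_of_nonneg_left hfsq (by positivity : 0 ≤ 2 + 720 * n)
      have e2 : 16 * (2 + 720 * n) * N ^ 2 / m ^ 2 = 4 * ((2 + 720 * n) * (4 * N ^ 2 / m ^ 2)) := by
        ring
      have : 0 ≤ (2 + 720 * n) * (4 * N ^ 2 / m ^ 2) := by positivity
      linarith
    rw [e1] at h1
    have e3 : 1 / (144 * n) * X / L ^ 2 = 1 / (144 * n) * (X / L ^ 2) := by ring
    linarith
  -- The gain in the concavity inequality pays for the third derivatives left by the gradient term;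
  -- this is the reason for `288 * n ≤ β`.
  have hβδ : 2 / β * (X / L ^ 2) ≤ 1 / (144 * n) * (X / L ^ 2) := by
    refine mul_le_mul_of_nonneg_right ?_ (by positivity)
    rw [div_le_div_iff₀ hβ0 (by positivity)]
    linarith
  -- the terms of the right-hand side
  have hrhs : -(β * N * M₁ / w) - N - 4 * N * L - A * N * (M₁ + M₁ ^ 2)
      ≤ f₁₁ / L + A * ∑ p, g p * f p := by
    have h1 := div_le_div_of_nonneg_right hf₁₁ h0.le
    -- The first-order condition removes the third derivatives. The resulting `A * ∑ e p * (g p * l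
    -- p)` cancels against the same term in `A * ∑ g p * f p`.
    have e1 : (∑ p, e p * T p i₀) / L
        = β / w * (∑ p, e p * g p) - A * ∑ p, e p * (g p * l p) := by
      rw [Finset.sum_div, Finset.mul_sum, Finset.mul_sum, ← Finset.sum_sub_distrib]
      refine Finset.sum_congr rfl fun p _ => ?_
      have h2 := first p
      rw [mul_div_assoc]
      have h3 : T p i₀ / L = β * g p / w - A * (g p * l p) := by
        rw [neg_mul, neg_div] at h2; linarith
      rw [h3]; ring
    have e2 : ∑ p, g p * f p
        = ∑ p, a p * g p + c * ∑ p, g p ^ 2 + ∑ p, e p * (g p * l p) := by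
      rw [Finset.mul_sum, ← Finset.sum_add_distrib, ← Finset.sum_add_distrib]
      exact Finset.sum_congr rfl fun p _ => by rw [hf]; ring
    have e3 : (c * L + ∑ p, e p * T p i₀ - N * Q ^ 2) / L
        = c + (∑ p, e p * T p i₀) / L - N * Q ^ 2 / L := by
      field_simp
    rw [e3, e1] at h1
    rw [e2]
    have hg0 : 0 ≤ ∑ p, g p ^ 2 := Finset.sum_nonneg fun _ _ => sq_nonneg _
    have h2 : -(N * M₁ ^ 2) ≤ c * ∑ p, g p ^ 2 := by
      have h3 : |c * ∑ p, g p ^ 2| ≤ N * M₁ ^ 2 := by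
        rw [abs_mul, abs_of_nonneg hg0]
        exact mul_le_mul hc hg hg0 hN
      exact (abs_le.1 h3).1
    have h3 : -(β / w * (N * M₁)) ≤ β / w * ∑ p, e p * g p := by
      have := mul_le_mul_of_nonneg_left (abs_le.1 heg).1 (by positivity : 0 ≤ β / w)
      linarith
    have h4 : N * Q ^ 2 / L ≤ 4 * N * L := by
      rw [div_le_iff₀ h0]
      have := mul_le_mul_of_nonneg_left (pow_le_pow_left₀ hQ0 hQ 2) hN
      linarith
    have h5 := mul_le_mul_of_nonneg_left (abs_le.1 hag).1 hA0
    have h6 := mul_le_mul_of_nonneg_left h2 hA0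
    have h7 := (abs_le.1 hc).1
    have e4 : β * N * M₁ / w = β / w * (N * M₁) := by ring
    rw [e4]
    linear_combination h1 + h3 + h4 + h5 + h6 + h7
  have hWm : L + 4 * N * L ≤ A / 4 * W := by
    have h1 : m * L ≤ 2 * W := (mul_le_mul_of_nonneg_right hml h0.le).trans hWlow
    have h2 := mul_le_mul_of_nonneg_left h1 (by positivity : 0 ≤ A / 8)
    have h3 := mul_le_mul_of_nonneg_right hA' h0.le
    linear_combination h2 + h3
  have hlin : β / w * ((n - 1) * sig l) ≤ β / w * ((n - 1) * N) :=
    mul_le_mul_of_nonneg_left (mul_le_mul_of_nonneg_left hlN (by linarith)) (by positivity)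
  have e5 : β * N * (n - 1 + M₁) / w = β / w * ((n - 1) * N) + β * N * M₁ / w := by ring
  have e6 : (f₁₁ + B) / L = f₁₁ / L + B / L := add_div _ _ _
  have e7 : -β / w * ((n - 1) * sig l) = -(β / w * ((n - 1) * sig l)) := by ring
  rw [e6, e7] at hsum
  rw [e5]
  linear_combination hsum + hgrad + hth + hβδ + hrhs + hWm + hlin

end Pointwise
end HessianEq

/-! ### Second-order jets on the line and symmetry of higher derivatives -/

namespace HessianEq
open Filter Topology

/-- `f` is twice differentiable at `0` with first and second derivatives `c₁` and `c₂`. -/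
def IsJet (f : ℝ → ℝ) (c₁ c₂ : ℝ) : Prop :=
  ∃ F : ℝ → ℝ, (∀ᶠ t in 𝓝 0, HasDerivAt f (F t) t) ∧ F 0 = c₁ ∧ HasDerivAt F c₂ 0

namespace IsJet

variable {f g : ℝ → ℝ} {c₁ c₂ d₁ d₂ : ℝ}

theorem hasDerivAt (h : IsJet f c₁ c₂) : HasDerivAt f c₁ 0 := by
  obtain ⟨F, hF, h1, -⟩ := h
  exact h1 ▸ hF.self_of_nhds

theorem unique (hf : IsJet f c₁ c₂) (hg : IsJet g d₁ d₂) (h : f =ᶠ[𝓝 0] g) :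
    c₁ = d₁ ∧ c₂ = d₂ := by
  obtain ⟨F, hF, hF1, hF2⟩ := hf
  obtain ⟨G, hG, hG1, hG2⟩ := hg
  have hFG : F =ᶠ[𝓝 0] G := by
    filter_upwards [hF, hG, h.eventually_nhds] with t h1 h2 h3
    exact (h1.congr_of_eventuallyEq (EventuallyEq.symm h3)).unique h2
  exact ⟨hF1 ▸ hG1 ▸ hFG.eq_of_nhds, hF2.unique (hG2.congr_of_eventuallyEq hFG)⟩

theorem const (c : ℝ) : IsJet (fun _ => c) 0 0 :=
  ⟨fun _ => 0, Eventually.of_forall fun t => hasDerivAt_const t c, rfl, hasDerivAt_const _ _⟩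

theorem id : IsJet (fun t => t) 1 0 :=
  ⟨fun _ => 1, Eventually.of_forall fun t => hasDerivAt_id t, rfl, hasDerivAt_const _ _⟩

theorem add (hf : IsJet f c₁ c₂) (hg : IsJet g d₁ d₂) :
    IsJet (fun t => f t + g t) (c₁ + d₁) (c₂ + d₂) := by
  obtain ⟨F, hF, hF1, hF2⟩ := hf
  obtain ⟨G, hG, hG1, hG2⟩ := hg
  refine ⟨fun t => F t + G t, ?_, by simp only [hF1, hG1], hF2.add hG2⟩
  filter_upwards [hF, hG] with t h1 h2 using h1.add h2

theorem sum {ι : Type*} {s : Finset ι} {f : ι → ℝ → ℝ} {c₁ c₂ : ι → ℝ}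
    (h : ∀ i ∈ s, IsJet (f i) (c₁ i) (c₂ i)) :
    IsJet (fun t => ∑ i ∈ s, f i t) (∑ i ∈ s, c₁ i) (∑ i ∈ s, c₂ i) := by
  classical
  induction s using Finset.induction_on with
  | empty => simpa using const 0
  | insert a s ha ih =>
    simp only [Finset.sum_insert ha]
    exact (h a (Finset.mem_insert_self a s)).add
      (ih fun i hi => h i (Finset.mem_insert_of_mem hi))

theorem mul (hf : IsJet f c₁ c₂) (hg : IsJet g d₁ d₂) :
    IsJet (fun t => f t * g t) (c₁ * g 0 + f 0 * d₁) (c₂ * g 0 + 2 * (c₁ * d₁) + f 0 * d₂) := by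
  have hf' := hf.hasDerivAt
  have hg' := hg.hasDerivAt
  obtain ⟨F, hF, hF1, hF2⟩ := hf
  obtain ⟨G, hG, hG1, hG2⟩ := hg
  refine ⟨fun t => F t * g t + f t * G t, ?_, by simp only [hF1, hG1], ?_⟩
  · filter_upwards [hF, hG] with t h1 h2 using h1.mul h2
  · refine ((hF2.mul hg').add (hf'.mul hG2)).congr_deriv ?_
    rw [hF1, hG1]; ring

theorem const_mul (c : ℝ) (hf : IsJet f c₁ c₂) : IsJet (fun t => c * f t) (c * c₁) (c * c₂) := by
  simpa using (const c).mul hf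

theorem log (hf : IsJet f c₁ c₂) (h0 : 0 < f 0) :
    IsJet (fun t => Real.log (f t)) (c₁ / f 0) (c₂ / f 0 - c₁ ^ 2 / f 0 ^ 2) := by
  have hf' := hf.hasDerivAt
  obtain ⟨F, hF, hF1, hF2⟩ := hf
  refine ⟨fun t => F t / f t, ?_, by simp only [hF1], ?_⟩
  · have hpos : ∀ᶠ t in 𝓝 0, 0 < f t := hf'.continuousAt.eventually (lt_mem_nhds h0)
    filter_upwards [hF, hpos] with t h1 h2 using h1.log h2.ne'
  · refine (hF2.div hf' h0.ne').congr_deriv ?_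
    rw [hF1]; field_simp

/-- The first- and second-order conditions at a local maximum. -/
theorem of_isLocalMax (hf : IsJet f c₁ c₂) (hmax : IsLocalMax f 0) : c₁ = 0 ∧ c₂ ≤ 0 := by
  have hf' := hf.hasDerivAt
  have h1 : c₁ = 0 := hmax.hasDerivAt_eq_zero hf'
  refine ⟨h1, ?_⟩
  obtain ⟨F, hF, hF1, hF2⟩ := hf
  by_contra hcon
  push Not at hcon
  have hderiv : deriv f =ᶠ[𝓝 0] F := hF.mono fun t ht => ht.deriv
  have hdd : deriv (deriv f) 0 = c₂ := (hF2.congr_of_eventuallyEq hderiv).deriv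
  -- A positive second derivative would make 0 a local minimum too, so `f` would be locally constant
  -- and its second derivative zero.
  have hmin := isLocalMin_of_deriv_deriv_pos (f := f) (x₀ := 0) (hdd ▸ hcon)
    (by rw [hf'.deriv, h1]) hf'.continuousAt
  have hconst : f =ᶠ[𝓝 0] fun _ => f 0 := by
    filter_upwards [hmax, hmin] with t h2 h3 using le_antisymm h2 h3
  have := (unique ⟨F, hF, hF1, hF2⟩ (const (f 0)) hconst).2
  linarith

/-- The second derivative of a composition with a function that has Lipschitz derivative. -/
theorem comp_lipschitz {X : Type*} [NormedAddCommGroup X] [NormedSpace ℝ X] {q q₁ : ℝ → X} {q₂ : X}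
    {ψ : X → ℝ} {P : ℝ → X →L[ℝ] ℝ} {N : ℝ} (hq : ∀ᶠ t in 𝓝 0, HasDerivAt q (q₁ t) t)
    (hq₁ : HasDerivAt q₁ q₂ 0) (hψ : ∀ᶠ t in 𝓝 0, HasFDerivAt ψ (P t) (q t))
    (hP : ∀ᶠ t in 𝓝 0, ‖P t - P 0‖ ≤ N * ‖q t - q 0‖)
    (hf : IsJet (fun t => ψ (q t)) c₁ c₂) :
    c₁ = P 0 (q₁ 0) ∧ |c₂ - P 0 q₂| ≤ N * ‖q₁ 0‖ ^ 2 := by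
  obtain ⟨F, hF, hF1, hF2⟩ := hf
  have hFP : ∀ᶠ t in 𝓝 0, F t = P t (q₁ t) := by
    filter_upwards [hF, hq, hψ] with t h1 h2 h3
    exact h1.unique (h3.comp_hasDerivAt t h2)
  have hF0 := hFP.self_of_nhds
  refine ⟨hF1 ▸ hF0, ?_⟩
  have hq0 := hq.self_of_nhds
  rw [hasDerivAt_iff_tendsto_slope_zero] at hF2 hq0
  have hq1' := hq₁
  rw [hasDerivAt_iff_tendsto_slope_zero] at hq1'
  simp only [zero_add] at hF2 hq0 hq1'
  have hlim1 : Tendsto (fun t : ℝ => |t⁻¹ • (F t - F 0) - P 0 (t⁻¹ • (q₁ t - q₁ 0))|) (𝓝[≠] 0)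
      (𝓝 |c₂ - P 0 q₂|) :=
    (hF2.sub (((P 0).continuous.tendsto q₂).comp hq1')).abs
  have hlim2 : Tendsto (fun t : ℝ => N * (‖t⁻¹ • (q t - q 0)‖ * ‖q₁ t‖)) (𝓝[≠] 0)
      (𝓝 (N * (‖q₁ 0‖ * ‖q₁ 0‖))) :=
    (hq0.norm.mul ((hq₁.continuousAt.tendsto.mono_left nhdsWithin_le_nhds).norm)).const_mul N
  rw [sq]
  refine le_of_tendsto_of_tendsto hlim1 hlim2 ?_
  filter_upwards [nhdsWithin_le_nhds hFP, nhdsWithin_le_nhds hP] with t h1 h2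
  -- The only part of the difference quotient not explained by `P 0` is the variation of `P`, which
  -- the Lipschitz bound controls; `ψ` itself need not be twice differentiable.
  have e : t⁻¹ • (F t - F 0) - P 0 (t⁻¹ • (q₁ t - q₁ 0)) = t⁻¹ * ((P t - P 0) (q₁ t)) := by
    rw [h1, hF0]
    simp only [map_smul, map_sub, smul_eq_mul, sub_apply]
    ring
  rw [e, abs_mul, norm_smul, Real.norm_eq_abs]
  have h3 : |(P t - P 0) (q₁ t)| ≤ N * ‖q t - q 0‖ * ‖q₁ t‖ :=
    ((P t - P 0).le_opNorm (q₁ t)).trans (mul_le_mul_of_nonneg_right h2 (norm_nonneg _))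
  calc _ ≤ |t⁻¹| * (N * ‖q t - q 0‖ * ‖q₁ t‖) := mul_le_mul_of_nonneg_left h3 (abs_nonneg _)
    _ = _ := by ring

end IsJet

section Line

variable {X V : Type*} [NormedAddCommGroup X] [NormedSpace ℝ X] [NormedAddCommGroup V]
  [NormedSpace ℝ V]

theorem hasDerivAt_line (x b : X) (t : ℝ) : HasDerivAt (fun t : ℝ => x + t • b) b t := by
  simpa using ((hasDerivAt_id t).smul_const b).const_add x

theorem tendsto_line (x b : X) : Tendsto (fun t : ℝ => x + t • b) (𝓝 0) (𝓝 x) := by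
  have := (hasDerivAt_line x b 0).continuousAt.tendsto
  simpa using this

theorem ContDiffAt.eventually_hasFDerivAt {G : X → V} {x : X} (hG : ContDiffAt ℝ 1 G x) :
    ∀ᶠ y in 𝓝 x, HasFDerivAt G (fderiv ℝ G y) y := by
  filter_upwards [hG.eventually (by simp)] with y hy
  exact (hy.differentiableAt (by simp)).hasFDerivAt

theorem ContDiffAt.hasDerivAt_line_eventually {G : X → V} {x : X} (hG : ContDiffAt ℝ 1 G x)
    (b : X) : ∀ᶠ t : ℝ in 𝓝 0,
      HasDerivAt (fun t : ℝ => G (x + t • b)) (fderiv ℝ G (x + t • b) b) t := by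
  filter_upwards [(tendsto_line x b).eventually (ContDiffAt.eventually_hasFDerivAt hG)] with t ht
  exact ht.comp_hasDerivAt t (hasDerivAt_line x b t)

theorem ContDiffAt.hasDerivAt_fderiv_line {G : X → V} {x : X} (hG : ContDiffAt ℝ 2 G x) (b : X) :
    HasDerivAt (fun t : ℝ => fderiv ℝ G (x + t • b) b) (fderiv ℝ (fderiv ℝ G) x b b) 0 := by
  have h1 : ContDiffAt ℝ 1 (fderiv ℝ G) x := hG.fderiv_right (by norm_num)
  have h2 := (ContDiffAt.hasDerivAt_line_eventually h1 b).self_of_nhds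
  have h3 := (ContinuousLinearMap.apply ℝ V b).hasFDerivAt.comp_hasDerivAt (0 : ℝ) h2
  simpa [Function.comp_def] using h3

/-- The first two derivatives of a function along a line. -/
theorem ContDiffAt.isJet_line {G : X → V} {x : X} (hG : ContDiffAt ℝ 2 G x) (ℓ : V →L[ℝ] ℝ)
    (b : X) : IsJet (fun t => ℓ (G (x + t • b))) (ℓ (fderiv ℝ G x b))
      (ℓ (fderiv ℝ (fderiv ℝ G) x b b)) := by
  refine ⟨fun t => ℓ (fderiv ℝ G (x + t • b) b), ?_, by simp, ?_⟩
  · filter_upwards [ContDiffAt.hasDerivAt_line_eventually (hG.of_le (by norm_num)) b] with t ht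
    exact ℓ.hasFDerivAt.comp_hasDerivAt t ht
  · exact ℓ.hasFDerivAt.comp_hasDerivAt (0 : ℝ) (ContDiffAt.hasDerivAt_fderiv_line hG b)

/-- Evaluation of a bilinear form as a linear functional. -/
noncomputable def evalBilin (v w : X) : (X →L[ℝ] X →L[ℝ] ℝ) →L[ℝ] ℝ :=
  (ContinuousLinearMap.apply ℝ ℝ w).comp (ContinuousLinearMap.apply ℝ (X →L[ℝ] ℝ) v)

@[simp]
theorem evalBilin_apply (v w : X) (B : X →L[ℝ] X →L[ℝ] ℝ) : evalBilin v w B = B v w := rfl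

variable {u : X → ℝ} {x : X}

theorem fderiv_fderiv_comm (hu : ContDiffAt ℝ 2 u x) (v w : X) :
    fderiv ℝ (fderiv ℝ u) x v w = fderiv ℝ (fderiv ℝ u) x w v :=
  (hu.isSymmSndFDerivAt (by simp)) v w

theorem fderiv₃_comm_left (hu : ContDiffAt ℝ 3 u x) (a b c : X) :
    fderiv ℝ (fderiv ℝ (fderiv ℝ u)) x a b c = fderiv ℝ (fderiv ℝ (fderiv ℝ u)) x b a c := by
  have h : ContDiffAt ℝ 2 (fderiv ℝ u) x := hu.fderiv_right (by norm_num)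
  rw [(h.isSymmSndFDerivAt (by simp)) a b]

theorem fderiv_evalBilin_congr {B : X → X →L[ℝ] X →L[ℝ] ℝ} (hB : DifferentiableAt ℝ B x)
    {v w v' w' : X} (h : ∀ᶠ y in 𝓝 x, B y v w = B y v' w') (a : X) :
    fderiv ℝ B x a v w = fderiv ℝ B x a v' w' := by
  have h1 := ((evalBilin v w).hasFDerivAt (x := B x)).comp x hB.hasFDerivAt
  have h2 := ((evalBilin v' w').hasFDerivAt (x := B x)).comp x hB.hasFDerivAt
  have h3 := (h2.congr_of_eventuallyEq (f₁ := fun y => evalBilin v w (B y)) h).unique h1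
  simpa using (congrArg (fun L => L a) h3).symm

theorem fderiv₃_comm_right (hu : ContDiffAt ℝ 3 u x) (a b c : X) :
    fderiv ℝ (fderiv ℝ (fderiv ℝ u)) x a b c = fderiv ℝ (fderiv ℝ (fderiv ℝ u)) x a c b := by
  have h1 : ContDiffAt ℝ 2 (fderiv ℝ u) x := hu.fderiv_right (by norm_num)
  have h2 : ContDiffAt ℝ 1 (fderiv ℝ (fderiv ℝ u)) x := h1.fderiv_right (by norm_num)
  refine fderiv_evalBilin_congr (h2.differentiableAt (by simp)) ?_ a
  filter_upwards [hu.eventually (by simp)] with y hy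
  exact fderiv_fderiv_comm (hy.of_le (by norm_num)) b c

/-- The fourth derivative does not depend on the order of the two pairs of arguments. -/
theorem fderiv₄_pair_comm (hu : ContDiffAt ℝ 4 u x) (a b : X) :
    fderiv ℝ (fderiv ℝ (fderiv ℝ (fderiv ℝ u))) x a a b b
      = fderiv ℝ (fderiv ℝ (fderiv ℝ (fderiv ℝ u))) x b b a a := by
  have hC1 : ContDiffAt ℝ 3 (fderiv ℝ u) x := hu.fderiv_right (by norm_num)
  have hC2 : ContDiffAt ℝ 2 (fderiv ℝ (fderiv ℝ u)) x := hC1.fderiv_right (by norm_num)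
  have hC3 : ContDiffAt ℝ 1 (fderiv ℝ (fderiv ℝ (fderiv ℝ u))) x := hC2.fderiv_right (by norm_num)
  have hd := (hC3.differentiableAt (by simp)).hasFDerivAt
  have h12 : ∀ p q r s, fderiv ℝ (fderiv ℝ (fderiv ℝ (fderiv ℝ u))) x p q r s
      = fderiv ℝ (fderiv ℝ (fderiv ℝ (fderiv ℝ u))) x q p r s := fun p q r s => by
    rw [(hC2.isSymmSndFDerivAt (by simp)) p q]
  have key : ∀ {q r s q' r' s' : X}, (∀ᶠ y in 𝓝 x, fderiv ℝ (fderiv ℝ (fderiv ℝ u)) y q r s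
      = fderiv ℝ (fderiv ℝ (fderiv ℝ u)) y q' r' s') → ∀ p,
      fderiv ℝ (fderiv ℝ (fderiv ℝ (fderiv ℝ u))) x p q r s
        = fderiv ℝ (fderiv ℝ (fderiv ℝ (fderiv ℝ u))) x p q' r' s' := by
    intro q r s q' r' s' h p
    have h1 := ((evalBilin r s).comp (ContinuousLinearMap.apply ℝ _ q)).hasFDerivAt.comp x hd
    have h2 := ((evalBilin r' s').comp (ContinuousLinearMap.apply ℝ _ q')).hasFDerivAt.comp x hd
    have h3 := (h2.congr_of_eventuallyEq (f₁ := fun y => evalBilin r s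
      (fderiv ℝ (fderiv ℝ (fderiv ℝ u)) y q)) h).unique h1
    simpa using (congrArg (fun L => L p) h3).symm
  have h3 : ∀ᶠ y in 𝓝 x, ContDiffAt ℝ 3 u y := by
    filter_upwards [hu.eventually (by simp)] with y hy using hy.of_le (by norm_num)
  have h23 : ∀ p q r s, fderiv ℝ (fderiv ℝ (fderiv ℝ (fderiv ℝ u))) x p q r s
      = fderiv ℝ (fderiv ℝ (fderiv ℝ (fderiv ℝ u))) x p r q s := fun p q r s =>
    key (h3.mono fun y hy => fderiv₃_comm_left hy q r s) p
  have h34 : ∀ p q r s, fderiv ℝ (fderiv ℝ (fderiv ℝ (fderiv ℝ u))) x p q r s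
      = fderiv ℝ (fderiv ℝ (fderiv ℝ (fderiv ℝ u))) x p q s r := fun p q r s =>
    key (h3.mono fun y hy => fderiv₃_comm_right hy q r s) p
  -- The chain is aabb, abab, baab, baba, bbaa.
  rw [h23, h12, h34, h23]

end Line
end HessianEq

/-! ### The cone Γ_{n-1} and eigenframes of the Hessian -/

namespace HessianEq
open Filter Topology

section Cone

variable {n : ℕ} {l : Fin n → ℝ}

theorem coeff_prod_X_add_C (l : Fin n → ℝ) {k : ℕ} (hk : k ≤ n) :
    (∏ i, (Polynomial.X + Polynomial.C (l i))).coeff k = sigma (n - k) l := by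
  have h := Multiset.prod_X_add_C_coeff (Finset.univ.val.map l) (k := k) (by simpa using hk)
  rw [Multiset.map_map, Finset.esymm_map_val, Multiset.card_map, Finset.card_val,
    Finset.card_univ, Fintype.card_fin] at h
  exact h

theorem sigma_zero (l : Fin n → ℝ) : sigma 0 l = 1 := by simp [sigma]

/-- As a function of `s` this is the derivative of `∏ (s + l i)`, whose coefficients are positive
multiples of σ_{n-1}, …, σ_0. -/
theorem sig_add_pos (hn : 0 < n) (h : l ∈ gardingCone n (n - 1)) {s : ℝ} (hs : 0 ≤ s) :
    0 < sig fun i => s + l i := by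
  set p : Polynomial ℝ := ∏ i, (Polynomial.X + Polynomial.C (l i)) with hp
  have hdeg : p.derivative.natDegree < n := by
    have h2 : p.natDegree = n := by
      rw [hp, Polynomial.natDegree_prod_of_monic _ _ fun i _ => Polynomial.monic_X_add_C (l i)]
      simp
    have h3 := Polynomial.natDegree_derivative_lt (p := p) (by omega)
    omega
  have e1 : p.derivative.eval s = sig fun i => s + l i := by
    rw [hp, Polynomial.derivative_prod_finset, Polynomial.eval_finsetSum]
    simp [sig, esymmPred, Polynomial.eval_prod]
  rw [← e1, Polynomial.eval_eq_sum_range' hdeg]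
  have hpos : ∀ i, i < n → 0 < sigma (n - (i + 1)) l := by
    intro i hi
    rcases Nat.eq_zero_or_pos (n - (i + 1)) with h0 | h0
    · rw [h0, sigma_zero]; exact one_pos
    · exact h _ h0 (by omega)
  refine Finset.sum_pos' (fun i hi => ?_) ⟨0, Finset.mem_range.2 hn, ?_⟩
  · have hi' := Finset.mem_range.1 hi
    rw [Polynomial.coeff_derivative, coeff_prod_X_add_C l (by omega)]
    have := hpos i hi'
    positivity
  · rw [Polynomial.coeff_derivative, coeff_prod_X_add_C l (by omega)]
    have := hpos 0 hn
    simpa using this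

/-- At most one entry of a point of `Γ_{n-1}` is nonpositive. -/
theorem pos_of_mem_gardingCone (hn : 2 < n) (h : l ∈ gardingCone n (n - 1)) {j : Fin n}
    (hj : ∀ c, l j ≤ l c) {c : Fin n} (hc : c ≠ j) : 0 < l c := by
  obtain ⟨b, hb, hbmin⟩ := Finset.exists_min_image (Finset.univ.erase j) l ⟨c, by simp [hc]⟩
  refine lt_of_lt_of_le ?_ (hbmin c (by simp [hc]))
  by_contra hcon
  push Not at hcon
  -- Shifting by the second smallest entry kills the entry at `b`, so only the product omitting `b`
  -- survives, and it has one factor `≤ 0` and all others `≥ 0`.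
  have hpos := sig_add_pos (by omega) h (s := -l b) (by linarith)
  have hbj : b ≠ j := Finset.ne_of_mem_erase hb
  rw [sig, esymmPred, Finset.sum_eq_single b] at hpos
  · rw [← Finset.mul_prod_erase _ _ (by simp [hbj.symm] : j ∈ Finset.univ.erase b)] at hpos
    have h1 : -l b + l j ≤ 0 := by linarith [hj b]
    have h2 : 0 ≤ ∏ c ∈ (Finset.univ.erase b).erase j, (-l b + l c) :=
      Finset.prod_nonneg fun c hc => by
        have := hbmin c (by simp [Finset.ne_of_mem_erase hc])
        linarith
    have := mul_nonpos_of_nonpos_of_nonneg h1 h2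
    linarith
  · intro i _ hi
    exact Finset.prod_eq_zero (i := b) (by simp [hi.symm]) (by ring)
  · simp

theorem exists_isAdmissible (hn : 2 < n) (h : l ∈ gardingCone n (n - 1)) :
    ∃ i₀ j k, IsAdmissible l i₀ j ∧ k ≠ i₀ ∧ k ≠ j := by
  have : NeZero n := ⟨by omega⟩
  obtain ⟨j, -, hj⟩ := Finset.exists_min_image Finset.univ l ⟨0, Finset.mem_univ _⟩
  have hex : ∃ i : Fin n, i ∈ Finset.univ.erase j := by
    have hc : 0 < (Finset.univ.erase j).card := by
      rw [Finset.card_erase_of_mem (Finset.mem_univ j)]; simp; omega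
    exact Finset.card_pos.1 hc
  obtain ⟨i₀, hi₀, hmax⟩ := Finset.exists_max_image (Finset.univ.erase j) l hex
  have hne : i₀ ≠ j := Finset.ne_of_mem_erase hi₀
  have hex' : ∃ k : Fin n, k ∈ (Finset.univ.erase j).erase i₀ := by
    have hc : 0 < ((Finset.univ.erase j).erase i₀).card := by
      rw [Finset.card_erase_of_mem hi₀, Finset.card_erase_of_mem (Finset.mem_univ j)]; simp; omega
    exact Finset.card_pos.1 hc
  obtain ⟨k, hk⟩ := hex'
  refine ⟨i₀, j, k, ⟨hne, fun c hc => pos_of_mem_gardingCone hn h (fun c => hj c (by simp)) hc,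
    fun c => ?_, fun c => hj c (by simp), ?_⟩, by simp at hk; tauto, by simp at hk; tauto⟩
  · by_cases hc : c = j
    · rw [hc]; exact hj i₀ (by simp)
    · exact hmax c (by simp [hc])
  · rw [← sigma_pred_eq_sig (by omega)]
    exact h (n - 1) (by omega) le_rfl

end Cone

section Frame

variable {n : ℕ} {u : E n → ℝ} {x : E n}

theorem fderiv_fderiv_eq_sum (u : E n → ℝ) (x v w : E n) :
    fderiv ℝ (fderiv ℝ u) x v w = ∑ i, ∑ j, v i * w j * hessian u x i j := by
  have h : ∀ v : E n, v = ∑ i, v i • EuclideanSpace.single i (1 : ℝ) := fun v => by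
    have := (EuclideanSpace.basisFun (Fin n) ℝ).sum_repr v
    simpa using this.symm
  conv_lhs => rw [h v, h w]
  simp only [map_sum, map_smul, sum_apply, smul_apply, smul_eq_mul, hessian, Matrix.of_apply]
  simp only [Finset.mul_sum]
  rw [Finset.sum_comm]
  refine Finset.sum_congr rfl fun i _ => Finset.sum_congr rfl fun j _ => by ring

/-- The Hessian in an orthonormal basis. -/
noncomputable def frameHessian (b : OrthonormalBasis (Fin n) ℝ (E n)) (u : E n → ℝ) (x : E n) :
    Matrix (Fin n) (Fin n) ℝ :=
  Matrix.of fun p q => fderiv ℝ (fderiv ℝ u) x (b p) (b q)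

theorem trace_adjugate_frameHessian (b : OrthonormalBasis (Fin n) ℝ (E n)) (u : E n → ℝ)
    (x : E n) : (frameHessian b u x).adjugate.trace = (hessian u x).adjugate.trace := by
  set U : Matrix (Fin n) (Fin n) ℝ := Matrix.of fun i q => b q i with hU
  have h1 : U.transpose * U = 1 := by
    ext p q
    have := orthonormal_iff_ite.1 b.orthonormal p q
    rw [PiLp.inner_apply] at this
    simp only [Matrix.mul_apply, Matrix.transpose_apply, hU, Matrix.of_apply, Matrix.one_apply]
    rw [← this]
    refine Finset.sum_congr rfl fun i _ => ?_
    simp [mul_comm]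
  have h2 : frameHessian b u x = U.transpose * hessian u x * U := by
    ext p q
    simp only [frameHessian, Matrix.of_apply, fderiv_fderiv_eq_sum, Matrix.mul_apply,
      Matrix.transpose_apply, hU, Finset.sum_mul]
    rw [Finset.sum_comm]
    refine Finset.sum_congr rfl fun i _ => Finset.sum_congr rfl fun j _ => by ring
  rw [h2, trace_adjugate_conj (mul_eq_one_comm.1 h1)]

/-- `b` is an orthonormal basis of eigenvectors of the Hessian of `u` at `x`, with eigenvalues
`l`. -/
def IsEigenframe (u : E n → ℝ) (x : E n) (b : OrthonormalBasis (Fin n) ℝ (E n))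
    (l : Fin n → ℝ) : Prop :=
  ∀ p v, fderiv ℝ (fderiv ℝ u) x (b p) v = l p * inner ℝ (b p) v

theorem exists_isEigenframe (hn : 2 < n) (hu : ContDiffAt ℝ 2 u x)
    (hcone : eigenvaluesOf (hessian u x) ∈ gardingCone n (n - 1)) :
    ∃ (b : OrthonormalBasis (Fin n) ℝ (E n)) (l : Fin n → ℝ) (i₀ j k : Fin n),
      IsEigenframe u x b l ∧ IsAdmissible l i₀ j ∧ k ≠ i₀ ∧ k ≠ j := by
  have hA := hessian_isHermitian hu
  have h1 : eigenvaluesOf (hessian u x) = hA.eigenvalues := dif_pos hA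
  rw [h1] at hcone
  obtain ⟨i₀, j, k, h⟩ := exists_isAdmissible hn hcone
  refine ⟨hA.eigenvectorBasis, hA.eigenvalues, i₀, j, k, fun p v => ?_, h⟩
  have h2 := hA.mulVec_eigenvectorBasis p
  rw [fderiv_fderiv_comm hu, fderiv_fderiv_eq_sum, PiLp.inner_apply, Finset.mul_sum]
  refine Finset.sum_congr rfl fun i _ => ?_
  have h3 := congrFun h2 i
  simp only [Matrix.mulVec, dotProduct, Pi.smul_apply, smul_eq_mul] at h3
  simp only [RCLike.inner_apply, conj_trivial]
  calc ∑ q, v i * hA.eigenvectorBasis p q * hessian u x i q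
      = v i * ∑ q, hessian u x i q * hA.eigenvectorBasis p q := by
        rw [Finset.mul_sum]; exact Finset.sum_congr rfl fun q _ => by ring
    _ = _ := by rw [h3]; ring

namespace IsEigenframe

variable {b : OrthonormalBasis (Fin n) ℝ (E n)} {l : Fin n → ℝ}

theorem apply_apply (h : IsEigenframe u x b l) (p q : Fin n) :
    fderiv ℝ (fderiv ℝ u) x (b p) (b q) = if p = q then l p else 0 := by
  rw [h, orthonormal_iff_ite.1 b.orthonormal p q]
  simp

theorem frameHessian_eq (h : IsEigenframe u x b l) :
    frameHessian b u x = Matrix.diagonal l := by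
  ext p q
  rw [frameHessian, Matrix.of_apply, h.apply_apply, Matrix.diagonal_apply]

theorem apply_eq_sum (h : IsEigenframe u x b l) (v w : E n) :
    fderiv ℝ (fderiv ℝ u) x v w = ∑ p, l p * (inner ℝ (b p) v * inner ℝ (b p) w) := by
  conv_lhs => rw [← b.sum_repr' v]
  simp only [map_sum, map_smul, sum_apply, smul_apply, smul_eq_mul]
  exact Finset.sum_congr rfl fun p _ => by rw [h]; ring

theorem matNorm_le (h : IsEigenframe u x b l) {K : ℝ} (hK : ∀ c, |l c| ≤ K) (hn : 0 < n) :
    matNorm (hessian u x) ≤ n * (n * K) := by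
  have hK0 : 0 ≤ K := (abs_nonneg _).trans (hK ⟨0, hn⟩)
  have hentry : ∀ i j, |hessian u x i j| ≤ n * K := by
    intro i j
    have hle : ∀ p i, |inner ℝ (b p) (EuclideanSpace.single i (1 : ℝ))| ≤ 1 := fun p i => by
      have := abs_real_inner_le_norm (b p) (EuclideanSpace.single i (1 : ℝ))
      simpa using this
    have e : hessian u x i j = fderiv ℝ (fderiv ℝ u) x (EuclideanSpace.single i 1)
      (EuclideanSpace.single j 1) := rfl
    rw [e, h.apply_eq_sum]
    refine (Finset.abs_sum_le_sum_abs _ _).trans ?_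
    refine (Finset.sum_le_sum (g := fun _ => K) fun p _ => ?_).trans (by simp)
    rw [abs_mul, abs_mul]
    calc |l p| * _ ≤ K * (1 * 1) := mul_le_mul (hK p)
          (mul_le_mul (hle p i) (hle p j) (abs_nonneg _) zero_le_one) (by positivity) hK0
      _ = K := by ring
  have hnK : 0 ≤ (n : ℝ) * K := by positivity
  rw [matNorm]
  refine Real.sqrt_le_iff.2 ⟨by positivity, ?_⟩
  calc ∑ i, ∑ j, hessian u x i j ^ 2 ≤ ∑ i : Fin n, ∑ j : Fin n, (n * K) ^ 2 :=
        Finset.sum_le_sum fun i _ => Finset.sum_le_sum fun j _ => by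
          rw [← sq_abs]; exact pow_le_pow_left₀ (abs_nonneg _) (hentry i j) 2
    _ = _ := by simp; ring

end IsEigenframe

end Frame
end HessianEq

/-! ### First- and second-order conditions at the maximum -/

namespace HessianEq
open Filter Topology

theorem IsJet.congr_values {f : ℝ → ℝ} {c₁ c₂ d₁ d₂ : ℝ} (h : IsJet f c₁ c₂) (h₁ : c₁ = d₁)
    (h₂ : c₂ = d₂) : IsJet f d₁ d₂ := h₁ ▸ h₂ ▸ h

section Maximum

variable {n : ℕ} {u : E n → ℝ} {x : E n} {b : OrthonormalBasis (Fin n) ℝ (E n)} {l : Fin n → ℝ}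

theorem inner_gradient (u : E n → ℝ) (x v : E n) : inner ℝ (∇ u x) v = fderiv ℝ u x v := by
  rw [gradient, InnerProductSpace.toDual_symm_apply]

theorem norm_gradient_sq (b : OrthonormalBasis (Fin n) ℝ (E n)) (u : E n → ℝ) (x : E n) :
    ‖∇ u x‖ ^ 2 = ∑ p, fderiv ℝ u x (b p) ^ 2 := by
  rw [← b.sum_sq_norm_inner_left]
  refine Finset.sum_congr rfl fun p _ => ?_
  rw [inner_gradient, Real.norm_eq_abs, sq_abs]

/-- The first- and second-order conditions in the direction `b i` at a maximum point of
`(-u) ^ β * exp (A / 2 * |∇u|²) * λ_max`. -/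
theorem maximum_conditions (hu : ContDiffAt ℝ 4 u x) (hframe : IsEigenframe u x b l)
    {i₀ : Fin n} (hl : ∀ c, -l i₀ < 2 * l c) (hl0 : 0 < l i₀) (hux : u x < 0) (β A : ℝ)
    (hmax : ∀ᶠ y in 𝓝 x, ∀ v : E n,
      (-u y) ^ β * Real.exp (A / 2 * ‖∇ u y‖ ^ 2) * fderiv ℝ (fderiv ℝ u) y v v
        ≤ (-u x) ^ β * Real.exp (A / 2 * ‖∇ u x‖ ^ 2) * l i₀ * ‖v‖ ^ 2) (i : Fin n) :
    -β * fderiv ℝ u x (b i) / (-u x)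
        + fderiv ℝ (fderiv ℝ (fderiv ℝ u)) x (b i₀) (b i) (b i₀) / l i₀
        + A * (fderiv ℝ u x (b i) * l i) = 0 ∧
      -β * l i / (-u x) - β * fderiv ℝ u x (b i) ^ 2 / (-u x) ^ 2
        + (fderiv ℝ (fderiv ℝ (fderiv ℝ (fderiv ℝ u))) x (b i) (b i) (b i₀) (b i₀)
          + 4 / 3 * ∑ p ∈ Finset.univ.erase i₀,
            fderiv ℝ (fderiv ℝ (fderiv ℝ u)) x (b i₀) (b p) (b i) ^ 2 / l i₀) / l i₀
        - fderiv ℝ (fderiv ℝ (fderiv ℝ u)) x (b i₀) (b i) (b i₀) ^ 2 / l i₀ ^ 2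
        + A * (l i ^ 2 + ∑ p, fderiv ℝ u x (b p)
          * fderiv ℝ (fderiv ℝ (fderiv ℝ u)) x (b i) (b i) (b p)) ≤ 0 := by
  have hC1 : ContDiffAt ℝ 3 (fderiv ℝ u) x := hu.fderiv_right (by norm_num)
  have hC2 : ContDiffAt ℝ 2 (fderiv ℝ (fderiv ℝ u)) x := hC1.fderiv_right (by norm_num)
  have hu3 : ContDiffAt ℝ 3 u x := hu.of_le (by norm_num)
  set w := -u x with hw
  have hw0 : 0 < w := by rw [hw]; linarith
  set g : Fin n → ℝ := fun p => fderiv ℝ u x (b p) with hg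
  set T : Fin n → ℝ := fun p => fderiv ℝ (fderiv ℝ (fderiv ℝ u)) x (b i₀) (b p) (b i) with hT
  set τ : Fin n → ℝ := fun p => fderiv ℝ (fderiv ℝ (fderiv ℝ u)) x (b i) (b i) (b p) with hτ
  set C := fderiv ℝ (fderiv ℝ (fderiv ℝ (fderiv ℝ u))) x (b i) (b i) (b i₀) (b i₀) with hC
  set L := l i₀ with hL
  set S := fderiv ℝ (fderiv ℝ (fderiv ℝ u)) x (b i₀) (b i) (b i₀) with hS
  -- The direction is tilted to `b i₀ + t • y`. Since `2 * l p > -L`, the tilt gains at least `4 * c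
  -- * T - 3 * L * c²` for each `p`, which is maximal at this `c` with value `4/3 * T²/L`. The zero
  -- at `i₀` keeps `y` orthogonal to `b i₀`.
  set c : Fin n → ℝ := fun p => if p = i₀ then 0 else 2 / 3 * (T p / L) with hc
  have hc0 : c i₀ = 0 := by simp [hc]
  set y : E n := ∑ p, c p • b p with hy
  have hby : ∀ p, inner ℝ (b p) y = c p := fun p => by
    rw [hy, b.orthonormal.inner_right_fintype]
  set ω := ∑ p, c p ^ 2 with hω
  have hyω : ‖y‖ ^ 2 = ω := by
    rw [← b.sum_sq_norm_inner_right y]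
    exact Finset.sum_congr rfl fun p _ => by rw [hby, Real.norm_eq_abs, sq_abs]
  have hω0 : 0 ≤ ω := by rw [← hyω]; positivity
  have hnorm : ∀ t : ℝ, ‖b i₀ + t • y‖ ^ 2 = 1 + ω * (t * t) := fun t => by
    rw [norm_add_sq_real, inner_smul_right, hby, hc0, norm_smul, mul_pow, hyω, b.norm_eq_one,
      Real.norm_eq_abs, sq_abs]
    ring
  -- the jets of the ingredients
  have ju : IsJet (fun t => -1 * u (x + t • b i)) (-1 * g i) (-1 * l i) :=
    ((ContDiffAt.isJet_line (hu.of_le (by norm_num)) (ContinuousLinearMap.id ℝ ℝ)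
      (b i)).const_mul (-1)).congr_values rfl (by
        simp only [ContinuousLinearMap.id_apply]
        rw [hframe.apply_apply, if_pos rfl])
  have jg : ∀ p, IsJet (fun t => fderiv ℝ u (x + t • b i) (b p)) (if i = p then l i else 0) (τ p) :=
    fun p => (ContDiffAt.isJet_line (hC1.of_le (by norm_num))
      (ContinuousLinearMap.apply ℝ ℝ (b p)) (b i)).congr_values (hframe.apply_apply i p) rfl
  have jB : ∀ v v', IsJet (fun t => fderiv ℝ (fderiv ℝ u) (x + t • b i) v v')
      (fderiv ℝ (fderiv ℝ (fderiv ℝ u)) x (b i) v v')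
      (fderiv ℝ (fderiv ℝ (fderiv ℝ (fderiv ℝ u))) x (b i) (b i) v v') := fun v v' =>
    ContDiffAt.isJet_line hC2 (evalBilin v v') (b i)
  have jgrad : IsJet (fun t => A / 2 * ∑ p, fderiv ℝ u (x + t • b i) (b p)
      * fderiv ℝ u (x + t • b i) (b p)) (A * (g i * l i))
      (A * (l i ^ 2 + ∑ p, g p * τ p)) := by
    refine ((IsJet.sum fun p _ => (jg p).mul (jg p)).const_mul (A / 2)).congr_values ?_ ?_
    · simp only [zero_smul, add_zero]
      have e : ∑ p, ((if i = p then l i else 0) * fderiv ℝ u x (b p)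
          + fderiv ℝ u x (b p) * (if i = p then l i else 0)) = 2 * (g i * l i) := by
        rw [Finset.sum_eq_single i (fun p _ hp => by simp [hp.symm]) (by simp)]
        simp only [if_true, hg]; ring
      rw [e]; ring
    · simp only [zero_smul, add_zero]
      have e : ∑ p, (τ p * fderiv ℝ u x (b p)
          + 2 * ((if i = p then l i else 0) * (if i = p then l i else 0))
          + fderiv ℝ u x (b p) * τ p) = 2 * (l i ^ 2 + ∑ p, g p * τ p) := by
        rw [mul_add, Finset.mul_sum]
        simp only [Finset.sum_add_distrib]
        have e1 : ∑ p, 2 * ((if i = p then l i else 0) * (if i = p then l i else 0))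
            = 2 * l i ^ 2 := by
          rw [Finset.sum_eq_single i (fun p _ hp => by simp [hp.symm]) (by simp)]
          simp only [if_true]; ring
        rw [e1, add_right_comm, ← Finset.sum_add_distrib, add_comm]
        congr 1
        exact Finset.sum_congr rfl fun p _ => by simp only [hg]; ring
      rw [e]; ring
  have hB0y : fderiv ℝ (fderiv ℝ u) x (b i₀) y = 0 := by rw [hframe, hby, hc0, mul_zero]
  have hByy : fderiv ℝ (fderiv ℝ u) x y y = ∑ p, l p * c p ^ 2 := by
    rw [hframe.apply_eq_sum]
    exact Finset.sum_congr rfl fun p _ => by rw [hby]; ring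
  have hT3 : fderiv ℝ (fderiv ℝ (fderiv ℝ u)) x (b i) (b i₀) y = ∑ p, c p * T p := by
    rw [hy]
    simp only [map_sum, map_smul, smul_eq_mul]
    refine Finset.sum_congr rfl fun p _ => ?_
    rw [fderiv₃_comm_left hu3, fderiv₃_comm_right hu3]
  have hS3 : fderiv ℝ (fderiv ℝ (fderiv ℝ u)) x (b i) (b i₀) (b i₀) = S :=
    fderiv₃_comm_left hu3 _ _ _
  set q : ℝ → ℝ := fun t => fderiv ℝ (fderiv ℝ u) (x + t • b i) (b i₀) (b i₀)
    + (2 * (t * fderiv ℝ (fderiv ℝ u) (x + t • b i) (b i₀) y)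
      + t * t * fderiv ℝ (fderiv ℝ u) (x + t • b i) y y) with hq
  have hq0 : q 0 = L := by
    simp only [hq, zero_smul, add_zero, zero_mul, mul_zero]
    rw [hframe.apply_apply, if_pos rfl]
  have jq : IsJet q S (C + 4 * ∑ p, c p * T p + 2 * ∑ p, l p * c p ^ 2) := by
    refine ((jB (b i₀) (b i₀)).add (((IsJet.id.mul (jB (b i₀) y)).const_mul 2).add
      ((IsJet.id.mul IsJet.id).mul (jB y y)))).congr_values ?_ ?_
    · simp only [zero_smul, add_zero]
      rw [hS3, hB0y]; ring
    · simp only [zero_smul, add_zero]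
      rw [hT3, hB0y, hByy, ← hC]; ring
  have jden : IsJet (fun t => 1 + ω * (t * t)) 0 (2 * ω) :=
    ((IsJet.const 1).add ((IsJet.id.mul IsJet.id).const_mul ω)).congr_values (by ring) (by ring)
  -- This is the logarithm of the test function in the tilted direction, divided by the squared
  -- length `1 + ω * t²`; `hmax` says that it has a local maximum at `t = 0`.
  have jh := (((ju.log (by simpa using hux)).const_mul β).add jgrad).add
    ((jq.log (by rw [hq0]; exact hl0)).add ((jden.log (by simp)).const_mul (-1)))
  -- the maximum
  have hqe : ∀ᶠ y' in 𝓝 x, ContDiffAt ℝ 2 u y' := by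
    filter_upwards [hu.eventually (by simp)] with y' hy' using hy'.of_le (by norm_num)
  have hline := tendsto_line x (b i)
  have hupos : ∀ᶠ y' in 𝓝 x, 0 < -u y' :=
    hu.continuousAt.neg.eventually (lt_mem_nhds hw0)
  have hqpos : ∀ᶠ t in 𝓝 0, 0 < q t :=
    jq.hasDerivAt.continuousAt.eventually (lt_mem_nhds (by rw [hq0]; exact hl0))
  have hloc := jh.of_isLocalMax (by
    filter_upwards [hline.eventually hmax, hline.eventually hupos, hline.eventually hqe, hqpos]
      with t h1 h2 h3 h4
    have h5 := h1 (b i₀ + t • y)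
    have e1 : fderiv ℝ (fderiv ℝ u) (x + t • b i) (b i₀ + t • y) (b i₀ + t • y) = q t := by
      simp only [map_add, map_smul, add_apply, smul_apply, smul_eq_mul, hq]
      rw [fderiv_fderiv_comm h3 y (b i₀)]
      ring
    rw [e1, hnorm] at h5
    have hden : 0 < 1 + ω * (t * t) := by
      have := mul_nonneg hω0 (mul_self_nonneg t); linarith
    have h6 := Real.log_le_log (by positivity) h5
    rw [Real.log_mul (by positivity) h4.ne', Real.log_mul (by positivity) (by positivity),
      Real.log_rpow h2, Real.log_exp, Real.log_mul (by positivity) hden.ne',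
      Real.log_mul (by positivity) hl0.ne', Real.log_mul (by positivity) (by positivity),
      Real.log_rpow hw0, Real.log_exp, norm_gradient_sq b, norm_gradient_sq b] at h6
    simp only [sq] at h6
    simp only [zero_smul, add_zero, mul_zero, Real.log_one, neg_one_mul, ← hw, hq0]
    linarith)
  simp only [zero_smul, add_zero, mul_zero, neg_one_mul, ← hw, hq0, zero_div] at hloc
  obtain ⟨h1, h2⟩ := hloc
  refine ⟨by rw [← h1]; ring, le_trans ?_ h2⟩
  have hsum : 4 / 3 * ∑ p ∈ Finset.univ.erase i₀, T p ^ 2 / L + 2 * ω * L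
      ≤ 4 * ∑ p, c p * T p + 2 * ∑ p, l p * c p ^ 2 := by
    rw [hω, ← Finset.add_sum_erase _ (fun p => c p ^ 2) (Finset.mem_univ i₀),
      ← Finset.add_sum_erase _ (fun p => c p * T p) (Finset.mem_univ i₀),
      ← Finset.add_sum_erase _ (fun p => l p * c p ^ 2) (Finset.mem_univ i₀), hc0]
    simp only [zero_mul, ne_eq, OfNat.ofNat_ne_zero, not_false_eq_true, zero_pow, mul_zero,
      zero_add]
    rw [mul_assoc, Finset.sum_mul, Finset.mul_sum, Finset.mul_sum, Finset.mul_sum, Finset.mul_sum,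
      ← Finset.sum_add_distrib, ← Finset.sum_add_distrib]
    refine Finset.sum_le_sum fun p hp => ?_
    have hcp : c p = 2 / 3 * (T p / L) := by simp [hc, Finset.ne_of_mem_erase hp]
    obtain ⟨r, hr⟩ : ∃ r, r = T p / L := ⟨_, rfl⟩
    have hTr : T p = r * L := by rw [hr]; field_simp
    rw [hcp, ← hr, hTr]
    have e : (r * L) ^ 2 / L = r ^ 2 * L := by field_simp
    rw [e]
    have := mul_le_mul_of_nonneg_left (hl p).le (sq_nonneg r)
    linarith
  have hdiv := div_le_div_of_nonneg_right hsum hl0.le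
  have e1 : (4 / 3 * ∑ p ∈ Finset.univ.erase i₀, T p ^ 2 / L + 2 * ω * L) / L
      = 4 / 3 * (∑ p ∈ Finset.univ.erase i₀, T p ^ 2 / L) / L + 2 * ω := by field_simp
  rw [e1] at hdiv
  have e2 : β * (-l i / w - (-g i) ^ 2 / w ^ 2) = -β * l i / w - β * g i ^ 2 / w ^ 2 := by ring
  rw [e2, add_div, add_assoc C, add_div C]
  simp only [one_pow, div_one]
  linarith

end Maximum
end HessianEq

/-! ### Differentiating the equation -/

namespace HessianEq
open Filter Topology

theorem IsJet.congr_of_eventuallyEq {f g : ℝ → ℝ} {c₁ c₂ : ℝ} (h : IsJet f c₁ c₂)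
    (hfg : g =ᶠ[𝓝 0] f) : IsJet g c₁ c₂ := by
  obtain ⟨F, hF, hF1, hF2⟩ := h
  refine ⟨F, ?_, hF1, hF2⟩
  filter_upwards [hF, hfg.eventually_nhds] with t h1 h2
  exact h1.congr_of_eventuallyEq h2

section Equation

variable {n : ℕ} {u : E n → ℝ} {x : E n} {b : OrthonormalBasis (Fin n) ℝ (E n)} {l : Fin n → ℝ}

theorem gradient_eq_sum (b : OrthonormalBasis (Fin n) ℝ (E n)) (u : E n → ℝ) (x : E n) :
    ∇ u x = ∑ q, fderiv ℝ u x (b q) • b q := by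
  conv_lhs => rw [← b.sum_repr' (∇ u x)]
  exact Finset.sum_congr rfl fun q _ => by rw [real_inner_comm, inner_gradient]

/-- The first two derivatives of `σ_{n-1}(∇²u)` along a line. -/
theorem isJet_trace_adjugate (hu : ContDiffAt ℝ 4 u x) (hframe : IsEigenframe u x b l) (e : E n) :
    IsJet (fun t => (frameHessian b u (x + t • e)).adjugate.trace)
      (∑ i, sig₁ l i * fderiv ℝ (fderiv ℝ (fderiv ℝ u)) x e (b i) (b i))
      (∑ i, sig₁ l i * fderiv ℝ (fderiv ℝ (fderiv ℝ (fderiv ℝ u))) x e e (b i) (b i)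
        + ∑ p, ∑ q ∈ Finset.univ.erase p, sig₂ l p q
          * (fderiv ℝ (fderiv ℝ (fderiv ℝ u)) x e (b p) (b p)
              * fderiv ℝ (fderiv ℝ (fderiv ℝ u)) x e (b q) (b q)
            - fderiv ℝ (fderiv ℝ (fderiv ℝ u)) x e (b p) (b q)
              * fderiv ℝ (fderiv ℝ (fderiv ℝ u)) x e (b q) (b p))) := by
  have hC1 : ContDiffAt ℝ 3 (fderiv ℝ u) x := hu.fderiv_right (by norm_num)
  have hC2 : ContDiffAt ℝ 2 (fderiv ℝ (fderiv ℝ u)) x := hC1.fderiv_right (by norm_num)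
  have key := trace_adjugate_path (M := fun t => frameHessian b u (x + t • e))
    (M₁ := fun t => Matrix.of fun p q =>
      fderiv ℝ (fderiv ℝ (fderiv ℝ u)) (x + t • e) e (b p) (b q))
    (M₂ := Matrix.of fun p q =>
      fderiv ℝ (fderiv ℝ (fderiv ℝ (fderiv ℝ u))) x e e (b p) (b q)) (d := l)
    (by
      filter_upwards [ContDiffAt.hasDerivAt_line_eventually (hC2.of_le (by norm_num)) e]
        with t ht p q
      exact (evalBilin (b p) (b q)).hasFDerivAt.comp_hasDerivAt t ht)
    (fun p q => (evalBilin (b p) (b q)).hasFDerivAt.comp_hasDerivAt (0 : ℝ)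
      (ContDiffAt.hasDerivAt_fderiv_line hC2 e))
    (by simpa using hframe.frameHessian_eq)
  obtain ⟨f₁, h1, h2, h3⟩ := key
  refine ⟨f₁, h1, ?_, ?_⟩
  · rw [h2]; simp
  · simpa using h3

/-- The differentiated equation. -/
theorem equation_conditions {Ω : Set (E n)} (hΩ : IsOpen Ω) (hx : x ∈ Ω)
    (hu : ContDiffAt ℝ 4 u x) (hframe : IsEigenframe u x b l) {ψ : E n × ℝ × E n → ℝ}
    (hψ : ∀ q : E n × ℝ × E n, q.1 ∈ Ω → DifferentiableAt ℝ ψ q) {M₀ M₁ N : ℝ}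
    (hM₀ : ∀ y ∈ Ω, |u y| ≤ M₀) (hM₁ : ∀ y ∈ Ω, ‖∇ u y‖ ≤ M₁)
    (hN : C11NormLE ψ (box Ω M₀ M₁) N)
    (heq : ∀ y ∈ Ω, (hessian u y).adjugate.trace = ψ (y, u y, ∇ u y)) (i : Fin n) :
    ∑ p, sig₁ l p * fderiv ℝ (fderiv ℝ (fderiv ℝ u)) x (b i) (b p) (b p)
        = fderiv ℝ ψ (x, u x, ∇ u x) (b i, fderiv ℝ u x (b i), l i • b i) ∧
      |∑ p, sig₁ l p * fderiv ℝ (fderiv ℝ (fderiv ℝ (fderiv ℝ u))) x (b i) (b i) (b p) (b p)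
        + ∑ p, ∑ q ∈ Finset.univ.erase p, sig₂ l p q
          * (fderiv ℝ (fderiv ℝ (fderiv ℝ u)) x (b i) (b p) (b p)
              * fderiv ℝ (fderiv ℝ (fderiv ℝ u)) x (b i) (b q) (b q)
            - fderiv ℝ (fderiv ℝ (fderiv ℝ u)) x (b i) (b p) (b q)
              * fderiv ℝ (fderiv ℝ (fderiv ℝ u)) x (b i) (b q) (b p))
        - fderiv ℝ ψ (x, u x, ∇ u x)
          (0, l i, ∑ q, fderiv ℝ (fderiv ℝ (fderiv ℝ u)) x (b i) (b i) (b q) • b q)|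
        ≤ N * ‖((b i, fderiv ℝ u x (b i), l i • b i) : E n × ℝ × E n)‖ ^ 2 := by
  have hC1 : ContDiffAt ℝ 3 (fderiv ℝ u) x := hu.fderiv_right (by norm_num)
  have hline := tendsto_line x (b i)
  have hmem : ∀ᶠ t : ℝ in 𝓝 0, x + t • b i ∈ Ω := hline.eventually (hΩ.mem_nhds hx)
  have hz : x + (0 : ℝ) • b i = x := by simp
  have h2 : ∑ q, fderiv ℝ (fderiv ℝ u) x (b i) (b q) • b q = l i • b i := by
    rw [Finset.sum_eq_single i]
    · rw [hframe.apply_apply, if_pos rfl]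
    · intro q _ hq
      rw [hframe.apply_apply, if_neg hq.symm, zero_smul]
    · simp
  have hq : ∀ᶠ t : ℝ in 𝓝 0, HasDerivAt
      (fun t : ℝ => ((x + t • b i, u (x + t • b i), ∇ u (x + t • b i)) : E n × ℝ × E n))
      (b i, fderiv ℝ u (x + t • b i) (b i),
        ∑ q, fderiv ℝ (fderiv ℝ u) (x + t • b i) (b i) (b q) • b q) t := by
    filter_upwards [ContDiffAt.hasDerivAt_line_eventually (hu.of_le (by norm_num)) (b i),
        ContDiffAt.hasDerivAt_line_eventually (hC1.of_le (by norm_num)) (b i)] with t h1 h2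
    refine (hasDerivAt_line x (b i) t).prodMk (h1.prodMk ?_)
    simp only [gradient_eq_sum b]
    refine HasDerivAt.fun_sum fun q _ => HasDerivAt.smul_const ?_ _
    exact (ContinuousLinearMap.apply ℝ ℝ (b q)).hasFDerivAt.comp_hasDerivAt t h2
  have hq₁ : HasDerivAt (fun t : ℝ => ((b i, fderiv ℝ u (x + t • b i) (b i),
        ∑ q, fderiv ℝ (fderiv ℝ u) (x + t • b i) (b i) (b q) • b q) : E n × ℝ × E n))
      (0, l i, ∑ q, fderiv ℝ (fderiv ℝ (fderiv ℝ u)) x (b i) (b i) (b q) • b q) 0 := by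
    refine (hasDerivAt_const _ _).prodMk (HasDerivAt.prodMk ?_ ?_)
    · have h3 := ContDiffAt.hasDerivAt_fderiv_line (hu.of_le (by norm_num)) (b i)
      rwa [hframe.apply_apply, if_pos rfl] at h3
    · refine HasDerivAt.fun_sum fun q _ => HasDerivAt.smul_const ?_ _
      exact (ContinuousLinearMap.apply ℝ ℝ (b q)).hasFDerivAt.comp_hasDerivAt (0 : ℝ)
        (ContDiffAt.hasDerivAt_fderiv_line (hC1.of_le (by norm_num)) (b i))
  have hψ' : ∀ᶠ t : ℝ in 𝓝 0, HasFDerivAt ψ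
      (fderiv ℝ ψ (x + t • b i, u (x + t • b i), ∇ u (x + t • b i)))
      (x + t • b i, u (x + t • b i), ∇ u (x + t • b i)) :=
    hmem.mono fun t ht => (hψ _ ht).hasFDerivAt
  have hP : ∀ᶠ t : ℝ in 𝓝 0, ‖fderiv ℝ ψ (x + t • b i, u (x + t • b i), ∇ u (x + t • b i))
      - fderiv ℝ ψ (x + (0 : ℝ) • b i, u (x + (0 : ℝ) • b i), ∇ u (x + (0 : ℝ) • b i))‖
      ≤ N * ‖((x + t • b i, u (x + t • b i), ∇ u (x + t • b i)) : E n × ℝ × E n)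
        - (x + (0 : ℝ) • b i, u (x + (0 : ℝ) • b i), ∇ u (x + (0 : ℝ) • b i))‖ := by
    rw [hz]
    have hbox : ∀ y ∈ Ω, ((y, u y, ∇ u y) : E n × ℝ × E n) ∈ box Ω M₀ M₁ :=
      fun y hy => ⟨hy, hM₀ y hy, hM₁ y hy⟩
    filter_upwards [hmem] with t ht
    exact hN.2.2 (x + t • b i, u (x + t • b i), ∇ u (x + t • b i)) (hbox _ ht)
      (x, u x, ∇ u x) (hbox x hx)
  -- The second derivative of the right-hand side along the line exists because it equals
  -- σ_{n-1}(∇²u) with `u` of class C⁴; this is how `ψ` of class C^{1,1} suffices.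
  have hj := (isJet_trace_adjugate hu hframe (b i)).congr_of_eventuallyEq
    (g := fun t => ψ (x + t • b i, u (x + t • b i), ∇ u (x + t • b i)))
    (hmem.mono fun t ht => by
      simp only [trace_adjugate_frameHessian]
      exact (heq _ ht).symm)
  have key := IsJet.comp_lipschitz hq hq₁ hψ' hP hj
  simp only [hz, h2] at key
  exact key

end Equation
end HessianEq

/-! ### The bound at the maximum point and the existence of such a point -/

namespace HessianEq
open Filter Topology

section Estimate

variable {n : ℕ} {u : E n → ℝ} {x : E n}

theorem IsEigenframe.apply_self_le {b : OrthonormalBasis (Fin n) ℝ (E n)} {l : Fin n → ℝ}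
    (h : IsEigenframe u x b l) {K : ℝ} (hK : ∀ c, l c ≤ K) (v : E n) :
    fderiv ℝ (fderiv ℝ u) x v v ≤ K * ‖v‖ ^ 2 := by
  rw [h.apply_eq_sum, ← b.sum_sq_norm_inner_right v, Finset.mul_sum]
  refine Finset.sum_le_sum fun p _ => ?_
  rw [Real.norm_eq_abs, sq_abs, ← sq]
  exact mul_le_mul_of_nonneg_right (hK p) (sq_nonneg _)

/-- The largest eigenvalue at a maximum point of the test function. -/
theorem top_mul_le_of_maximum {Ω : Set (E n)} (hΩ : IsOpen Ω) (hx : x ∈ Ω)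
    (hu : ContDiffAt ℝ 4 u x) {b : OrthonormalBasis (Fin n) ℝ (E n)} {l : Fin n → ℝ}
    (hframe : IsEigenframe u x b l) {i₀ j k : Fin n} (hl : IsAdmissible l i₀ j) (hk : k ≠ i₀)
    (hkj : k ≠ j) {ψ : E n × ℝ × E n → ℝ}
    (hψ : ∀ q : E n × ℝ × E n, q.1 ∈ Ω → DifferentiableAt ℝ ψ q) {M₀ M₁ N m A β : ℝ}
    (hM₀ : ∀ y ∈ Ω, |u y| ≤ M₀) (hM₁ : ∀ y ∈ Ω, ‖∇ u y‖ ≤ M₁)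
    (hN : C11NormLE ψ (box Ω M₀ M₁) N)
    (heq : ∀ y ∈ Ω, (hessian u y).adjugate.trace = ψ (y, u y, ∇ u y)) (hm : 0 < m)
    (hmψ : m ≤ ψ (x, u x, ∇ u x)) (hA0 : 0 ≤ A)
    (hA : 16 * (2 + 720 * (n : ℝ)) * N ^ 2 / m ^ 2 ≤ A / 4) (hA' : 4 * N + 1 ≤ A / 8 * m)
    (hβ : 288 * (n : ℝ) ≤ β) (hβ' : 4 * A * M₁ ^ 2 ≤ β) (hux : u x < 0)
    (hmax : ∀ᶠ y in 𝓝 x, ∀ v : E n,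
      (-u y) ^ β * Real.exp (A / 2 * ‖∇ u y‖ ^ 2) * fderiv ℝ (fderiv ℝ u) y v v
        ≤ (-u x) ^ β * Real.exp (A / 2 * ‖∇ u x‖ ^ 2) * l i₀ * ‖v‖ ^ 2) :
    l i₀ * -u x ≤ β * N * (n - 1 + M₁) + (N + A * N * (M₁ + M₁ ^ 2)) * M₀ + (1 + M₁) * M₀ := by
  have hw : 0 < -u x := by linarith
  have hwM : -u x ≤ M₀ := (neg_le_abs _).trans (hM₀ x hx)
  have hM0 : 0 ≤ M₀ := hw.le.trans hwM
  have hM1 : 0 ≤ M₁ := (norm_nonneg _).trans (hM₁ x hx)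
  have hbox : ((x, u x, ∇ u x) : E n × ℝ × E n) ∈ box Ω M₀ M₁ := ⟨hx, hM₀ x hx, hM₁ x hx⟩
  set P := fderiv ℝ ψ (x, u x, ∇ u x) with hP
  have hPN : ‖P‖ ≤ N := hN.2.1 _ hbox
  have hN0 : 0 ≤ N := (norm_nonneg _).trans hPN
  have hn1 : (1 : ℝ) ≤ n := by exact_mod_cast (Fin.pos i₀)
  have hβ0 : 0 ≤ β := by linarith
  have h0 := hl.top_pos
  -- A small eigenvalue is bounded trivially; otherwise `l i₀` dominates 1 and the gradient, which
  -- yields `Q ≤ 2 * l i₀`.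
  rcases lt_or_ge (l i₀) (1 + M₁) with hsmall | hlarge
  · have h1 : l i₀ * -u x ≤ (1 + M₁) * M₀ := mul_le_mul hsmall.le hwM hw.le (by positivity)
    have h2 : 0 ≤ β * N * (n - 1 + M₁) := mul_nonneg (by positivity) (by linarith)
    have h3 : 0 ≤ (N + A * N * (M₁ + M₁ ^ 2)) * M₀ := by positivity
    linarith
  have hu3 : ContDiffAt ℝ 3 u x := hu.of_le (by norm_num)
  have hmc := maximum_conditions hu hframe (hl.neg_top_lt hk hkj) h0 hux β A hmax
  have hec := equation_conditions hΩ hx hu hframe hψ hM₀ hM₁ hN heq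
  rw [← hP] at hec
  have hPle : ∀ q, |P q| ≤ N * ‖q‖ := fun q =>
    (P.le_opNorm q).trans (mul_le_mul_of_nonneg_right hPN (norm_nonneg _))
  have hsplit : ∀ (v : E n) (r : ℝ) (v' : E n),
      P (v, r, v') = P (v, 0, 0) + P (0, 1, 0) * r + P (0, 0, v') := fun v r v' => by
    have e : ((v, r, v') : E n × ℝ × E n)
        = (v, 0, 0) + r • ((0, 1, 0) : E n × ℝ × E n) + (0, 0, v') := by simp
    rw [e, map_add, map_add, map_smul, smul_eq_mul, mul_comm]
  have hsum₁ : ∀ c : Fin n → ℝ, P (∑ p, c p • b p, 0, 0) = ∑ p, P (b p, 0, 0) * c p := fun c => by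
    have e : ((∑ p, c p • b p, 0, 0) : E n × ℝ × E n)
        = ∑ p, c p • ((b p, 0, 0) : E n × ℝ × E n) := by
      ext <;> simp [Prod.fst_sum, Prod.snd_sum]
    rw [e, map_sum]
    exact Finset.sum_congr rfl fun p _ => by rw [map_smul, smul_eq_mul, mul_comm]
  have hsum₃ : ∀ c : Fin n → ℝ, P (0, 0, ∑ p, c p • b p) = ∑ p, P (0, 0, b p) * c p := fun c => by
    have e : ((0, 0, ∑ p, c p • b p) : E n × ℝ × E n)
        = ∑ p, c p • ((0, 0, b p) : E n × ℝ × E n) := by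
      ext <;> simp [Prod.fst_sum, Prod.snd_sum]
    rw [e, map_sum]
    exact Finset.sum_congr rfl fun p _ => by rw [map_smul, smul_eq_mul, mul_comm]
  have hsmul₃ : ∀ (c : ℝ) (v : E n), P (0, 0, c • v) = P (0, 0, v) * c := fun c v => by
    have e : ((0, 0, c • v) : E n × ℝ × E n) = c • (0, 0, v) := by simp
    rw [e, map_smul, smul_eq_mul, mul_comm]
  have hg₁ : ∀ p, |fderiv ℝ u x (b p)| ≤ M₁ := fun p => by
    rw [← inner_gradient]
    refine (abs_real_inner_le_norm _ _).trans ?_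
    rw [b.norm_eq_one, mul_one]
    exact hM₁ x hx
  have hsig : sig l = ψ (x, u x, ∇ u x) := by
    rw [← heq x hx, ← trace_adjugate_frameHessian b, hframe.frameHessian_eq,
      sig_eq_trace_adjugate_diagonal]
  set Q := ‖((b i₀, fderiv ℝ u x (b i₀), l i₀ • b i₀) : E n × ℝ × E n)‖ with hQ
  have hQle : Q ≤ 2 * l i₀ := by
    rw [hQ, Prod.norm_mk, Prod.norm_mk, norm_smul, b.norm_eq_one, mul_one, Real.norm_eq_abs,
      Real.norm_eq_abs, abs_of_pos h0]
    have := hg₁ i₀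
    refine max_le (by linarith) (max_le (by linarith) (by linarith))
  have hmain := hl.top_le hk hkj (β := β) (A := A) (N := N) (m := m) (M₁ := M₁) (w := -u x)
    (c := P (0, 1, 0)) (Q := Q) (g := fun p => fderiv ℝ u x (b p))
    (a := fun p => P (b p, 0, 0)) (e := fun p => P (0, 0, b p))
    (f := fun p => P (b p, fderiv ℝ u x (b p), l p • b p))
    (C := fun p => fderiv ℝ (fderiv ℝ (fderiv ℝ (fderiv ℝ u))) x (b p) (b p) (b i₀) (b i₀))
    (T := fun p q => fderiv ℝ (fderiv ℝ (fderiv ℝ u)) x (b i₀) (b p) (b q))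
    (τ := fun p i => fderiv ℝ (fderiv ℝ (fderiv ℝ u)) x (b p) (b i) (b i))
    (f₁₁ := ∑ p, sig₁ l p
        * fderiv ℝ (fderiv ℝ (fderiv ℝ (fderiv ℝ u))) x (b i₀) (b i₀) (b p) (b p)
      + ∑ p, ∑ q ∈ Finset.univ.erase p, sig₂ l p q
          * (fderiv ℝ (fderiv ℝ (fderiv ℝ u)) x (b i₀) (b p) (b p)
              * fderiv ℝ (fderiv ℝ (fderiv ℝ u)) x (b i₀) (b q) (b q)
            - fderiv ℝ (fderiv ℝ (fderiv ℝ u)) x (b i₀) (b p) (b q)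
              * fderiv ℝ (fderiv ℝ (fderiv ℝ u)) x (b i₀) (b q) (b p)))
    (fun p q => fderiv₃_comm_right hu3 _ _ _) hw hm hN0 (by simpa using hA) hA' (by simpa using hβ)
    hβ' (fun i => (hmc i).1)
    (fun i => by
      have h1 := (hmc i).2
      have e : ∀ p, fderiv ℝ (fderiv ℝ (fderiv ℝ u)) x (b i) (b i) (b p)
          = fderiv ℝ (fderiv ℝ (fderiv ℝ u)) x (b p) (b i) (b i) := fun p => by
        rw [fderiv₃_comm_right hu3, fderiv₃_comm_left hu3]
      simp only [e] at h1
      exact h1)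
    (fun p => (hec p).1) (fun p => by rw [hsplit, hsmul₃]) (hec i₀).1
    (by
      -- Exchanging the pairs of indices turns the fourth derivatives of the top entry into those of
      -- the differentiated equation; the quadratic terms then cancel by definition.
      simp only [negHess, fderiv₄_pair_comm hu _ (b i₀)]
      rw [add_assoc, add_assoc, ← Finset.sum_neg_distrib, ← Finset.sum_add_distrib,
        ← Finset.sum_add_distrib]
      symm
      rw [add_eq_left]
      refine Finset.sum_eq_zero fun p _ => ?_
      rw [← Finset.sum_neg_distrib, ← Finset.sum_add_distrib, ← Finset.sum_add_distrib]
      refine Finset.sum_eq_zero fun q _ => ?_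
      rw [fderiv₃_comm_right hu3 (b i₀) (b q) (b p)]
      ring)
    (by
      have h1 := (abs_le.1 (hec i₀).2).1
      rw [hsplit, hsum₃] at h1
      have e0 : P (0, 0, 0) = 0 := map_zero P
      have e : ∀ q, fderiv ℝ (fderiv ℝ (fderiv ℝ u)) x (b i₀) (b i₀) (b q)
          = fderiv ℝ (fderiv ℝ (fderiv ℝ u)) x (b i₀) (b q) (b i₀) := fun q =>
        fderiv₃_comm_right hu3 _ _ _
      simp only [e] at h1
      rw [← hQ, e0] at h1
      linarith)
    (hPle _) (norm_nonneg _) hQle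
    (by
      rw [← hsum₁, ← gradient_eq_sum]
      refine (hPle _).trans (mul_le_mul_of_nonneg_left ?_ hN0)
      rw [Prod.norm_mk, Prod.norm_mk, norm_zero, norm_zero]
      simpa using hM₁ x hx)
    (by
      rw [← hsum₃, ← gradient_eq_sum]
      refine (hPle _).trans (mul_le_mul_of_nonneg_left ?_ hN0)
      rw [Prod.norm_mk, Prod.norm_mk, norm_zero, norm_zero]
      simpa using hM₁ x hx)
    (by
      have := hPle (0, 1, 0)
      simpa [Prod.norm_mk] using this)
    (by
      rw [← norm_gradient_sq]
      exact pow_le_pow_left₀ (norm_nonneg _) (hM₁ x hx) 2)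
    (hsig ▸ hmψ) (hsig ▸ (le_abs_self _).trans (hN.1 _ hbox))
  rw [Fintype.card_fin] at hmain
  have h1 := mul_le_mul_of_nonneg_right hmain hw.le
  have e : (β * N * (n - 1 + M₁) / -u x + N + A * N * (M₁ + M₁ ^ 2)) * -u x
      = β * N * (n - 1 + M₁) + (N + A * N * (M₁ + M₁ ^ 2)) * -u x := by
    rw [add_assoc, add_mul, div_mul_cancel₀ _ hw.ne']
  rw [e] at h1
  have h2 : (N + A * N * (M₁ + M₁ ^ 2)) * -u x ≤ (N + A * N * (M₁ + M₁ ^ 2)) * M₀ :=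
    mul_le_mul_of_nonneg_left hwM (by positivity)
  have h3 : 0 ≤ (1 + M₁) * M₀ := by positivity
  linarith

/-- An admissible function that vanishes on the boundary is negative. -/
theorem neg_of_admissible (hn : 2 < n) {Ω : Set (E n)} (hΩ : IsOpen Ω)
    (hb : Bornology.IsBounded Ω) (hu : ∀ y ∈ Ω, ContDiffAt ℝ 2 u y)
    (hc : ContinuousOn u (closure Ω))
    (hcone : ∀ y ∈ Ω, eigenvaluesOf (hessian u y) ∈ gardingCone n (n - 1))
    (hbd : ∀ y ∈ frontier Ω, u y = 0) (hx : x ∈ Ω) : u x < 0 := by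
  -- The Hessian has a positive eigenvalue everywhere, which excludes an interior maximum.
  have hno : ∀ y ∈ Ω, ¬ ∀ z ∈ Ω, u z ≤ u y := by
    intro y hy hcon
    obtain ⟨b, l, i₀, j, k, hframe, hl, -, -⟩ := exists_isEigenframe hn (hu y hy) (hcone y hy)
    have hj := ContDiffAt.isJet_line (hu y hy) (ContinuousLinearMap.id ℝ ℝ) (b i₀)
    have h1 := hj.of_isLocalMax (by
      filter_upwards [(tendsto_line y (b i₀)).eventually (hΩ.mem_nhds hy)] with t ht
      simpa using hcon _ ht)
    have h2 := h1.2
    rw [ContinuousLinearMap.id_apply, hframe.apply_apply, if_pos rfl] at h2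
    linarith [hl.top_pos]
  by_contra hcon
  push Not at hcon
  obtain ⟨y, hy, hmax⟩ := hb.isCompact_closure.exists_isMaxOn ⟨x, subset_closure hx⟩ hc
  have hle : ∀ z ∈ Ω, u z ≤ u y := fun z hz => hmax (subset_closure hz)
  by_cases hyΩ : y ∈ Ω
  · exact hno y hyΩ hle
  · have hyb : u y = 0 := hbd y (by rw [hΩ.frontier_eq]; exact ⟨hy, hyΩ⟩)
    exact hno x hx fun z hz => (hle z hz).trans (hyb ▸ hcon)

theorem norm_gradient (u : E n → ℝ) (x : E n) : ‖∇ u x‖ = ‖fderiv ℝ u x‖ := by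
  rw [gradient, LinearIsometryEquiv.norm_map]

/-- The test function attains its maximum at an interior point. -/
theorem exists_maximum (hn : 2 < n) {Ω : Set (E n)} (hΩ : IsOpen Ω)
    (hb : Bornology.IsBounded Ω) (hu : ∀ y ∈ Ω, ContDiffAt ℝ 2 u y)
    (hC2 : IsC2UpToBoundary Ω u)
    (hcone : ∀ y ∈ Ω, eigenvaluesOf (hessian u y) ∈ gardingCone n (n - 1))
    (hbd : ∀ y ∈ frontier Ω, u y = 0) (hneg : ∀ y ∈ Ω, u y < 0) (hΩne : Ω.Nonempty) {β : ℝ}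
    (hβ : 0 < β) (A : ℝ) :
    ∃ y ∈ Ω, ∃ (b : OrthonormalBasis (Fin n) ℝ (E n)) (l : Fin n → ℝ) (i₀ j k : Fin n),
      IsEigenframe u y b l ∧ IsAdmissible l i₀ j ∧ k ≠ i₀ ∧ k ≠ j ∧
      ∀ z ∈ Ω, ∀ v : E n,
      (-u z) ^ β * Real.exp (A / 2 * ‖∇ u z‖ ^ 2) * fderiv ℝ (fderiv ℝ u) z v v
        ≤ (-u y) ^ β * Real.exp (A / 2 * ‖∇ u y‖ ^ 2) * l i₀ * ‖v‖ ^ 2 := by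
  obtain ⟨-, hc, ⟨g₁, hg₁, hg₁'⟩, ⟨g₂, hg₂, hg₂'⟩⟩ := hC2
  obtain ⟨x, hx⟩ := hΩne
  -- The continuous extensions `g₁`, `g₂` replace the derivatives, so that `Φ` is continuous on a
  -- compact set; it vanishes over the boundary because `β > 0`.
  set Φ : E n × E n → ℝ := fun q =>
    (-u q.1) ^ β * Real.exp (A / 2 * ‖g₁ q.1‖ ^ 2) * g₂ q.1 q.2 q.2 with hΦ
  have hΦΩ : ∀ z ∈ Ω, ∀ v, Φ (z, v)
      = (-u z) ^ β * Real.exp (A / 2 * ‖∇ u z‖ ^ 2) * fderiv ℝ (fderiv ℝ u) z v v :=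
    fun z hz v => by simp only [hΦ, norm_gradient, ← hg₁' hz, ← hg₂' hz]
  set K : Set (E n × E n) := closure Ω ×ˢ Metric.sphere (0 : E n) 1 with hK
  have hKc : IsCompact K := hb.isCompact_closure.prod (isCompact_sphere _ _)
  have hfst : Set.MapsTo (Prod.fst : E n × E n → E n) K (closure Ω) := fun q hq => hq.1
  have hcont : ContinuousOn Φ K := by
    refine ContinuousOn.mul (ContinuousOn.mul ?_ ?_) ?_
    · exact ((hc.comp continuousOn_fst hfst).neg).rpow_const fun _ _ => Or.inr hβ.le
    · exact Real.continuous_exp.comp_continuousOn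
        (((hg₁.comp continuousOn_fst hfst).norm.pow 2).const_smul (A / 2))
    · exact ((hg₂.comp continuousOn_fst hfst).clm_apply continuousOn_snd).clm_apply continuousOn_snd
  obtain ⟨b, l, i₀, j, k, hframe, hl, -, -⟩ := exists_isEigenframe hn (hu x hx) (hcone x hx)
  have hxK : (x, b i₀) ∈ K := ⟨subset_closure hx, by simp⟩
  obtain ⟨⟨y, v⟩, hyv, hmax⟩ := hKc.exists_isMaxOn ⟨_, hxK⟩ hcont
  have hpos : 0 < Φ (x, b i₀) := by
    rw [hΦΩ x hx, hframe.apply_apply, if_pos rfl]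
    have := hneg x hx
    have h1 : 0 < -u x := by linarith
    have h2 := hl.top_pos
    positivity
  have hyΩ : y ∈ Ω := by
    by_contra hcon
    have hyb : u y = 0 := hbd y (by rw [hΩ.frontier_eq]; exact ⟨hyv.1, hcon⟩)
    have h0 : Φ (y, v) = 0 := by simp [hΦ, hyb, Real.zero_rpow hβ.ne']
    have := hmax hxK
    simp only [Set.mem_ofPred_eq] at this
    linarith
  obtain ⟨b', l', i₁, j', k', hframe', hl', hk, hkj⟩ :=
    exists_isEigenframe hn (hu y hyΩ) (hcone y hyΩ)
  refine ⟨y, hyΩ, b', l', i₁, j', k', hframe', hl', hk, hkj, fun z hz v' => ?_⟩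
  have huy : 0 < -u y := by linarith [hneg y hyΩ]
  have hvle : Φ (y, v) ≤ (-u y) ^ β * Real.exp (A / 2 * ‖∇ u y‖ ^ 2) * l' i₁ := by
    rw [hΦΩ y hyΩ]
    refine mul_le_mul_of_nonneg_left ?_ (by positivity)
    have h1 := hframe'.apply_self_le hl'.le_top v
    have h2 : ‖v‖ = 1 := by simpa using hyv.2
    rwa [h2, one_pow, mul_one] at h1
  rw [← hΦΩ z hz]
  by_cases hv' : v' = 0
  · rw [hv']; simp [hΦ]
  have hv'0 : 0 < ‖v'‖ := norm_pos_iff.2 hv'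
  have hunit : ‖‖v'‖⁻¹ • v'‖ = 1 := by
    rw [norm_smul, norm_inv, norm_norm, inv_mul_cancel₀ hv'0.ne']
  have hmem : (z, ‖v'‖⁻¹ • v') ∈ K := ⟨subset_closure hz, by simpa using hunit⟩
  have h1 := (hmax hmem).trans hvle
  have e : Φ (z, v') = Φ (z, ‖v'‖⁻¹ • v') * ‖v'‖ ^ 2 := by
    simp only [hΦ, map_smul, smul_apply, smul_eq_mul]
    field_simp
  rw [e]
  exact mul_le_mul_of_nonneg_right h1 (by positivity)

end Estimate
end HessianEq

/-! ### Choice of constants and conclusion -/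

theorem theorem1p1 (n : ℕ) (hn : 2 < n) (M₀ M₁ N m : ℝ) (hm : 0 < m) :
    ∃ β C : ℝ, 0 < β ∧
      ∀ (Ω : Set (HessianEq.E n)) (ψ : HessianEq.E n × ℝ × HessianEq.E n → ℝ)
        (u : HessianEq.E n → ℝ),
        IsOpen Ω → Bornology.IsBounded Ω →
        HessianEq.IsC11 Ω ψ →
        (∀ x ∈ closure Ω, ∀ (z : ℝ) (p : HessianEq.E n), 0 < ψ (x, z, p)) →
        ContDiffOn ℝ 4 u Ω →
        HessianEq.IsC2UpToBoundary Ω u →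
        (∀ x ∈ Ω, HessianEq.eigenvaluesOf (HessianEq.hessian u x) ∈
          HessianEq.gardingCone n (n - 1)) →
        (∀ x ∈ Ω, HessianEq.sigma (n - 1) (HessianEq.eigenvaluesOf (HessianEq.hessian u x)) =
          ψ (x, u x, ∇ u x)) →
        (∀ x ∈ frontier Ω, u x = 0) →
        (∀ x ∈ Ω, |u x| ≤ M₀) →
        (∀ x ∈ Ω, ‖∇ u x‖ ≤ M₁) →
        HessianEq.C11NormLE ψ (HessianEq.box Ω M₀ M₁) N →
        (∀ x ∈ Ω, m ≤ ψ (x, u x, ∇ u x)) →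
        ∀ x ∈ Ω, u x < 0 ∧ (-u x) ^ β * HessianEq.matNorm (HessianEq.hessian u x) ≤ C := by
  -- Each summand serves one of the two lower bounds on `A`. The absolute value is needed because `N
  -- ≥ 0` is only known once a point of Ω is given.
  obtain ⟨A, hA⟩ : ∃ A, A = 64 * (2 + 720 * (n : ℝ)) * N ^ 2 / m ^ 2 + 8 * (4 * |N| + 1) / m :=
    ⟨_, rfl⟩
  have hA₁ : 0 ≤ 64 * (2 + 720 * (n : ℝ)) * N ^ 2 / m ^ 2 := by positivity
  have hA₂ : 0 ≤ 8 * (4 * |N| + 1) / m := by positivity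
  have hA0 : 0 ≤ A := by linarith
  -- The summand 1 ensures `β ≥ 1`, so that `(-u)^(β - 1) ≤ M₀^(β - 1)` after one factor `-u` is
  -- spent on the bound for `l i₀ * (-u)`.
  obtain ⟨β, hβ⟩ : ∃ β, β = 288 * (n : ℝ) + 4 * A * M₁ ^ 2 + 1 := ⟨_, rfl⟩
  have hβ₁ : 0 ≤ 4 * A * M₁ ^ 2 := by positivity
  have hβ₂ : 0 ≤ 288 * (n : ℝ) := by positivity
  refine ⟨β, n * (n * (M₀ ^ (β - 1) * Real.exp (A / 2 * M₁ ^ 2) *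
    (β * N * (n - 1 + M₁) + (N + A * N * (M₁ + M₁ ^ 2)) * M₀ + (1 + M₁) * M₀))),
    by linarith, ?_⟩
  intro Ω ψ u hΩ hb hψ _ hu hC2 hcone heq hbd hM₀ hM₁ hN hmψ x hx
  have hu4 : ∀ y ∈ Ω, ContDiffAt ℝ 4 u y := fun y hy => hu.contDiffAt (hΩ.mem_nhds hy)
  have hu2 : ∀ y ∈ Ω, ContDiffAt ℝ 2 u y := fun y hy => (hu4 y hy).of_le (by norm_num)
  have hneg : ∀ y ∈ Ω, u y < 0 := fun y hy =>
    HessianEq.neg_of_admissible hn hΩ hb hu2 hC2.2.1 hcone hbd hy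
  have htrace : ∀ y ∈ Ω, (HessianEq.hessian u y).adjugate.trace = ψ (y, u y, ∇ u y) :=
    fun y hy => by
      rw [← heq y hy, HessianEq.sigma_eigenvaluesOf (by omega)
        (HessianEq.hessian_isHermitian (hu2 y hy))]
  have hN0 : 0 ≤ N := (norm_nonneg _).trans (hN.2.1 (x, u x, ∇ u x) ⟨hx, hM₀ x hx, hM₁ x hx⟩)
  obtain ⟨y, hy, b, l, i₀, j, k, hframe, hl, hk, hkj, hmax⟩ :=
    HessianEq.exists_maximum hn hΩ hb hu2 hC2 hcone hbd hneg ⟨x, hx⟩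
      (show 0 < β by linarith) A
  have hbound := HessianEq.top_mul_le_of_maximum hΩ hy (hu4 y hy) hframe hl hk hkj hψ.2.1 hM₀ hM₁
    hN htrace hm (hmψ y hy) hA0
    (by
      have : 64 * (2 + 720 * (n : ℝ)) * N ^ 2 / m ^ 2
          = 4 * (16 * (2 + 720 * (n : ℝ)) * N ^ 2 / m ^ 2) := by ring
      linarith)
    (by
      have h1 : 8 * (4 * |N| + 1) / m * m = 8 * (4 * |N| + 1) := div_mul_cancel₀ _ hm.ne'
      have h2 : 8 * (4 * |N| + 1) / m * m ≤ A * m :=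
        mul_le_mul_of_nonneg_right (by linarith) hm.le
      linarith [le_abs_self N])
    (show 288 * (n : ℝ) ≤ β by linarith) (by linarith) (hneg y hy)
    (Filter.mem_of_superset (hΩ.mem_nhds hy) fun z hz => hmax z hz)
  refine ⟨hneg x hx, ?_⟩
  obtain ⟨b', l', i₁, j', k', hframe', hl', hk', hkj'⟩ :=
    HessianEq.exists_isEigenframe hn (hu2 x hx) (hcone x hx)
  -- Negative eigenvalues are dominated by the largest one, so the test function controls the whole
  -- Hessian.
  have habs : ∀ c, |l' c| ≤ l' i₁ := fun c => by
    have h1 := hl'.neg_top_lt hk' hkj' c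
    have h2 := hl'.le_top c
    have h3 := hl'.top_pos
    rw [abs_le]
    constructor <;> linarith
  have hmat := hframe'.matNorm_le habs (by omega)
  have hx0 : 0 < -u x := by linarith [hneg x hx]
  have hy0 : 0 < -u y := by linarith [hneg y hy]
  have hpow : 0 < (-u x) ^ β := Real.rpow_pos_of_pos hx0 _
  have hatx := hmax x hx (b' i₁)
  rw [hframe' i₁, real_inner_self_eq_norm_sq, b'.norm_eq_one, one_pow, mul_one, mul_one] at hatx
  have h1 : (-u x) ^ β * l' i₁
      ≤ (-u x) ^ β * Real.exp (A / 2 * ‖∇ u x‖ ^ 2) * l' i₁ := by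
    refine mul_le_mul_of_nonneg_right ?_ hl'.top_pos.le
    exact le_mul_of_one_le_right hpow.le (Real.one_le_exp (by positivity))
  have hwM : -u y ≤ M₀ := (neg_le_abs _).trans (hM₀ y hy)
  have hsplit : (-u y) ^ β = (-u y) ^ (β - 1) * -u y := by
    rw [← Real.rpow_add_one hy0.ne', sub_add_cancel]
  have h2 : (-u y) ^ β * Real.exp (A / 2 * ‖∇ u y‖ ^ 2) * l i₀
      = (-u y) ^ (β - 1) * Real.exp (A / 2 * ‖∇ u y‖ ^ 2) * (l i₀ * -u y) := by
    rw [hsplit]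
    ring
  have h3 : (-u y) ^ (β - 1) ≤ M₀ ^ (β - 1) := Real.rpow_le_rpow hy0.le hwM (by linarith)
  have h4 : Real.exp (A / 2 * ‖∇ u y‖ ^ 2) ≤ Real.exp (A / 2 * M₁ ^ 2) := by
    have := pow_le_pow_left₀ (norm_nonneg _) (hM₁ y hy) 2
    gcongr
  have hM0 : 0 ≤ M₀ := hy0.le.trans hwM
  have h5 := mul_le_mul (mul_le_mul h3 h4 (Real.exp_pos _).le (Real.rpow_nonneg hM0 _)) hbound
    (mul_nonneg hl.top_pos.le hy0.le)
    (mul_nonneg (Real.rpow_nonneg hM0 _) (Real.exp_pos _).le)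
  calc (-u x) ^ β * HessianEq.matNorm (HessianEq.hessian u x)
      ≤ (-u x) ^ β * (n * (n * l' i₁)) := mul_le_mul_of_nonneg_left hmat hpow.le
    _ = n * (n * ((-u x) ^ β * l' i₁)) := by ring
    _ ≤ _ := by
      have h6 := (h1.trans hatx).trans (h2.le.trans h5)
      gcongr
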